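/- **Conventions.** Graphs are finite, simple and without isolated vertices; subgraphs of $K$ correspond to subsets of $E(K)$, and $V(H)$ is the set of vertices incident to an edge of $H$. Write $e(H)=|E(H)|$, $v(H)=|V(H)|$. A fractional vertex cover of $H$ is a tuple $(c_v)_{v\in V(H)}$ with $c_v\ge 0$ and $c_u+c_v\ge 1$ for every edge $uv$; $c(H)$ is the minimum of $\sum_v c_v$ over these. Let $$\gamma=\gamma(K)=\max_{\emptyset\ne H\subseteq K}\frac{e(H)-v(H)}{c(H)}.$$ A subgraph $H\subseteq K$ (possibly empty) is *contributing* if it has minimum degree at least $2$ and $e(H)-v(H)=c(H)\gamma(K)$. A set $A\subseteq V(H)$ is *valid* if some fractional vertex cover of total weight $c(H)$ has $c_v=1$ for $v\in A$ and $c_v\in\{0,\tfrac12\}$ for $v\in V(H)\setminus A$. Let $$P_K(z,w)=\sum_{H\text{ contributing}}\ \sum_{A\subseteq V(H)\text{ valid}}z^{|A|}w^{c(H)-|A|},\qquad \rho(K,\delta)=\min_{z,w\ge 0,\ P_K(z,w)\ge 1+\delta}\Big(z+\frac w2\Big).$$ The $2$-core of $K$ is its largest subgraph of minimum degree at least $2$.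 A graphon is a symmetric measurable $W:[0,1]^2\to[0,1]$; it is $p$-regular if $\int_0^1W(x,y)\,dy=p$ for all $x\in[0,1]$. For $0<p<1$ let $I_p(x)=x\log\frac xp+(1-x)\log\frac{1-x}{1-p}$ (with $I_p(0)=\log\frac1{1-p}$, $I_p(1)=\log\frac1p$) and $I_p(W)=\int_0^1\!\int_0^1I_p(W(x,y))\,dx\,dy$. For symmetric measurable $W:[0,1]^2\to\mathbb R$ let $\mathrm{Hom}(K,W)=\int_{[0,1]^{V(K)}}\prod_{uv\in E(K)}W(x_u,x_v)\,dx$. A block graphon on $k$ blocks is a graphon with a partition $[0,1]=S_1\cup\dots\cup S_k$ into intervals such that $W$ is equal to a constant $w_{ij}$ on each $S_i\times S_j$; $m(S_i)$ is the length of $S_i$. For $B:V(K)\to\{1,\dots,k\}$, $\mathrm{Hom}_B(K,W)$ is the integral defining $\mathrm{Hom}(K,W)$ restricted to $\{x: x_v\in S_{B(v)}\ \forall v\}$. **Conditions (C).** Let $n=n_t\to\infty$ be integers, $p=p_t$ reals, and $W=W_t$ block graphons on a fixed number $k$ of blocks; asymptotics are as $t\to\infty$, and $f\ll g$ means $f=o(g)$.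 Call $B$ *negligible* if $\mathrm{Hom}_B(K,W)=o(p^{e(K)})$. Call $(i,j)$ *important* if $i,j\le k-1$ and $m(S_i)m(S_j)w_{ij}\ll(\log\log\log\frac1p)^{-1}I_p(W)$, and *unimportant* otherwise; an important $(i,j)$ is *very important* if $w_{ij}=1$ (for all large $t$) and *somewhat important* otherwise. The conditions are: $p>0$ eventually, $n^{-1}\log\log n\ll p\ll 1$, and 1. $W$ is $p$-regular; 2. $m(S_k)\ge 1-p$; 3. $\mathrm{Hom}(K,W)\ge(1+\eta)p^{e(K)}$ for some constant $\eta>0$; 4. $n^{-1}\log n\ll I_p(W)\ll p^{2e(K)}n$; 5. $m(S_i)\gg n^{-1}$ for all $i$; 6. for all $i,j\le k-1$: $w_{ij}\ge p$, and either $w_{ij}=p$ or $(i,j)$ is important; 7. if $B$ is non-negligible, the edges $uv$ of $K$ with $(B(u),B(v))$ somewhat important form a matching; 8. if $B$ is non-negligible, $uv\in E(K)$ and $(i,j)=(B(u),B(v))$ is unimportant, then $m(S_i)m(S_j)\ge(1+o(1))p^{-1}I_p(W)$ and $w_{ij}=p+o(p)$; 9. $w_{ij}m(S_i)\gg n^{-1}\log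 n$ for all important $(i,j)$; 10. $\mathrm{Hom}(K,W+p)=O(p^{e(K)})$ (where 1, 2, 3 and the (in)equalities in 6 are required for all sufficiently large $t$). **Theorem.** Let $K$ be a graph that is not a forest and whose $2$-core is not a disjoint union of cycles, and let $\delta>0$. Then, as $p\to0^+$ (implied constants and rates depending only on $K,\delta$), $$p^{2+\gamma(K)}\lesssim\inf_{\substack{W\ p\text{-regular}\\ \mathrm{Hom}(K,W)\ge(1+\delta)p^{e(K)}}}I_p(W)\le(2+o(1))\,\rho(K,\delta)\,p^{2+\gamma(K)}\log\frac1p .$$ Furthermore, the upper bound is attained by explicit block graphons: there are a minimizer $(z_0,w_0)$ in the definition of $\rho(K,\delta)$, numbers $z(p)\to z_0$, $w(p)\to w_0$, and block graphons $W_p$ on a fixed number of blocks such that, for all sufficiently small $p>0$, $W_p$ is $p$-regular, $\mathrm{Hom}(K,W_p)\ge(1+\delta)p^{e(K)}$, and, with $z=z(p)$ and $w=w(p)$, $W_p$ has one of the following forms, where the entries marked $*$ are those forced by $p$-regularity: * (hub; $z>0=w$) intervals with successive endpoints $0,\ zp^{1+\gamma},\ p,\ 1$ and values $\begin{pmatrix}1&1&0\\1&p&*\\0&*&*\end{pmatrix}$;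 * (clique; $z=0<w$) intervals with endpoints $0,\ \sqrt w\,p^{1+\gamma/2},\ 1$ and values $\begin{pmatrix}1&*\\ *&*\end{pmatrix}$; * (hub and clique; $z,w>0$) intervals with endpoints $0,\ zp^{1+\gamma},\ \sqrt w\,p^{1+\gamma/2},\ p,\ 1$ and values $\begin{pmatrix}1&1&1&0\\1&1&p&*\\1&p&p&*\\0&*&*&*\end{pmatrix}$; moreover $I_p(W_p)=(2+o(1))\rho(K,\delta)p^{2+\gamma(K)}\log\frac1p$ as $p\to 0^+$, and for all sequences of integers $n_t\to\infty$ and reals $p_t\to0^+$ with $(n_t^{-1}\log n_t)^{1/(2e(K)-2-\gamma(K))}\ll p_t$, the graphons $W_{p_t}$ satisfy the conditions (C). -/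

import Mathlib

open Filter Topology MeasureTheory Asymptotics
open scoped unitInterval

noncomputable section

/-! ## Graph invariants

All graphs are finite and simple. Subgraphs of `K` are taken without isolated vertices, so they are
the same as subsets of the edge set, i.e. the `H : SimpleGraph V` with `H ≤ K`; the vertex set of
such an `H` is the set `H.support` of its non-isolated vertices. -/

namespace SimpleGraph

variable {V : Type*}

/-- `e(H)`, the number of edges. -/
def numEdges (H : SimpleGraph V) : ℕ := H.edgeSet.ncard

/-- `v(H)`, the number of non-isolated vertices. -/
def numVerts (H : SimpleGraph V) : ℕ := H.support.ncard

/-- Every (non-isolated) vertex of `H` has degree at least `2`. -/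
def MinDegTwo (H : SimpleGraph V) : Prop :=
  ∀ v ∈ H.support, 2 ≤ (H.neighborSet v).ncard

/-- The `2`-core: the largest subgraph with minimum degree at least `2` (see
`twoCore_isGreatest`); equivalently, what is left after successively removing all leaves. -/
def twoCore (K : SimpleGraph V) : SimpleGraph V :=
  sSup {H | H ≤ K ∧ H.MinDegTwo}

theorem twoCore_isGreatest [Finite V] (K : SimpleGraph V) :
    IsGreatest {H | H ≤ K ∧ H.MinDegTwo} K.twoCore := by
  refine ⟨⟨sSup_le fun H hH => hH.1, ?_⟩, fun H hH => le_sSup hH⟩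
  rintro v ⟨u, hu⟩
  obtain ⟨H, hH, hvu⟩ := (SimpleGraph.sSup_adj).1 hu
  refine (hH.2 v ⟨u, hvu⟩).trans (Set.ncard_le_ncard ?_ (Set.toFinite _))
  intro x hx
  exact (SimpleGraph.sSup_adj).2 ⟨H, hH, hx⟩

/-- Fractional vertex covers. (Isolated vertices may carry weight here; those of a minimum
fractional vertex cover necessarily have weight `0`.) -/
def IsFracVertexCover (H : SimpleGraph V) (c : V → ℝ) : Prop :=
  (∀ v, 0 ≤ c v) ∧ ∀ u v, H.Adj u v → 1 ≤ c u + c v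

variable [Fintype V]

/-- `c(H)`, the minimum total weight of a fractional vertex cover. -/
def fracCoverNum (H : SimpleGraph V) : ℝ :=
  sInf {s | ∃ c : V → ℝ, H.IsFracVertexCover c ∧ s = ∑ v, c v}

/-- `γ(K)`, the maximum of `(e(H) - v(H)) / c(H)` over the nonempty subgraphs `H ⊆ K`
(a maximum of finitely many numbers). -/
def gammaInv (K : SimpleGraph V) : ℝ :=
  sSup {r | ∃ H : SimpleGraph V, H ≤ K ∧ H ≠ ⊥ ∧
    r = ((H.numEdges : ℝ) - H.numVerts) / H.fracCoverNum}

/-- `H` is a contributing subgraph of `K`. (The empty subgraph is contributing.) -/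
def IsContributing (K H : SimpleGraph V) : Prop :=
  H ≤ K ∧ H.MinDegTwo ∧ (H.numEdges : ℝ) - H.numVerts = H.fracCoverNum * K.gammaInv

/-- `A ⊆ V(H)` is valid: some minimum fractional vertex cover is `1` exactly on `A` and takes
values in `{0, 1/2}` off `A`. -/
def IsValidSet (H : SimpleGraph V) (A : Finset V) : Prop :=
  (A : Set V) ⊆ H.support ∧
    ∃ c : V → ℝ, H.IsFracVertexCover c ∧ ∑ v, c v = H.fracCoverNum ∧
      (∀ v ∈ A, c v = 1) ∧ ∀ v ∉ A, c v = 0 ∨ c v = 1 / 2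

open Classical in
/-- `P_K(z, w)`. The exponent `c(H) - |A|` is a nonnegative half-integer, and `0 ^ 0 = 1`. -/
def upperTailPoly (K : SimpleGraph V) (z w : ℝ) : ℝ :=
  ∑ H : SimpleGraph V with K.IsContributing H, ∑ A : Finset V with H.IsValidSet A,
    z ^ A.card * w ^ (H.fracCoverNum - (A.card : ℝ))

/-- `ρ(K, δ)`, the minimum of `z + w / 2` over `z, w ≥ 0` with `P_K(z, w) ≥ 1 + δ`. -/
def rho (K : SimpleGraph V) (δ : ℝ) : ℝ :=
  sInf {s | ∃ z w : ℝ, 0 ≤ z ∧ 0 ≤ w ∧ 1 + δ ≤ K.upperTailPoly z w ∧ s = z + w / 2}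

end SimpleGraph

/-! ## Graphons -/

/-- A symmetric measurable function `[0,1]² → ℝ`. -/
structure SymmKernel where
  toFun : I → I → ℝ
  measurable : Measurable (Function.uncurry toFun)
  symm : ∀ x y, toFun x y = toFun y x

/-- A graphon: a symmetric measurable function `[0,1]² → [0,1]`. -/
structure Graphon extends SymmKernel where
  mem_Icc : ∀ x y, toFun x y ∈ Set.Icc (0 : ℝ) 1

namespace SymmKernel

variable {V : Type*}

/-- The kernel `W + p`. -/
def addConst (W : SymmKernel) (p : ℝ) : SymmKernel where
  toFun x y := W.toFun x y + p
  measurable := W.measurable.add_const p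
  symm x y := by rw [W.symm x y]

/-- `W(x_u, x_v)` as a function of the unordered pair `uv`. -/
def edgeVal (W : SymmKernel) (x : V → I) : Sym2 V → ℝ :=
  Sym2.lift ⟨fun u v => W.toFun (x u) (x v), fun u v => W.symm (x u) (x v)⟩

open Classical in
/-- `∏_{uv ∈ E(K)} W(x_u, x_v)`. -/
def edgeProd [Fintype V] (K : SimpleGraph V) (W : SymmKernel) (x : V → I) : ℝ :=
  ∏ e ∈ K.edgeFinset, W.edgeVal x e

/-- `Hom(K, W)`. -/
def hom [Fintype V] (K : SimpleGraph V) (W : SymmKernel) : ℝ :=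
  ∫ x : V → I, edgeProd K W x

end SymmKernel

/-- `I_p(x)`; at `x = 0` and `x = 1` this is `log (1 / (1 - p))` and `log (1 / p)`, the limiting
values. -/
def relEntropy (p x : ℝ) : ℝ :=
  x * Real.log (x / p) + (1 - x) * Real.log ((1 - x) / (1 - p))

namespace Graphon

/-- `I_p(W)`. -/
def entropy (p : ℝ) (W : Graphon) : ℝ :=
  ∫ x : I, ∫ y : I, relEntropy p (W.toFun x y)

/-- `W` is `p`-regular. -/
def IsRegular (p : ℝ) (W : Graphon) : Prop :=
  ∀ x : I, ∫ y : I, W.toFun x y = p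

end Graphon

/-- The infimum of `I_p(W)` over the `p`-regular graphons `W` with
`Hom(K, W) ≥ (1 + δ) p ^ e(K)`. -/
def minEntropy {V : Type*} [Fintype V] (K : SimpleGraph V) (δ p : ℝ) : ℝ :=
  sInf {s | ∃ W : Graphon, W.IsRegular p ∧
    (1 + δ) * p ^ K.numEdges ≤ W.toSymmKernel.hom K ∧ s = W.entropy p}

/-! ## Block graphons -/

/-- A block graphon with `m + 1` blocks: a partition of `[0,1]` into intervals
`S_i = part ⁻¹' {i}`, and the value `val i j` on `S_i × S_j`. -/
structure BlockGraphon (m : ℕ) where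
  part : I → Fin (m + 1)
  interval : ∀ i, (part ⁻¹' {i}).OrdConnected
  val : Fin (m + 1) → Fin (m + 1) → ℝ
  val_symm : ∀ i j, val i j = val j i
  val_mem : ∀ i j, val i j ∈ Set.Icc (0 : ℝ) 1

namespace BlockGraphon

variable {m : ℕ} {V : Type*} [Fintype V]

theorem measurable_part (W : BlockGraphon m) : Measurable W.part :=
  measurable_to_countable' fun i => (W.interval i).measurableSet

/-- The underlying graphon. -/
def toGraphon (W : BlockGraphon m) : Graphon where
  toFun x y := W.val (W.part x) (W.part y)
  measurable :=
    (measurable_of_countable (Function.uncurry W.val)).comp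
      ((W.measurable_part.comp measurable_fst).prodMk (W.measurable_part.comp measurable_snd))
  symm _ _ := W.val_symm _ _
  mem_Icc _ _ := W.val_mem _ _

/-- `m(S_i)`, the length of the `i`-th interval. -/
def len (W : BlockGraphon m) (i : Fin (m + 1)) : ℝ :=
  volume.real (W.part ⁻¹' {i})

/-- `I_p(W)`. -/
def entropy (p : ℝ) (W : BlockGraphon m) : ℝ := W.toGraphon.entropy p

/-- `Hom(K, W)`. -/
def hom (K : SimpleGraph V) (W : BlockGraphon m) : ℝ := W.toGraphon.toSymmKernel.hom K

/-- `Hom_B(K, W)`: the part of the integral `Hom(K, W)` over the `x` with `x_v ∈ S_{B(v)}` for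
all vertices `v`. -/
def homBlock (K : SimpleGraph V) (W : BlockGraphon m) (B : V → Fin (m + 1)) : ℝ :=
  ∫ x in {x : V → I | ∀ v, W.part (x v) = B v}, SymmKernel.edgeProd K W.toGraphon.toSymmKernel x

end BlockGraphon

/-! ## The conditions on a sequence of block graphons

We have `n = n t`, `p = p t` and block graphons `W = W t` on a fixed number `m + 1` of blocks;
asymptotics are for `t → ∞`. The last of the blocks plays a special role. -/

section Conditions

variable {V : Type*} [Fintype V] {m : ℕ}

/-- The block `(i, j)` is important: `i, j` are not the last index and
`m(S_i) m(S_j) w_{ij} ≪ (log log log (1/p))⁻¹ I_p(W)`. -/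
def IsImportantBlock (p : ℕ → ℝ) (W : ℕ → BlockGraphon m) (i j : Fin (m + 1)) : Prop :=
  i ≠ Fin.last m ∧ j ≠ Fin.last m ∧
    (fun t => (W t).len i * (W t).len j * (W t).val i j) =o[atTop]
      fun t => (Real.log (Real.log (Real.log (1 / p t))))⁻¹ * (W t).entropy (p t)

/-- An important block is very important if `w_{ij} = 1` and somewhat important otherwise. -/
def IsSomewhatImportantBlock (p : ℕ → ℝ) (W : ℕ → BlockGraphon m) (i j : Fin (m + 1)) : Prop :=
  IsImportantBlock p W i j ∧ ¬ ∀ᶠ t in atTop, (W t).val i j = 1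

/-- The `K`-block `B` is negligible: `Hom_B(K, W) = o(p ^ e(K))`. -/
def IsNegligible (K : SimpleGraph V) (p : ℕ → ℝ) (W : ℕ → BlockGraphon m)
    (B : V → Fin (m + 1)) : Prop :=
  (fun t => (W t).homBlock K B) =o[atTop] fun t => p t ^ K.numEdges

/-- The hypotheses on `n`, `p` and a sequence of block graphons under which the upper tail
probability of `Hom(K, G_n^d)` is bounded below in terms of the entropy of the graphons. -/
structure UpperTailLowerBoundConditions (K : SimpleGraph V) (n : ℕ → ℕ) (p : ℕ → ℝ)
    (W : ℕ → BlockGraphon m) : Prop where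
  range_lower : (fun t => (n t : ℝ)⁻¹ * Real.log (Real.log (n t))) =o[atTop] p
  range_upper : Tendsto p atTop (𝓝[>] 0)
  regular : ∀ᶠ t in atTop, (W t).toGraphon.IsRegular (p t)
  one_block_dominates : ∀ᶠ t in atTop, 1 - p t ≤ (W t).len (Fin.last m)
  many_copies : ∃ η : ℝ, 0 < η ∧ ∀ᶠ t in atTop, (1 + η) * p t ^ K.numEdges ≤ (W t).hom K
  entropy_lower :
    (fun t => (n t : ℝ)⁻¹ * Real.log (n t)) =o[atTop] fun t => (W t).entropy (p t)
  entropy_upper :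
    (fun t => (W t).entropy (p t)) =o[atTop] fun t => p t ^ (2 * K.numEdges) * (n t : ℝ)
  not_too_small : ∀ i, (fun t => (n t : ℝ)⁻¹) =o[atTop] fun t => (W t).len i
  dichotomy : ∀ i j, i ≠ Fin.last m → j ≠ Fin.last m →
    (∀ᶠ t in atTop, p t ≤ (W t).val i j) ∧
      ((∀ᶠ t in atTop, (W t).val i j = p t) ∨ IsImportantBlock p W i j)
  /-- The edges that a non-negligible `B` sends into somewhat important blocks form a matching. -/
  somewhat_important : ∀ B : V → Fin (m + 1), ¬ IsNegligible K p W B →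
    ∀ u v v', K.Adj u v → K.Adj u v' → IsSomewhatImportantBlock p W (B u) (B v) →
      IsSomewhatImportantBlock p W (B u) (B v') → v = v'
  /-- Unimportant blocks used by a non-negligible `B` have
  `m(S_i) m(S_j) ≥ (1 + o(1)) p⁻¹ I_p(W)` and `w_{ij} = p + o(p)`. -/
  unimportant : ∀ B : V → Fin (m + 1), ¬ IsNegligible K p W B →
    ∀ u v, K.Adj u v → ¬ IsImportantBlock p W (B u) (B v) →
      (∃ η : ℕ → ℝ, Tendsto η atTop (𝓝 0) ∧ ∀ᶠ t in atTop,
        (1 + η t) * ((p t)⁻¹ * (W t).entropy (p t)) ≤ (W t).len (B u) * (W t).len (B v)) ∧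
      (fun t => (W t).val (B u) (B v) - p t) =o[atTop] p
  high_degrees : ∀ i j, IsImportantBlock p W i j →
    (fun t => (n t : ℝ)⁻¹ * Real.log (n t)) =o[atTop] fun t => (W t).val i j * (W t).len i
  not_too_many_copies :
    (fun t => ((W t).toGraphon.toSymmKernel.addConst (p t)).hom K) =O[atTop]
      fun t => p t ^ K.numEdges

end Conditions

/-! ## The explicit block graphons -/

/-- The hub, clique, and hub-plus-clique block graphons with parameters `z` and `w`. The entries of
`val` that are not listed are determined by `p`-regularity, which is a separate requirement. -/
inductive IsHubCliqueGraphon (γ p z w : ℝ) : (m : ℕ) → BlockGraphon m → Prop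
  /-- Only a hub: intervals `[0, z p^(1+γ)]`, `(z p^(1+γ), p]`, `(p, 1]`. -/
  | hub (W : BlockGraphon 2) (hz : 0 < z) (hw : w = 0)
      (part_eq : ∀ x : I, W.part x =
        if (x : ℝ) ≤ z * p ^ (1 + γ) then 0 else if (x : ℝ) ≤ p then 1 else 2)
      (h00 : W.val 0 0 = 1) (h01 : W.val 0 1 = 1) (h02 : W.val 0 2 = 0)
      (h11 : W.val 1 1 = p) : IsHubCliqueGraphon γ p z w 2 W
  /-- Only a clique: intervals `[0, √w p^(1+γ/2)]`, `(√w p^(1+γ/2), 1]`. -/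
  | clique (W : BlockGraphon 1) (hz : z = 0) (hw : 0 < w)
      (part_eq : ∀ x : I, W.part x = if (x : ℝ) ≤ √w * p ^ (1 + γ / 2) then 0 else 1)
      (h00 : W.val 0 0 = 1) : IsHubCliqueGraphon γ p z w 1 W
  /-- Both: intervals `[0, z p^(1+γ)]`, `(z p^(1+γ), √w p^(1+γ/2)]`, `(√w p^(1+γ/2), p]`,
  `(p, 1]`. -/
  | hubClique (W : BlockGraphon 3) (hz : 0 < z) (hw : 0 < w)
      (part_eq : ∀ x : I, W.part x =
        if (x : ℝ) ≤ z * p ^ (1 + γ) then 0 else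
          if (x : ℝ) ≤ √w * p ^ (1 + γ / 2) then 1 else if (x : ℝ) ≤ p then 2 else 3)
      (h00 : W.val 0 0 = 1) (h01 : W.val 0 1 = 1) (h02 : W.val 0 2 = 1) (h03 : W.val 0 3 = 0)
      (h11 : W.val 1 1 = 1) (h12 : W.val 1 2 = p) (h22 : W.val 2 2 = p) :
      IsHubCliqueGraphon γ p z w 3 W

end

/-!
Write `γ = γ(K)`. By definition, `e(H) - v(H) ≤ γ c(H)` for every `H ⊆ K`, and everything below is
an application of this inequality to suitable edge sets (`SimpleGraph.card_le_of_cover`). It is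
useful because `γ > 0`: a graph of minimum degree at least `2` that is not a union of
cycles has more edges than vertices.

*Lower bound.* Let `W` be `p`-regular with entropy less than `c p ^ (2 + γ)`. Fix `r > 1` and let `U`
be the part of `W` where it is at least `r p`. There the relative entropy is at least a constant
times `W`, so `U` has small total mass `Θ = ε p ^ (2 + γ)`, and by regularity its rows have mass at
most `p`. Expanding `W ≤ r p + U` over the edges of `K` reduces the claim to bounding the number of
copies of each nonempty `H ⊆ K` in `U`. By Finner's inequality, applied with a maximum
fractional matching of weight `Y ≥ c(H)`, it is at most `Θ ^ Y p ^ (v(H) - 2 Y)`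
(`exists_lintegral_prod_pairVal_le`), which is at most `ε p ^ e(H)` since
`γ Y ≥ γ c(H) ≥ e(H) - v(H)`. That `Y ≥ c(H)` is the half-integral duality of
`SimpleGraph.exists_cover_matching`, a form of König's theorem. Hence there are too few copies of `K`.

*Upper bound.* The explicit graphons have a common shape, `HubCliqueProfile`: a block `i` has a
weight `κ i` and a length of order `p ^ (1 + γ κ i)`, and the value on `(i, j)` is `1` if
`κ i + κ j ≥ 1` and asymptotic to `p` otherwise, except that the hub and the last block have value
`0`. An assignment `B` of blocks to the vertices of `K` yields a fractional vertex cover `κ ∘ B` of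
the edges on blocks of value `1`, and `B` contributes to the order `p ^ e(K)` only if the inequality
for `γ` is an equality for these edges. A contributing subgraph with a valid set gives such
an assignment, in which the neighbours outside the subgraph of a vertex in the hub are put in
`[0, p]`; different pairs give different assignments (`SimpleGraph.IsContributing.card_covered`), so
`Hom(K, W)` is asymptotically at least `P_K(z, w) p ^ e(K)` (`HubCliqueProfile.eventually_le_hom`).
The entropy is dominated by the blocks of value `1` with `κ i + κ j = 1`, which give
`2 z + w` times `p ^ (2 + γ) log (1 / p)` (`HubCliqueProfile.entropy_tendsto`); the values forced by
regularity are so close to `p` that the `χ²` bound on the relative entropy makes them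
negligible. Starting with a minimizer `(z₀, w₀)` and scaling it by `1 + s(p)` with `s(p) → 0` slowly
gives enough copies of `K` for every small `p`.

*The conditions.* They also follow from the inequality for `γ`, see
`HubCliqueProfile.upperTailLowerBoundConditions`. For instance, if a non-negligible `B` had two
incident edges on somewhat important blocks, then raising the weight of their common vertex by at
most `1 / γ` would cover two more edges, while the inequality allows only one.
-/

/-! ### Fractional vertex covers and fractional matchings -/

namespace SimpleGraph

section Duality

variable {V : Type*}

theorem isFracVertexCover_one (H : SimpleGraph V) : H.IsFracVertexCover fun _ => 1 :=
  ⟨fun _ => zero_le_one, fun _ _ _ => by norm_num⟩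

variable [Fintype V] {H H' : SimpleGraph V}

theorem IsFracVertexCover.fracCoverNum_le {c : V → ℝ} (hc : H.IsFracVertexCover c) :
    H.fracCoverNum ≤ ∑ v, c v := by
  refine csInf_le ⟨0, ?_⟩ ⟨c, hc, rfl⟩
  rintro _ ⟨_, hc, rfl⟩
  exact Finset.sum_nonneg fun v _ => hc.1 v

theorem le_fracCoverNum {a : ℝ} (h : ∀ c, H.IsFracVertexCover c → a ≤ ∑ v, c v) :
    a ≤ H.fracCoverNum := by
  refine le_csInf ⟨_, _, H.isFracVertexCover_one, rfl⟩ ?_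
  rintro _ ⟨c, hc, rfl⟩
  exact h c hc

theorem fracCoverNum_mono (h : H ≤ H') : H.fracCoverNum ≤ H'.fracCoverNum :=
  le_fracCoverNum fun _ hc =>
    IsFracVertexCover.fracCoverNum_le ⟨hc.1, fun u v huv => hc.2 u v (h huv)⟩

theorem fracCoverNum_nonneg (H : SimpleGraph V) : 0 ≤ H.fracCoverNum :=
  le_fracCoverNum fun _ hc => Finset.sum_nonneg fun v _ => hc.1 v

theorem one_le_fracCoverNum (hH : H ≠ ⊥) : 1 ≤ H.fracCoverNum := by
  classical
  obtain ⟨a, b, hab⟩ := SimpleGraph.ne_bot_iff_exists_adj.1 hH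
  refine le_fracCoverNum fun c hc => (hc.2 a b hab).trans ?_
  rw [← Finset.sum_pair hab.ne]
  exact Finset.sum_le_sum_of_subset_of_nonneg (Finset.subset_univ _) fun v _ _ => hc.1 v

theorem fracCoverNum_bot : (⊥ : SimpleGraph V).fracCoverNum = 0 := by
  refine le_antisymm ?_ (fracCoverNum_nonneg _)
  have : (⊥ : SimpleGraph V).IsFracVertexCover fun _ => 0 := ⟨fun _ => le_rfl, by simp⟩
  simpa using this.fracCoverNum_le

open Classical in
/-- A fractional matching: weights `y e ≥ 0` on the edges of `H` with total weight at most `1` at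
each vertex. It is a function on all of `Sym2 V` that vanishes off the edges. -/
def IsFracMatching (H : SimpleGraph V) (y : Sym2 V → ℝ) : Prop :=
  (∀ e, 0 ≤ y e) ∧ (∀ e ∉ H.edgeSet, y e = 0) ∧ ∀ v, ∑ e with v ∈ e, y e ≤ 1

open Classical in
theorem sum_mul_sum_mem_comm (y : Sym2 V → ℝ) (c : V → ℝ) :
    ∑ v, c v * ∑ e with v ∈ e, y e = ∑ e : Sym2 V, y e * ∑ v with v ∈ e, c v := by
  simp only [Finset.mul_sum, Finset.sum_filter]
  rw [Finset.sum_comm]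
  refine Finset.sum_congr rfl fun e _ => Finset.sum_congr rfl fun v _ => ?_
  split_ifs <;> ring

open Classical in
theorem sum_mem_mk {a b : V} (hab : a ≠ b) (c : V → ℝ) :
    ∑ v with v ∈ s(a, b), c v = c a + c b := by
  rw [← Finset.sum_pair hab]
  congr 1
  ext v
  simp

/-- Weak duality. -/
theorem IsFracMatching.sum_le {y : Sym2 V → ℝ} (hy : H.IsFracMatching y) {c : V → ℝ}
    (hc : H.IsFracVertexCover c) : ∑ e, y e ≤ ∑ v, c v := by
  classical
  calc ∑ e, y e ≤ ∑ e : Sym2 V, y e * ∑ v with v ∈ e, c v := by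
        refine Finset.sum_le_sum fun e _ => ?_
        induction e with | _ a b
        by_cases hab : H.Adj a b
        · rw [sum_mem_mk hab.ne]
          exact le_mul_of_one_le_right (hy.1 _) (hc.2 a b hab)
        · rw [hy.2.1 _ (by simpa using hab), zero_mul]
    _ = ∑ v, c v * ∑ e with v ∈ e, y e := by
        rw [← sum_mul_sum_mem_comm]
    _ ≤ ∑ v, c v := by
        refine Finset.sum_le_sum fun v _ => mul_le_of_le_one_right (hc.1 v) ?_
        convert hy.2.2 v

set_option maxHeartbeats 400000 in
open Classical in
/-- König's theorem for the bipartite double cover of `H`, read in `H` itself: a half-integral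
fractional vertex cover and a (half-integral) fractional matching of equal weight. It comes from
Hall's theorem with `d` dummy vertices added, where `d` is the largest deficiency
`|S| - |N(S)|`. -/
theorem exists_cover_matching (H : SimpleGraph V) :
    ∃ (c : V → ℝ) (y : Sym2 V → ℝ), H.IsFracVertexCover c ∧ (∀ v, c v = 0 ∨ c v = 1 / 2 ∨ c v = 1) ∧
      H.IsFracMatching y ∧ ∑ v, c v ≤ ∑ e, y e := by
  let N : Finset V → Finset V := fun S => Finset.univ.filter fun w => ∃ u ∈ S, H.Adj u w
  obtain ⟨S, -, hS⟩ := Finset.exists_max_image (Finset.univ : Finset (Finset V))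
    (fun S => (S.card : ℤ) - (N S).card) Finset.univ_nonempty
  have hd0 : (0 : ℤ) ≤ (S.card : ℤ) - (N S).card := by
    simpa [N] using hS ∅ (Finset.mem_univ _)
  obtain ⟨d, hd⟩ := Int.eq_ofNat_of_zero_le hd0
  -- `u` may be matched with its neighbours and with the `d` dummy vertices
  let t : V → Finset (V ⊕ Fin d) := fun u =>
    (Finset.univ.filter fun w => H.Adj u w).disjSum Finset.univ
  obtain ⟨f, hf, hft⟩ := (Finset.all_card_le_biUnion_card_iff_exists_injective t).1 (by
    intro T
    rcases T.eq_empty_or_nonempty with rfl | ⟨u₀, hu₀⟩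
    · simp
    have : T.biUnion t = (N T).disjSum Finset.univ := by
      ext x
      rcases x with w | i
      · simp [t, N]
      · simpa [t] using ⟨u₀, hu₀⟩
    rw [this, Finset.card_disjSum]
    have := hS T (Finset.mem_univ _)
    simp only [Finset.card_univ, Fintype.card_fin]
    omega)
  have hadj : ∀ u w, f u = Sum.inl w → H.Adj u w := by
    intro u w h
    simpa [t, h] using hft u
  -- `f` is now a matching in the double cover; the edge of `u`, if any, gets weight `1/2`
  let g : V → Sym2 V := fun u => Sum.elim (fun w => s(u, w)) (fun _ => s(u, u)) (f u)
  have hsum : ∀ (q : Sym2 V → Prop), (∑ e with q e, ∑ u, if g u = e ∧ (f u).isLeft then (1 / 2 : ℝ) else 0)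
      = ∑ u, if q (g u) ∧ (f u).isLeft then (1 / 2 : ℝ) else 0 := by
    intro q
    rw [Finset.sum_comm]
    refine Finset.sum_congr rfl fun u _ => ?_
    by_cases h : (f u).isLeft = true
    · simp [h]
    · simp [h]
  refine ⟨fun v => ((if v ∈ S then 0 else 1) + if v ∈ N S then 1 else 0) / 2,
    fun e => ∑ u, if g u = e ∧ (f u).isLeft then (1 / 2 : ℝ) else 0, ⟨?_, ?_⟩, ?_, ⟨?_, ?_, ?_⟩, ?_⟩
  · intro v
    positivity
  · intro u v huv
    have h1 : u ∈ S → v ∈ N S := fun h => by simpa [N] using ⟨u, h, huv⟩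
    have h2 : v ∈ S → u ∈ N S := fun h => by simpa [N] using ⟨v, h, huv.symm⟩
    dsimp only
    split_ifs <;> first | (exfalso; tauto) | norm_num
  · intro v
    dsimp only
    split_ifs <;> norm_num
  · intro e
    positivity
  · intro e he
    refine Finset.sum_eq_zero fun u _ => if_neg ?_
    rintro ⟨rfl, hl⟩
    rcases h : f u with w | i
    · exact he (by simpa [g, h] using hadj u w h)
    · simp [h] at hl
  · intro v
    calc _ = ∑ u, if v ∈ g u ∧ (f u).isLeft then (1 / 2 : ℝ) else 0 := by
          convert hsum fun e => v ∈ e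
      _ ≤ ∑ u, ((if u = v then (1 / 2 : ℝ) else 0) + if f u = Sum.inl v then 1 / 2 else 0) := by
          refine Finset.sum_le_sum fun u _ => ?_
          rcases h : f u with w | i
          · simp only [g, h, Sum.elim_inl, Sym2.mem_iff, Sum.isLeft_inl, and_true, Sum.inl.injEq]
            rw [eq_comm (a := v) (b := u), eq_comm (a := v) (b := w)]
            by_cases hu : u = v <;> by_cases hw : w = v <;> simp [hu, hw]
          · simp
            positivity
      _ ≤ 1 / 2 + 1 / 2 := by
          rw [Finset.sum_add_distrib]
          refine add_le_add (by simp) ?_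
          rw [Finset.sum_ite, Finset.sum_const_zero, add_zero, Finset.sum_const, nsmul_eq_mul]
          refine mul_le_of_le_one_left (by norm_num) ?_
          exact_mod_cast Finset.card_le_one.2 fun a ha b hb => hf (by simp_all)
      _ = 1 := by norm_num
  · have h1 := hsum fun _ => True
    simp only [Finset.filter_true, true_and] at h1
    rw [h1]
    have h2 : (Fintype.card V : ℝ) - d ≤ ∑ u, if (f u).isLeft then (1 : ℝ) else 0 := by
      have : ∑ u, (if (f u).isLeft then (0 : ℝ) else 1) ≤ d := by
        rw [Finset.sum_ite, Finset.sum_const_zero, zero_add, Finset.sum_const, nsmul_eq_mul, mul_one]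
        have := Finset.card_le_card_of_injOn (s := Finset.univ.filter fun u => ¬ (f u).isLeft = true)
          (t := (Finset.univ : Finset (Fin d)).map ⟨Sum.inr, Sum.inr_injective⟩) f (by
            intro u hu
            rcases h : f u with w | i
            · simp [h] at hu
            · simp) hf.injOn
        simpa using this
      have h3 : ∑ u, ((if (f u).isLeft then (1 : ℝ) else 0) + if (f u).isLeft then (0 : ℝ) else 1)
          = Fintype.card V := by
        rw [Finset.sum_congr rfl (g := fun _ => (1 : ℝ)) fun u _ => by split_ifs <;> simp]
        simp
      rw [Finset.sum_add_distrib] at h3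
      linarith
    have h3 : ∑ u, (if (f u).isLeft then (1 / 2 : ℝ) else 0)
        = (∑ u, if (f u).isLeft then (1 : ℝ) else 0) / 2 := by
      rw [Finset.sum_div]
      exact Finset.sum_congr rfl fun u _ => by split_ifs <;> simp
    rw [h3, ← Finset.sum_div, Finset.sum_add_distrib]
    have h4 : ∑ v, (if v ∈ S then (0 : ℝ) else 1) = Fintype.card V - S.card := by
      have : ∀ v, (if v ∈ S then (0 : ℝ) else 1) = 1 - if v ∈ S then 1 else 0 := fun v => by
        split_ifs <;> simp
      simp [this]
    have h5 : ∑ v, (if v ∈ N S then (1 : ℝ) else 0) = (N S).card := by simp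
    have h6 : (S.card : ℝ) - (N S).card = d := by exact_mod_cast hd
    rw [h4, h5]
    linarith

/-- A fractional matching of maximum weight: its weight is at least `c(H)` by duality. -/
theorem exists_max_fracMatching (H : SimpleGraph V) :
    ∃ y : Sym2 V → ℝ, H.IsFracMatching y ∧ H.fracCoverNum ≤ ∑ e, y e ∧
      ∀ y', H.IsFracMatching y' → ∑ e, y' e ≤ ∑ e, y e := by
  classical
  obtain ⟨c, y₀, hc, -, hy₀, hcy⟩ := H.exists_cover_matching
  have hcpt : IsCompact {y | H.IsFracMatching y} := by
    refine (isCompact_univ_pi fun _ : Sym2 V =>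
      isCompact_Icc (a := (0 : ℝ)) (b := 1)).of_isClosed_subset ?_ ?_
    · simp only [IsFracMatching, Set.ofPred_and, Set.ofPred_forall]
      refine (isClosed_iInter fun e => isClosed_le continuous_const (continuous_apply e)).inter
        ((isClosed_iInter fun e => isClosed_iInter fun _ =>
          isClosed_eq (continuous_apply e) continuous_const).inter
        (isClosed_iInter fun v => isClosed_le ?_ continuous_const))
      exact continuous_finsetSum _ fun e _ => continuous_apply e
    · intro y hy e _
      refine ⟨hy.1 e, ?_⟩
      induction e with | _ a b
      refine le_trans ?_ (hy.2.2 a)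
      exact Finset.single_le_sum (f := y) (fun e _ => hy.1 e) (by simp)
  obtain ⟨y, hy, hmax⟩ := hcpt.exists_isMaxOn ⟨y₀, hy₀⟩
    (continuous_finsetSum (Finset.univ : Finset (Sym2 V)) fun e _ =>
      continuous_apply (A := fun _ => ℝ) e).continuousOn
  exact ⟨y, hy, hc.fracCoverNum_le.trans (hcy.trans (hmax hy₀)), fun y' hy' => hmax hy'⟩

/-- A minimum fractional vertex cover that is half-integral. -/
theorem exists_half_integral_cover (H : SimpleGraph V) :
    ∃ c : V → ℝ, H.IsFracVertexCover c ∧ ∑ v, c v = H.fracCoverNum ∧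
      ∀ v, c v = 0 ∨ c v = 1 / 2 ∨ c v = 1 := by
  obtain ⟨c, y, hc, hc', hy, hcy⟩ := H.exists_cover_matching
  exact ⟨c, hc, le_antisymm (hcy.trans (le_fracCoverNum fun c' => hy.sum_le)) hc.fracCoverNum_le, hc'⟩

/-- A minimum fractional vertex cover vanishes at isolated vertices. -/
theorem IsFracVertexCover.eq_zero_of_notMem_support {c : V → ℝ} (hc : H.IsFracVertexCover c)
    (hmin : ∑ v, c v = H.fracCoverNum) {v : V} (hv : v ∉ H.support) : c v = 0 := by
  classical
  have hadj : ∀ w, ¬ H.Adj v w := fun w h => hv ⟨w, h⟩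
  have : H.IsFracVertexCover (Function.update c v 0) := by
    refine ⟨fun w => ?_, fun u w huw => ?_⟩
    · by_cases h : w = v
      · simp [h]
      · simpa [h] using hc.1 w
    · have hu : u ≠ v := fun h => hadj w (h ▸ huw)
      have hw : w ≠ v := fun h => hadj u (h ▸ huw.symm)
      simpa [hu, hw] using hc.2 u w huw
  have h1 := this.fracCoverNum_le
  have h2 := Finset.sum_update_of_mem (Finset.mem_univ v) c (0 : ℝ)
  have h3 := Finset.sum_eq_add_sum_sdiff_singleton_of_mem (Finset.mem_univ v) c
  have := hc.1 v
  linarith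

theorem exists_isValidSet (H : SimpleGraph V) : ∃ A, H.IsValidSet A := by
  classical
  obtain ⟨c, hc, hsum, hhalf⟩ := H.exists_half_integral_cover
  refine ⟨Finset.univ.filter fun v => c v = 1, fun v hv => ?_, c, hc, hsum, by simp, fun v hv => ?_⟩
  · by_contra h
    have := hc.eq_zero_of_notMem_support hsum h
    simp_all
  · have := hhalf v
    simp_all

end Duality

end SimpleGraph

/-! ### The exponent `γ(K)` -/

namespace SimpleGraph

section Gamma

variable {V : Type*}

theorem numEdges_bot : (⊥ : SimpleGraph V).numEdges = 0 := by
  simp [numEdges]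

theorem numVerts_bot : (⊥ : SimpleGraph V).numVerts = 0 := by
  simp [numVerts]

variable [Fintype V] {H K : SimpleGraph V}

open Classical in
theorem numEdges_eq_card : H.numEdges = H.edgeFinset.card := by
  rw [numEdges, ← coe_edgeFinset, Set.ncard_coe_finset]

theorem le_gammaInv (hHK : H ≤ K) (hH : H ≠ ⊥) :
    ((H.numEdges : ℝ) - H.numVerts) / H.fracCoverNum ≤ K.gammaInv := by
  classical
  refine le_csSup (Set.Finite.bddAbove ?_) ⟨H, hHK, hH, rfl⟩
  refine (Set.finite_range fun H : SimpleGraph V =>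
    ((H.numEdges : ℝ) - H.numVerts) / H.fracCoverNum).subset ?_
  rintro _ ⟨H, -, -, rfl⟩
  exact ⟨H, rfl⟩

theorem numEdges_sub_numVerts_le (hHK : H ≤ K) :
    (H.numEdges : ℝ) - H.numVerts ≤ K.gammaInv * H.fracCoverNum := by
  rcases eq_or_ne H ⊥ with rfl | hH
  · simp [numEdges_bot, numVerts_bot, fracCoverNum_bot]
  · exact (div_le_iff₀ (zero_lt_one.trans_le (one_le_fracCoverNum hH))).1 (le_gammaInv hHK hH)

/-- If `K` has a nonempty subgraph, the maximum defining `γ(K)` is attained. -/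
theorem exists_eq_gammaInv (hK : K ≠ ⊥) : ∃ H ≤ K, H ≠ ⊥ ∧
    (H.numEdges : ℝ) - H.numVerts = K.gammaInv * H.fracCoverNum := by
  classical
  have hfin : {r | ∃ H : SimpleGraph V, H ≤ K ∧ H ≠ ⊥ ∧
      r = ((H.numEdges : ℝ) - H.numVerts) / H.fracCoverNum}.Finite := by
    refine (Set.finite_range fun H : SimpleGraph V =>
      ((H.numEdges : ℝ) - H.numVerts) / H.fracCoverNum).subset ?_
    rintro _ ⟨H, -, -, rfl⟩
    exact ⟨H, rfl⟩
  have hne : {r | ∃ H : SimpleGraph V, H ≤ K ∧ H ≠ ⊥ ∧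
      r = ((H.numEdges : ℝ) - H.numVerts) / H.fracCoverNum}.Nonempty := ⟨_, K, le_rfl, hK, rfl⟩
  obtain ⟨H, hHK, hH, h⟩ := hne.csSup_mem hfin
  refine ⟨H, hHK, hH, ?_⟩
  rw [gammaInv, h, div_mul_cancel₀]
  exact (zero_lt_one.trans_le (one_le_fracCoverNum hH)).ne'

/-- Each vertex has degree at least `2`, and some vertex has degree at least `3`. -/
theorem numVerts_lt_numEdges (hH : H.MinDegTwo) (hc : ¬ H.IsCycles) :
    H.numVerts < H.numEdges := by
  classical
  have hdeg : ∀ v, H.degree v = (H.neighborSet v).ncard := fun v => by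
    rw [← card_neighborSet_eq_degree, Set.ncard_eq_toFinset_card', Set.toFinset_card]
  have hsum := H.sum_degrees_eq_twice_card_edges
  have hv : 2 * H.numVerts = ∑ v, if v ∈ H.support then 2 else 0 := by
    rw [Finset.sum_ite, Finset.sum_const_zero, add_zero, Finset.sum_const, smul_eq_mul, mul_comm,
      numVerts, Set.ncard_eq_toFinset_card']
    congr 2
    ext; simp
  have hle : ∀ v, (if v ∈ H.support then 2 else 0) ≤ H.degree v := fun v => by
    split_ifs with h
    · exact hdeg v ▸ hH v h
    · exact Nat.zero_le _
  obtain ⟨v, hv0, hv2⟩ : ∃ v, (H.neighborSet v).Nonempty ∧ (H.neighborSet v).ncard ≠ 2 := by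
    simpa [IsCycles] using hc
  have hlt : (if v ∈ H.support then 2 else 0) < H.degree v := by
    have hvs : v ∈ H.support := hv0
    rw [if_pos hvs, hdeg]
    exact lt_of_le_of_ne (hH v hvs) hv2.symm
  have := Finset.sum_lt_sum (fun v _ => hle v) ⟨v, Finset.mem_univ v, hlt⟩
  rw [numEdges_eq_card]
  omega

theorem gammaInv_pos (hcore : ¬ K.twoCore.IsCycles) : 0 < K.gammaInv := by
  have hlt := numVerts_lt_numEdges K.twoCore_isGreatest.1.2 hcore
  have hne : K.twoCore ≠ ⊥ := fun h => hcore (by rw [h]; intro v hv; simp at hv)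
  refine lt_of_lt_of_le (div_pos ?_ ?_) (le_gammaInv K.twoCore_isGreatest.1.1 hne)
  · exact sub_pos.2 (by exact_mod_cast hlt)
  · exact zero_lt_one.trans_le (one_le_fracCoverNum hne)

theorem ne_bot_of_not_isCycles (hcore : ¬ K.twoCore.IsCycles) : K ≠ ⊥ := by
  rintro rfl
  refine hcore ?_
  rw [le_bot_iff.1 (twoCore_isGreatest (⊥ : SimpleGraph V)).1.1]
  intro v hv
  simp at hv

/-- The defining inequality of `γ(K)` for an edge set `T`, a set `N` containing its endpoints, and
any fractional vertex cover `c` of `T`. -/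
theorem card_le_of_cover (hγ : 0 ≤ K.gammaInv) {T : Finset (Sym2 V)} (hT : (T : Set (Sym2 V)) ⊆ K.edgeSet)
    {N : Finset V} (hN : ∀ u v, s(u, v) ∈ T → u ∈ N) {c : V → ℝ} (hc0 : ∀ v, 0 ≤ c v)
    (hc : ∀ u v, s(u, v) ∈ T → 1 ≤ c u + c v) :
    (T.card : ℝ) ≤ N.card + K.gammaInv * ∑ v, c v := by
  classical
  set H := fromEdgeSet (T : Set (Sym2 V)) with hH
  have hadj : ∀ u v, H.Adj u v → s(u, v) ∈ T := fun u v h => by simpa using h.1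
  have hHK : H ≤ K := fun u v h => by simpa using hT (hadj u v h)
  have he : H.numEdges = T.card := by
    rw [numEdges, hH, edgeSet_fromEdgeSet, sdiff_eq_left.2, Set.ncard_coe_finset]
    rw [Set.disjoint_left]
    intro e he hd
    exact K.not_isDiag_of_mem_edgeSet (hT he) hd
  have hv : H.numVerts ≤ N.card := by
    rw [numVerts, ← Set.ncard_coe_finset]
    refine Set.ncard_le_ncard ?_ (Set.toFinite _)
    rintro u ⟨v, huv⟩
    exact hN u v (hadj u v huv)
  have hcov : H.IsFracVertexCover c := ⟨hc0, fun u v h => hc u v (hadj u v h)⟩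
  have h1 := numEdges_sub_numVerts_le hHK
  have h2 := mul_le_mul_of_nonneg_left hcov.fracCoverNum_le hγ
  have h3 : (H.numVerts : ℝ) ≤ N.card := by exact_mod_cast hv
  rw [he] at h1
  linarith

theorem isContributing_bot : K.IsContributing ⊥ :=
  ⟨bot_le, fun v hv => by simp at hv, by simp [numEdges_bot, numVerts_bot, fracCoverNum_bot]⟩

/-- There is a nonempty contributing subgraph: a subgraph with as few edges as possible among those
attaining the maximum in `γ(K)` has no leaves, since removing a leaf does not decrease the ratio. -/
theorem exists_isContributing_ne_bot (hK : K ≠ ⊥) (hγ : 0 < K.gammaInv) :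
    ∃ H, K.IsContributing H ∧ H ≠ ⊥ := by
  classical
  obtain ⟨H, hH, hmin⟩ := Finset.exists_min_image (Finset.univ.filter fun H : SimpleGraph V =>
    H ≤ K ∧ H ≠ ⊥ ∧ (H.numEdges : ℝ) - H.numVerts = K.gammaInv * H.fracCoverNum) numEdges
    (by obtain ⟨H, h⟩ := exists_eq_gammaInv hK; exact ⟨H, by simpa using h⟩)
  simp only [Finset.mem_filter, Finset.mem_univ, true_and] at hH hmin
  obtain ⟨hHK, hne, heq⟩ := hH
  refine ⟨H, ⟨hHK, ?_, by rw [heq, mul_comm]⟩, hne⟩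
  rintro v ⟨u, hvu⟩
  by_contra! hlt
  have hnb : ∀ w, H.Adj v w → w = u := fun w hw => by
    by_contra hwu
    have := Set.ncard_le_ncard (s := {w, u}) (t := H.neighborSet v)
      (by rintro x (rfl | rfl) <;> assumption) (Set.toFinite _)
    rw [Set.ncard_pair hwu] at this
    omega
  -- `v` is a leaf, with neighbour `u`
  set H' := H.deleteEdges {s(v, u)} with hH'
  have hle : H' ≤ H := H.deleteEdges_le _
  have he : H'.numEdges + 1 = H.numEdges := by
    rw [numEdges, hH', edgeSet_deleteEdges]
    exact Set.ncard_sdiff_singleton_add_one hvu (Set.toFinite _)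
  have hv : H'.numVerts + 1 ≤ H.numVerts := by
    rw [numVerts, numVerts, ← Set.ncard_sdiff_singleton_add_one (s := H.support) ⟨u, hvu⟩ (Set.toFinite _)]
    refine Nat.succ_le_succ (Set.ncard_le_ncard ?_ (Set.toFinite _))
    rintro w ⟨x, hwx⟩
    refine ⟨⟨x, hle hwx⟩, ?_⟩
    rintro rfl
    have := hnb x (hle hwx)
    subst this
    simp [hH'] at hwx
  have hne' : H' ≠ ⊥ := by
    intro h
    have h1 : 0 < (H.numEdges : ℝ) - H.numVerts := by
      rw [heq]
      exact mul_pos hγ (zero_lt_one.trans_le (one_le_fracCoverNum hne))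
    have h2 : H'.numEdges = 0 := by rw [h, numEdges_bot]
    have h3 : H.numVerts < H.numEdges := by
      have := sub_pos.1 h1
      exact_mod_cast this
    omega
  have h1 := numEdges_sub_numVerts_le (hle.trans hHK)
  have h2 := mul_le_mul_of_nonneg_left (fracCoverNum_mono hle) hγ.le
  have he' : (H'.numEdges : ℝ) + 1 = H.numEdges := by exact_mod_cast he
  have hv' : (H'.numVerts : ℝ) + 1 ≤ H.numVerts := by exact_mod_cast hv
  have := hmin H' ⟨hle.trans hHK, hne', by linarith⟩
  omega

end Gamma

end SimpleGraph

/-! ### Finner's inequality -/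

section Finner

open scoped ENNReal

variable {δ ι : Type*} [DecidableEq δ] {X : δ → Type*} [∀ i, MeasurableSpace (X i)]
  {μ : ∀ i, Measure (X i)} [∀ i, IsProbabilityMeasure (μ i)]

theorem lmarginal_const (s : Finset δ) (c : ℝ≥0∞) (x : ∀ i, X i) :
    (∫⋯∫⁻_s, (fun _ => c) ∂μ) x = c := by
  simp [lmarginal]

open Classical in
/-- Finner's inequality: a Hölder inequality for functions `f e` of a product variable, where the
weights `y e` of those that depend on any given coordinate in `s` add up to at most `1`. -/
theorem lmarginal_prod_rpow_le (s : Finset δ) (E : Finset ι) {f : ι → (∀ i, X i) → ℝ≥0∞}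
    (hf : ∀ e, Measurable (f e)) (D : ι → δ → Prop)
    (hD : ∀ e i, ¬ D e i → ∀ x t, f e (Function.update x i t) = f e x)
    {y : ι → ℝ} (hy : ∀ e, 0 ≤ y e) (h : ∀ i ∈ s, ∑ e ∈ E with D e i, y e ≤ 1) (x : ∀ i, X i) :
    (∫⋯∫⁻_s, (fun x => ∏ e ∈ E, f e x ^ y e) ∂μ) x ≤
      ∏ e ∈ E, (∫⋯∫⁻_s, f e ∂μ) x ^ y e := by
  induction s using Finset.induction_on generalizing x with
  | empty => simp
  | insert i s hi ih =>
    have hm : Measurable fun x => ∏ e ∈ E, f e x ^ y e :=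
      Finset.measurable_prod _ fun e _ => (hf e).pow_const _
    rw [lmarginal_insert _ hm hi]
    set g : ι → X i → ℝ≥0∞ := fun e t => (∫⋯∫⁻_s, f e ∂μ) (Function.update x i t) with hg
    have hgm : ∀ e, Measurable (g e) := fun e => ((hf e).lmarginal μ).comp (measurable_update x)
    have hgc : ∀ e, ¬ D e i → ∀ t, g e t = (∫⋯∫⁻_s, f e ∂μ) x := fun e he t => by
      simp only [hg]
      rw [lmarginal_update_of_notMem (hf e) hi]
      congr 1
      ext z
      exact hD e i he z t
    have hgi : ∀ e, (∫⋯∫⁻_insert i s, f e ∂μ) x = ∫⁻ t, g e t ∂μ i := fun e =>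
      lmarginal_insert _ (hf e) hi x
    calc ∫⁻ t, (∫⋯∫⁻_s, (fun x => ∏ e ∈ E, f e x ^ y e) ∂μ) (Function.update x i t) ∂μ i
        ≤ ∫⁻ t, ∏ e ∈ E, g e t ^ y e ∂μ i :=
          lintegral_mono fun t => ih (fun j hj => h j (Finset.mem_insert_of_mem hj)) _
      _ = ∫⁻ t, (∏ e ∈ E with ¬ D e i, (∫⋯∫⁻_s, f e ∂μ) x ^ y e) *
            ∏ e ∈ E with D e i, g e t ^ y e ∂μ i := by
          refine lintegral_congr fun t => ?_
          rw [← Finset.prod_filter_mul_prod_filter_not E (fun e => D e i), mul_comm]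
          congr 1
          refine Finset.prod_congr rfl fun e he => ?_
          rw [hgc e (Finset.mem_filter.1 he).2]
      _ = (∏ e ∈ E with ¬ D e i, (∫⋯∫⁻_s, f e ∂μ) x ^ y e) *
            ∫⁻ t, ∏ e ∈ E with D e i, g e t ^ y e ∂μ i :=
          lintegral_const_mul _ (Finset.measurable_prod _ fun e _ => (hgm e).pow_const _)
      _ ≤ (∏ e ∈ E with ¬ D e i, (∫⋯∫⁻_s, f e ∂μ) x ^ y e) *
            ∏ e ∈ E with D e i, (∫⁻ t, g e t ∂μ i) ^ y e := by
          gcongr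
          have := ENNReal.lintegral_mul_prod_norm_pow_le (μ := μ i) (g := fun _ => 1)
            (E.filter fun e => D e i) (f := g) (p := y) aemeasurable_const
            (fun e _ => (hgm e).aemeasurable) (1 - ∑ e ∈ E with D e i, y e) (by ring)
            (sub_nonneg.2 (h i (Finset.mem_insert_self i s))) (fun e _ => hy e)
          simpa using this
      _ = ∏ e ∈ E, (∫⋯∫⁻_insert i s, f e ∂μ) x ^ y e := by
          rw [← Finset.prod_filter_mul_prod_filter_not E (fun e => D e i), mul_comm]
          congr 1
          · exact Finset.prod_congr rfl fun e _ => by rw [hgi]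
          · refine Finset.prod_congr rfl fun e he => ?_
            rw [hgi, lintegral_congr (hgc e (Finset.mem_filter.1 he).2)]
            simp

end Finner

/-! ### Copies of a graph in a sparse kernel -/

section HomBound

open scoped ENNReal

theorem ENNReal.prod_rpow_eq_rpow_sum {ι : Type*} (s : Finset ι) (a : ℝ≥0∞) {f : ι → ℝ}
    (hf : ∀ i ∈ s, 0 ≤ f i) : ∏ i ∈ s, a ^ f i = a ^ ∑ i ∈ s, f i := by
  classical
  induction s using Finset.induction_on with
  | empty => simp
  | insert i s hi ih =>
    rw [Finset.prod_insert hi, Finset.sum_insert hi,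
      ih fun j hj => hf j (Finset.mem_insert_of_mem hj), ENNReal.rpow_add_of_nonneg _ _
        (hf i (Finset.mem_insert_self i s))
        (Finset.sum_nonneg fun j hj => hf j (Finset.mem_insert_of_mem hj))]

open Classical in
/-- In a fractional matching of maximum weight, no edge joins two unsaturated vertices. -/
theorem SimpleGraph.IsFracMatching.not_adj_of_lt_one {V : Type*} [Fintype V] {H : SimpleGraph V}
    {y : Sym2 V → ℝ} (hy : H.IsFracMatching y)
    (hmax : ∀ y', H.IsFracMatching y' → ∑ e, y' e ≤ ∑ e, y e) {u v : V}
    (hu : ∑ e with u ∈ e, y e < 1) (hv : ∑ e with v ∈ e, y e < 1) : ¬ H.Adj u v := by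
  intro huv
  set r := min (1 - ∑ e with u ∈ e, y e) (1 - ∑ e with v ∈ e, y e) with hr
  have hr0 : 0 < r := lt_min (by linarith) (by linarith)
  have hsum : ∀ w, (∑ e with w ∈ e, (y e + if e = s(u, v) then r else 0))
      = (∑ e with w ∈ e, y e) + if w ∈ s(u, v) then r else 0 := by
    intro w
    rw [Finset.sum_add_distrib]
    congr 1
    simp [Finset.sum_ite_eq']
  have h1 := hmax (fun e => y e + if e = s(u, v) then r else 0) ⟨?_, ?_, ?_⟩
  · rw [Finset.sum_add_distrib, Finset.sum_ite_eq' Finset.univ] at h1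
    simp at h1
    linarith
  · intro e
    have := hy.1 e
    positivity
  · intro e he
    have : e ≠ s(u, v) := by rintro rfl; exact he huv
    simp [hy.2.1 e he, this]
  · intro w
    refine le_trans (le_of_eq (by convert hsum w)) ?_
    by_cases hw : w ∈ s(u, v)
    · rw [if_pos hw]
      rcases Sym2.mem_iff.1 hw with rfl | rfl
      · linarith [min_le_left (1 - ∑ e with w ∈ e, y e) (1 - ∑ e with v ∈ e, y e)]
      · linarith [min_le_right (1 - ∑ e with u ∈ e, y e) (1 - ∑ e with w ∈ e, y e)]
    · rw [if_neg hw, add_zero]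
      exact hy.2.2 w

variable {V : Type*} [Fintype V]

/-- The value of a symmetric function of two variables on an unordered pair of coordinates. -/
def pairVal {w : I → I → ℝ≥0∞} (hs : ∀ a b, w a b = w b a) (e : Sym2 V) (x : V → I) : ℝ≥0∞ :=
  Sym2.lift ⟨fun u v => w (x u) (x v), fun _ _ => hs _ _⟩ e

open Classical in
/-- If `w` has values in `[0, 1]`, all its rows have integral at most `P` and its total integral is
at most `Θ`, then the number of copies of `H` in `w` is at most `Θ ^ Y * P ^ (v(H) - 2 Y)` for some
`Y ≥ c(H)`. Here `Y` is the weight of a maximum fractional matching `y` and Finner's inequality is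
applied twice. The unsaturated vertices form an independent set `S`; topping up the weights at
each `v ∈ S` on one edge from `v` to a saturated vertex and integrating over the variables in `S`
gives the powers of `P`. Integrating over the others with the weights `y` gives the powers
of `Θ`. -/
theorem exists_lintegral_prod_pairVal_le (H : SimpleGraph V) {w : I → I → ℝ≥0∞}
    (hw : Measurable (Function.uncurry w)) (hs : ∀ a b, w a b = w b a) (h1 : ∀ a b, w a b ≤ 1)
    {P Θ : ℝ≥0∞} (hP : ∀ a, ∫⁻ b, w a b ≤ P) (hΘ : ∫⁻ a, ∫⁻ b, w a b ≤ Θ) :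
    ∃ Y : ℝ, H.fracCoverNum ≤ Y ∧ 2 * Y ≤ H.numVerts ∧
      ∫⁻ x : V → I, ∏ e ∈ H.edgeFinset, pairVal hs e x ≤ Θ ^ Y * P ^ (H.numVerts - 2 * Y) := by
  obtain ⟨y, hy, hcy, hmax⟩ := H.exists_max_fracMatching
  set E := H.edgeFinset with hE
  let d : V → ℝ := fun v => ∑ e with v ∈ e, y e
  have hd1 : ∀ v, d v ≤ 1 := hy.2.2
  have hd0 : ∀ v, 0 ≤ d v := fun v => Finset.sum_nonneg fun e _ => hy.1 e
  let S : Finset V := Finset.univ.filter fun v => v ∈ H.support ∧ d v < 1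
  have hS : ∀ v, v ∈ S ↔ v ∈ H.support ∧ d v < 1 := fun v => by simp [S]
  have hnb : ∀ v, ∃ t, v ∈ S → H.Adj v t := fun v => by
    by_cases hv : v ∈ S
    · obtain ⟨t, ht⟩ := ((hS v).1 hv).1
      exact ⟨t, fun _ => ht⟩
    · exact ⟨v, fun h => absurd h hv⟩
  choose t ht using hnb
  have htS : ∀ v ∈ S, t v ∉ S := fun v hv htv =>
    hy.not_adj_of_lt_one hmax ((hS v).1 hv).2 ((hS _).1 htv).2 (ht v hv)
  -- the weight added to the edges `v t(v)` in order to saturate the vertices `v ∈ S`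
  let ex : Sym2 V → ℝ := fun e => ∑ v ∈ S, if s(v, t v) = e then 1 - d v else 0
  have hex0 : ∀ e, 0 ≤ ex e := fun e => Finset.sum_nonneg fun v _ => by
    have := hd1 v
    split_ifs <;> linarith
  have hm : ∀ e : Sym2 V, Measurable fun x : V → I => pairVal hs e x := by
    intro e
    induction e with | _ u v
    have : Measurable fun x : V → I => (x u, x v) :=
      (measurable_pi_apply u).prodMk (measurable_pi_apply v)
    exact hw.comp this
  have hle1 : ∀ (e : Sym2 V) (x : V → I), pairVal hs e x ≤ 1 := by
    intro e x
    induction e with | _ u v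
    exact h1 _ _
  have hdep : ∀ (e : Sym2 V) (i : V), ¬ i ∈ e → ∀ (x : V → I) s,
      pairVal hs e (Function.update x i s) = pairVal hs e x := by
    intro e i hi x s
    induction e with | _ u v
    simp only [Sym2.mem_iff, not_or] at hi
    simp [pairVal, Function.update_of_ne (Ne.symm hi.1), Function.update_of_ne (Ne.symm hi.2)]
  have hfilt : ∀ v, ∑ e ∈ E with v ∈ e, y e = d v := fun v => by
    refine Finset.sum_subset (Finset.filter_subset_filter _ (Finset.subset_univ _)) ?_
    intro e he he'
    refine hy.2.1 e fun h => he' ?_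
    simp only [Finset.mem_filter, Finset.mem_univ, true_and] at he ⊢
    exact ⟨by simpa [hE] using h, he⟩
  have hEy : ∑ e ∈ E, y e = ∑ e, y e :=
    Finset.sum_subset (Finset.subset_univ _) fun e _ he => hy.2.1 e (by simpa [hE] using he)
  have hext : ∀ v ∈ S, ∑ e ∈ E with v ∈ e, ex e = 1 - d v := by
    intro v hv
    rw [Finset.sum_comm, Finset.sum_eq_single v]
    · rw [Finset.sum_ite_eq, if_pos]
      simp [hE, ht v hv]
    · intro v' hv' hne
      refine Finset.sum_eq_zero fun e he => if_neg ?_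
      rintro rfl
      rcases Sym2.mem_iff.1 (Finset.mem_filter.1 he).2 with h | h
      · exact hne h.symm
      · exact htS v' hv' (h ▸ hv)
    · exact fun h => absurd hv h
  have hweight : ∀ v ∈ S, ∑ e ∈ E with v ∈ e, (y e + ex e) = 1 := fun v hv => by
    rw [Finset.sum_add_distrib, hfilt, hext v hv]
    ring
  -- the total deficiency of the vertices of `H`
  have hexsum : ∑ e ∈ E, ex e = H.numVerts - 2 * ∑ e, y e := by
    have h2 : ∑ v, d v = 2 * ∑ e, y e := by
      have := SimpleGraph.sum_mul_sum_mem_comm y fun _ : V => 1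
      simp only [one_mul] at this
      rw [show (∑ v, d v) = ∑ v, ∑ e with v ∈ e, y e from rfl, this, Finset.mul_sum]
      refine Finset.sum_congr rfl fun e _ => ?_
      by_cases he : e ∈ H.edgeSet
      · induction e with | _ a b
        rw [SimpleGraph.sum_mem_mk (H.ne_of_adj he)]
        ring
      · rw [hy.2.1 e he]
        ring
    have h3 : ∑ e ∈ E, ex e = ∑ v ∈ S, (1 - d v) := by
      rw [Finset.sum_comm]
      refine Finset.sum_congr rfl fun v hv => ?_
      rw [Finset.sum_ite_eq, if_pos]
      simp [hE, ht v hv]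
    have h4 : ∑ v ∈ S, (1 - d v) = ∑ v with v ∈ H.support, (1 - d v) := by
      refine Finset.sum_subset (fun v hv => by simpa using ((hS v).1 hv).1) fun v hv hv' => ?_
      have := hd1 v
      have h5 : v ∈ H.support := by simpa using hv
      have : ¬ d v < 1 := fun h => hv' ((hS v).2 ⟨h5, h⟩)
      linarith
    have h5 : ∑ v with v ∈ H.support, d v = ∑ v, d v := by
      refine Finset.sum_subset (Finset.subset_univ _) fun v _ hv => ?_
      refine Finset.sum_eq_zero fun e he => hy.2.1 e fun h => hv ?_
      induction e with | _ a b
      have hab : H.Adj a b := h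
      rcases Sym2.mem_iff.1 (Finset.mem_filter.1 he).2 with rfl | rfl
      · simpa using ⟨_, hab⟩
      · simpa using ⟨_, hab.symm⟩
    have h6 : (H.numVerts : ℝ) = ∑ v with v ∈ H.support, (1 : ℝ) := by
      simp only [Finset.sum_const, nsmul_eq_mul, mul_one, SimpleGraph.numVerts]
      rw [Set.ncard_eq_toFinset_card']
      congr 2
      ext; simp
    rw [h3, h4, Finset.sum_sub_distrib, h5, h2, h6]
  have hrow : ∀ v ∈ S, ∀ x, (∫⋯∫⁻_S, (pairVal hs s(v, t v)) ∂fun _ => volume) x ≤ P := by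
    intro v hv x
    have hne := (ht v hv).ne
    rw [lmarginal_erase' _ (hm _) hv]
    refine (lmarginal_mono (g := fun _ => P) fun x => ?_) x |>.trans_eq (lmarginal_const _ _ _)
    simp only [pairVal, Sym2.lift_mk, Function.update_self, Function.update_of_ne hne.symm]
    simp only [hs _ (x (t v))]
    exact hP _
  have htot : ∀ e ∈ E, ∀ x, (∫⋯∫⁻_Finset.univ, (pairVal hs e) ∂fun _ => volume) x ≤ Θ := by
    intro e he x
    induction e with | _ u v
    have hne : u ≠ v := by
      have : H.Adj u v := by simpa [hE] using he
      exact this.ne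
    rw [lmarginal_erase' _ (hm _) (Finset.mem_univ v), lmarginal_erase' (i := u)]
    · refine (lmarginal_mono (g := fun _ => Θ) fun x => ?_) x |>.trans_eq (lmarginal_const _ _ _)
      simp only [pairVal, Sym2.lift_mk, Function.update_self, Function.update_of_ne hne]
      exact hΘ
    · simp only [pairVal, Sym2.lift_mk, Function.update_self, Function.update_of_ne hne]
      exact hw.lintegral_prod_right'.comp (measurable_pi_apply u)
    · simpa using hne
  refine ⟨∑ e, y e, hcy, ?_, ?_⟩
  · have : 0 ≤ ∑ e ∈ E, ex e := Finset.sum_nonneg fun e _ => hex0 e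
    linarith
  -- integration over the variables in `S`, with the weights `y + ex`; for this, the integrand is
  -- raised to these powers at most `1`
  have hstep1 : ∀ x, (∫⋯∫⁻_S, (fun x => ∏ e ∈ E, pairVal hs e x) ∂fun _ => volume) x ≤
      P ^ (H.numVerts - 2 * ∑ e, y e) *
        ∏ e ∈ E, (∫⋯∫⁻_S, (pairVal hs e) ∂fun _ => volume) x ^ y e := by
    intro x
    calc (∫⋯∫⁻_S, (fun x => ∏ e ∈ E, pairVal hs e x) ∂fun _ => volume) x
        ≤ (∫⋯∫⁻_S, (fun x => ∏ e ∈ E, pairVal hs e x ^ (y e + ex e)) ∂fun _ => volume) x := by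
          refine lmarginal_mono (fun x => Finset.prod_le_prod' fun e he => ?_) x
          have hle : y e + ex e ≤ 1 := by
            by_cases hS' : ∃ v ∈ S, v ∈ e
            · obtain ⟨v, hv, hve⟩ := hS'
              rw [← hweight v hv]
              exact Finset.single_le_sum (f := fun e => y e + ex e)
                (fun e _ => add_nonneg (hy.1 e) (hex0 e)) (by simp [he, hve])
            · have h0 : ex e = 0 := Finset.sum_eq_zero fun v hv => if_neg fun h => hS'
                ⟨v, hv, by rw [← h]; exact Sym2.mem_mk_left _ _⟩
              rw [h0, add_zero]
              induction e with | _ a b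
              refine le_trans ?_ (hd1 a)
              exact Finset.single_le_sum (f := y) (fun e _ => hy.1 e) (by simp)
          simpa using ENNReal.rpow_le_rpow_of_exponent_ge (hle1 e x) hle
      _ ≤ ∏ e ∈ E, (∫⋯∫⁻_S, (pairVal hs e) ∂fun _ => volume) x ^ (y e + ex e) := by
          refine lmarginal_prod_rpow_le S E hm (fun e i => i ∈ e) hdep
            (fun e => add_nonneg (hy.1 e) (hex0 e)) (fun v hv => ?_) x
          exact le_of_eq (by convert hweight v hv)
      _ = (∏ e ∈ E, (∫⋯∫⁻_S, (pairVal hs e) ∂fun _ => volume) x ^ ex e) *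
            ∏ e ∈ E, (∫⋯∫⁻_S, (pairVal hs e) ∂fun _ => volume) x ^ y e := by
          rw [← Finset.prod_mul_distrib]
          refine Finset.prod_congr rfl fun e _ => ?_
          rw [ENNReal.rpow_add_of_nonneg _ _ (hy.1 e) (hex0 e), mul_comm]
      _ ≤ _ := by
          gcongr
          rw [← hexsum, ← ENNReal.prod_rpow_eq_rpow_sum _ _ fun e _ => hex0 e]
          refine Finset.prod_le_prod' fun e _ => ?_
          by_cases hS' : ∃ v ∈ S, s(v, t v) = e
          · obtain ⟨v, hv, rfl⟩ := hS'
            exact ENNReal.rpow_le_rpow (hrow v hv x) (hex0 _)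
          · have h0 : ex e = 0 := Finset.sum_eq_zero fun v hv => if_neg fun h => hS' ⟨v, hv, h⟩
            simp [h0]
  have hmS : ∀ e, Measurable (∫⋯∫⁻_S, (pairVal hs e) ∂fun _ : V => (volume : Measure I)) :=
    fun e => (hm e).lmarginal _
  have huniv : ∀ f : (V → I) → ℝ≥0∞, Measurable f →
      ∫⋯∫⁻_Finset.univ, f ∂(fun _ => volume) =
        ∫⋯∫⁻_Sᶜ, (∫⋯∫⁻_S, f ∂fun _ => volume) ∂fun _ => volume := by
    intro f hf
    rw [← lmarginal_union _ _ hf disjoint_compl_left]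
    congr 1
    rw [Finset.union_comm, Finset.union_compl]
  have x₀ : V → I := fun _ => 0
  calc ∫⁻ x : V → I, ∏ e ∈ E, pairVal hs e x
      = (∫⋯∫⁻_Sᶜ, (∫⋯∫⁻_S, (fun x => ∏ e ∈ E, pairVal hs e x) ∂fun _ => volume)
          ∂fun _ => volume) x₀ := by
        rw [← huniv _ (Finset.measurable_prod _ fun e _ => hm e), lmarginal_univ]
        rfl
    _ ≤ (∫⋯∫⁻_Sᶜ, (fun x => P ^ (H.numVerts - 2 * ∑ e, y e) *
          ∏ e ∈ E, (∫⋯∫⁻_S, (pairVal hs e) ∂fun _ => volume) x ^ y e) ∂fun _ => volume) x₀ :=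
        lmarginal_mono hstep1 x₀
    _ = P ^ (H.numVerts - 2 * ∑ e, y e) * (∫⋯∫⁻_Sᶜ, (fun x =>
          ∏ e ∈ E, (∫⋯∫⁻_S, (pairVal hs e) ∂fun _ => volume) x ^ y e) ∂fun _ => volume) x₀ := by
        refine lintegral_const_mul _ (Measurable.comp (g := fun x =>
          ∏ e ∈ E, (∫⋯∫⁻_S, (pairVal hs e) ∂fun _ => volume) x ^ y e) ?_ measurable_updateFinset)
        exact Finset.measurable_prod _ fun e _ => (hmS e).pow_const _
    _ ≤ P ^ (H.numVerts - 2 * ∑ e, y e) * ∏ e ∈ E, (∫⋯∫⁻_Sᶜ,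
          (∫⋯∫⁻_S, (pairVal hs e) ∂fun _ => volume) ∂fun _ => volume) x₀ ^ y e := by
        gcongr
        refine lmarginal_prod_rpow_le Sᶜ E hmS (fun e i => i ∈ e) ?_ hy.1 (fun v _ => ?_) x₀
        · intro e i hi x s
          by_cases hiS : i ∈ S
          · exact lmarginal_update_of_mem _ hiS _ _ _
          · rw [lmarginal_update_of_notMem (hm e) hiS]
            congr 1
            ext z
            exact hdep e i hi z s
        · exact le_trans (le_of_eq (by convert hfilt v)) (hd1 v)
    _ ≤ P ^ (H.numVerts - 2 * ∑ e, y e) * ∏ e ∈ E, Θ ^ y e := by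
        gcongr with e he
        · exact hy.1 e
        · rw [← huniv _ (hm e)]
          exact htot e he x₀
    _ = Θ ^ (∑ e, y e) * P ^ (H.numVerts - 2 * ∑ e, y e) := by
        rw [ENNReal.prod_rpow_eq_rpow_sum _ _ fun e _ => hy.1 e, hEy, mul_comm]

end HomBound

/-! ### Relative entropy, and the lower bound on the entropy -/

section Entropy

theorem sub_le_mul_log_div {a b : ℝ} (ha : 0 ≤ a) (hb : 0 < b) : a - b ≤ a * Real.log (a / b) := by
  rcases ha.eq_or_lt with rfl | ha
  · simpa using hb.le
  · have := Real.one_sub_inv_le_log_of_pos (div_pos ha hb)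
    have := mul_le_mul_of_nonneg_left this ha.le
    rwa [inv_div, mul_sub, mul_one, mul_div_cancel₀ _ ha.ne'] at this

theorem relEntropy_nonneg {p x : ℝ} (hp0 : 0 < p) (hp1 : p < 1) (hx : x ∈ Set.Icc (0 : ℝ) 1) :
    0 ≤ relEntropy p x := by
  have h1 := sub_le_mul_log_div hx.1 hp0
  have h2 := sub_le_mul_log_div (sub_nonneg.2 hx.2) (sub_pos.2 hp1)
  unfold relEntropy
  linarith

/-- Relative entropy is at most the `χ²` divergence. -/
theorem relEntropy_le {p x : ℝ} (hp0 : 0 < p) (hp1 : p < 1) (hx : x ∈ Set.Icc (0 : ℝ) 1) :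
    relEntropy p x ≤ (x - p) ^ 2 / (p * (1 - p)) := by
  have key : ∀ a b : ℝ, 0 ≤ a → 0 < b → a * Real.log (a / b) ≤ a * (a / b - 1) := by
    intro a b ha hb
    rcases ha.eq_or_lt with rfl | ha
    · simp
    · exact mul_le_mul_of_nonneg_left (Real.log_le_sub_one_of_pos (div_pos ha hb)) ha.le
  have h1 := key x p hx.1 hp0
  have h2 := key (1 - x) (1 - p) (sub_nonneg.2 hx.2) (sub_pos.2 hp1)
  have hp1' : 1 - p ≠ 0 := (sub_pos.2 hp1).ne'
  have : x * (x / p - 1) + (1 - x) * ((1 - x) / (1 - p) - 1) = (x - p) ^ 2 / (p * (1 - p)) := by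
    field_simp
    ring
  unfold relEntropy
  linarith

theorem relEntropy_le_inv {p x : ℝ} (hp0 : 0 < p) (hp1 : p < 1) (hx : x ∈ Set.Icc (0 : ℝ) 1) :
    relEntropy p x ≤ (p * (1 - p))⁻¹ := by
  refine (relEntropy_le hp0 hp1 hx).trans ?_
  rw [div_eq_mul_inv]
  refine mul_le_of_le_one_left (inv_nonneg.2 (mul_nonneg hp0.le (sub_pos.2 hp1).le)) ?_
  have h1 := hx.1
  have h2 := hx.2
  nlinarith

/-- Above `r p` with `r > 1`, the relative entropy is at least a constant multiple of its
argument. -/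
theorem mul_le_relEntropy {p x r : ℝ} (hp0 : 0 < p) (hp1 : p < 1) (hx : x ≤ 1) (hr : 1 ≤ r)
    (hrx : r * p ≤ x) : (Real.log r - 1 + r⁻¹) * x ≤ relEntropy p x := by
  have hr0 : 0 < r := zero_lt_one.trans_le hr
  have hx0 : 0 < x := (mul_pos hr0 hp0).trans_le hrx
  have h2 := sub_le_mul_log_div (sub_nonneg.2 hx) (sub_pos.2 hp1)
  have h1 : Real.log (x / p) = Real.log r + Real.log (x / (r * p)) := by
    rw [← Real.log_mul hr0.ne' (div_pos hx0 (mul_pos hr0 hp0)).ne']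
    congr 1
    field_simp
  have h3 := Real.one_sub_inv_le_log_of_pos (div_pos hx0 (mul_pos hr0 hp0))
  rw [inv_div] at h3
  have h4 : x * (1 - r * p / x) = x - r * p := by field_simp
  have h5 := mul_le_mul_of_nonneg_left h3 hx0.le
  have h6 : r⁻¹ * (x - r * p) ≤ x - r * p := mul_le_of_le_one_left (by linarith)
    (inv_le_one_of_one_le₀ hr)
  have h7 : r⁻¹ * (r * p) = p := by field_simp
  unfold relEntropy
  rw [h1]
  nlinarith

theorem log_sub_one_add_inv_pos {r : ℝ} (hr : 1 < r) : 0 < Real.log r - 1 + r⁻¹ := by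
  have h0 : 0 < r := zero_lt_one.trans hr
  have := Real.log_lt_sub_one_of_pos (inv_pos.2 h0) (inv_ne_one.2 hr.ne')
  rw [Real.log_inv] at this
  linarith

theorem measurable_relEntropy (p : ℝ) : Measurable (relEntropy p) := by
  unfold relEntropy
  fun_prop

namespace Graphon

theorem entropy_nonneg {p : ℝ} (hp0 : 0 < p) (hp1 : p < 1) (W : Graphon) : 0 ≤ W.entropy p :=
  integral_nonneg fun _ => integral_nonneg fun _ => relEntropy_nonneg hp0 hp1 (W.mem_Icc _ _)

theorem measurable_relEntropy_uncurry (W : Graphon) (p : ℝ) :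
    Measurable fun z : I × I => relEntropy p (W.toFun z.1 z.2) :=
  (measurable_relEntropy p).comp W.measurable

theorem lintegral_relEntropy {p : ℝ} (hp0 : 0 < p) (hp1 : p < 1) (W : Graphon) :
    ∫⁻ a, ∫⁻ b, ENNReal.ofReal (relEntropy p (W.toFun a b)) = ENNReal.ofReal (W.entropy p) := by
  have hb : ∀ a b, ‖relEntropy p (W.toFun a b)‖ ≤ (p * (1 - p))⁻¹ := fun a b => by
    rw [Real.norm_of_nonneg (relEntropy_nonneg hp0 hp1 (W.mem_Icc _ _))]
    exact relEntropy_le_inv hp0 hp1 (W.mem_Icc _ _)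
  have hi : ∀ a, Integrable fun b => relEntropy p (W.toFun a b) := fun a =>
    .of_bound ((W.measurable_relEntropy_uncurry p).comp measurable_prodMk_left).aestronglyMeasurable
      _ (ae_of_all _ (hb a))
  rw [entropy, ofReal_integral_eq_lintegral_ofReal]
  · refine lintegral_congr fun a => ?_
    rw [ofReal_integral_eq_lintegral_ofReal (hi a)]
    exact ae_of_all _ fun b => relEntropy_nonneg hp0 hp1 (W.mem_Icc _ _)
  · refine .of_bound (C := (p * (1 - p))⁻¹) ?_ (ae_of_all _ fun a => ?_)
    · exact (StronglyMeasurable.integral_prod_right (ν := volume)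
        (W.measurable_relEntropy_uncurry p).stronglyMeasurable).aestronglyMeasurable
    · simpa using norm_integral_le_of_norm_le_const (μ := (volume : Measure I)) (ae_of_all _ (hb a))
  · exact ae_of_all _ fun a => integral_nonneg fun b => relEntropy_nonneg hp0 hp1 (W.mem_Icc _ _)

theorem lintegral_row {p : ℝ} {W : Graphon} (hW : W.IsRegular p) (a : I) :
    ∫⁻ b, ENNReal.ofReal (W.toFun a b) = ENNReal.ofReal p := by
  rw [← hW a, ofReal_integral_eq_lintegral_ofReal]
  · refine .of_bound (C := 1) (W.measurable.comp measurable_prodMk_left).aestronglyMeasurable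
      (ae_of_all _ fun b => ?_)
    exact abs_le.2 ⟨by linarith [(W.mem_Icc a b).1], (W.mem_Icc a b).2⟩
  · exact ae_of_all _ fun b => (W.mem_Icc a b).1

end Graphon

end Entropy

section LowerBound

open scoped ENNReal

variable {V : Type*}

theorem Graphon.edgeVal_mem_Icc (W : Graphon) (x : V → I) (e : Sym2 V) :
    W.toSymmKernel.edgeVal x e ∈ Set.Icc (0 : ℝ) 1 := by
  induction e with | _ u v
  exact W.mem_Icc _ _

variable [Fintype V]

open Classical in
theorem SymmKernel.measurable_edgeProd (K : SimpleGraph V) (W : SymmKernel) :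
    Measurable (SymmKernel.edgeProd K W) := by
  refine Finset.measurable_prod _ fun e _ => ?_
  induction e with | _ u v
  have : Measurable fun x : V → I => (x u, x v) :=
    (measurable_pi_apply u).prodMk (measurable_pi_apply v)
  exact W.measurable.comp this

theorem Graphon.edgeProd_nonneg (K : SimpleGraph V) (W : Graphon) (x : V → I) :
    0 ≤ SymmKernel.edgeProd K W.toSymmKernel x :=
  Finset.prod_nonneg fun e _ => (W.edgeVal_mem_Icc x e).1

open Classical in
/-- Expanding `W ≤ q + W 1[W ≥ q]` over the edges: the density of `K` in `W` is at most
`q ^ e(K)` plus a small multiple of `p ^ e(K)`, if the part `W 1[W ≥ q]` has total mass at most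
`ε p ^ (2 + γ)`. -/
theorem Graphon.hom_le_of_lintegral_le (K : SimpleGraph V) (hγ : 0 < K.gammaInv) {p r ε : ℝ}
    (hp0 : 0 < p) (hp1 : p < 1) (hr : 1 ≤ r) (hε0 : 0 < ε) (hε1 : ε ≤ 1) {W : Graphon}
    (hW : W.IsRegular p)
    (hmass : ∫⁻ a, ∫⁻ b, ENNReal.ofReal (if r * p ≤ W.toFun a b then W.toFun a b else 0) ≤
      ENNReal.ofReal (ε * p ^ (2 + K.gammaInv))) :
    W.toSymmKernel.hom K ≤
      (r ^ K.numEdges + 2 ^ K.numEdges * (r ^ K.numEdges * ε)) * p ^ K.numEdges := by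
  set w : I → I → ℝ≥0∞ := fun a b =>
    ENNReal.ofReal (if r * p ≤ W.toFun a b then W.toFun a b else 0) with hw
  have hs : ∀ a b, w a b = w b a := fun a b => by simp only [hw, W.symm a b]
  have hm : Measurable (Function.uncurry w) :=
    (Measurable.ite (measurableSet_le measurable_const W.measurable) W.measurable
      measurable_const).ennreal_ofReal
  have hle : ∀ a b, w a b ≤ ENNReal.ofReal (W.toFun a b) := fun a b => by
    refine ENNReal.ofReal_le_ofReal ?_
    split_ifs
    · exact le_rfl
    · exact (W.mem_Icc a b).1
  have h1 : ∀ a b, w a b ≤ 1 := fun a b => (hle a b).trans (by simpa using (W.mem_Icc a b).2)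
  have hrow : ∀ a, ∫⁻ b, w a b ≤ ENNReal.ofReal p := fun a =>
    (lintegral_mono (hle a)).trans_eq (lintegral_row hW a)
  set E := K.edgeFinset with hE
  have hr0 : 0 < r := zero_lt_one.trans_le hr
  have hcardE : E.card = K.numEdges := by
    rw [SimpleGraph.numEdges_eq_card]
  have hmp : ∀ e : Sym2 V, Measurable fun x : V → I => pairVal hs e x := by
    intro e
    induction e with | _ u v
    have : Measurable fun x : V → I => (x u, x v) :=
      (measurable_pi_apply u).prodMk (measurable_pi_apply v)
    exact hm.comp this
  -- `F` is the set of edges on which `W ≥ r p`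
  have hpt : ∀ x : V → I, ENNReal.ofReal (SymmKernel.edgeProd K W.toSymmKernel x) ≤
      ∑ F ∈ E.powerset, (∏ e ∈ F, pairVal hs e x) *
        ENNReal.ofReal (r * p) ^ (E.card - F.card) := by
    intro x
    unfold SymmKernel.edgeProd
    rw [ENNReal.ofReal_prod_of_nonneg fun e _ => (W.edgeVal_mem_Icc x e).1]
    calc _ ≤ ∏ e ∈ E, (pairVal hs e x + ENNReal.ofReal (r * p)) := by
          refine Finset.prod_le_prod' fun e _ => ?_
          induction e with | _ u v
          change ENNReal.ofReal (W.toFun (x u) (x v)) ≤ w (x u) (x v) + _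
          simp only [hw]
          split_ifs with h
          · exact le_self_add
          · exact (ENNReal.ofReal_le_ofReal (not_le.1 h).le).trans le_add_self
      _ = _ := by
          rw [Finset.prod_add]
          refine Finset.sum_congr rfl fun F hF => ?_
          rw [Finset.prod_const, Finset.card_sdiff_of_subset (Finset.mem_powerset.1 hF)]
  have hterm : ∀ F ∈ E.powerset, F ≠ ∅ → (∫⁻ x : V → I, ∏ e ∈ F, pairVal hs e x) *
      ENNReal.ofReal (r * p) ^ (E.card - F.card) ≤
      ENNReal.ofReal (r ^ K.numEdges * ε * p ^ K.numEdges) := by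
    intro F hF hne
    rw [Finset.mem_powerset] at hF
    obtain ⟨H, hHe⟩ : ∃ H : SimpleGraph V, H.edgeFinset = F := by
      refine ⟨SimpleGraph.fromEdgeSet (F : Set (Sym2 V)), ?_⟩
      ext e
      simp only [SimpleGraph.mem_edgeFinset, SimpleGraph.edgeSet_fromEdgeSet, Set.mem_sdiff,
        Finset.mem_coe, and_iff_left_iff_imp]
      exact fun he => K.not_isDiag_of_mem_edgeSet (by simpa [hE] using hF he)
    have hHK : H ≤ K := by
      rw [← SimpleGraph.edgeFinset_subset_edgeFinset, hHe]
      exact hF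
    have hHne : H ≠ ⊥ := by
      rintro rfl
      exact hne (by rw [← hHe]; ext e; simp [SimpleGraph.mem_edgeFinset])
    have hFH : H.numEdges = F.card := by rw [SimpleGraph.numEdges_eq_card, hHe]
    obtain ⟨Y, hcY, hYv, hY⟩ := exists_lintegral_prod_pairVal_le H hm hs h1 hrow hmass
    rw [hHe] at hY
    have hY1 : 1 ≤ Y := (SimpleGraph.one_le_fracCoverNum hHne).trans hcY
    have hγY := (SimpleGraph.numEdges_sub_numVerts_le hHK).trans
      (mul_le_mul_of_nonneg_left hcY hγ.le)
    have hcard := Finset.card_le_card hF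
    have hpow : 0 < p ^ (2 + K.gammaInv) := Real.rpow_pos_of_pos hp0 _
    refine (mul_le_mul_left hY _).trans ?_
    rw [ENNReal.ofReal_rpow_of_pos (mul_pos hε0 hpow), ENNReal.ofReal_rpow_of_pos hp0,
      ← ENNReal.ofReal_pow (mul_pos hr0 hp0).le, ← ENNReal.ofReal_mul (by positivity),
      ← ENNReal.ofReal_mul (by positivity)]
    refine ENNReal.ofReal_le_ofReal ?_
    have hexp : (ε * p ^ (2 + K.gammaInv)) ^ Y * p ^ ((H.numVerts : ℝ) - 2 * Y) *
        (r * p) ^ (E.card - F.card) = r ^ (E.card - F.card) * ε ^ Y *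
          p ^ ((2 + K.gammaInv) * Y + (H.numVerts - 2 * Y) + ((E.card - F.card : ℕ) : ℝ)) := by
      rw [Real.mul_rpow hε0.le hpow.le, ← Real.rpow_mul hp0.le, Real.rpow_add hp0,
        Real.rpow_add hp0, Real.rpow_natCast, mul_pow]
      ring
    rw [hexp]
    refine mul_le_mul (mul_le_mul ?_ ?_ (by positivity) (by positivity)) ?_ (by positivity)
      (by positivity)
    · exact pow_le_pow_right₀ hr (by omega)
    · simpa using Real.rpow_le_rpow_of_exponent_ge hε0 hε1 hY1
    · rw [← Real.rpow_natCast]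
      refine Real.rpow_le_rpow_of_exponent_ge hp0 hp1.le ?_
      rw [Nat.cast_sub hcard, hcardE, ← hFH]
      linarith
  have hmain : ENNReal.ofReal (W.toSymmKernel.hom K) ≤ ENNReal.ofReal
      ((r ^ K.numEdges + 2 ^ K.numEdges * (r ^ K.numEdges * ε)) * p ^ K.numEdges) := by
    calc ENNReal.ofReal (W.toSymmKernel.hom K)
        ≤ ∫⁻ x : V → I, ENNReal.ofReal (SymmKernel.edgeProd K W.toSymmKernel x) := by
          rw [SymmKernel.hom, integral_eq_lintegral_of_nonneg_ae
            (ae_of_all _ (W.edgeProd_nonneg K))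
            (SymmKernel.measurable_edgeProd K _).aestronglyMeasurable]
          exact ENNReal.ofReal_toReal_le
      _ ≤ ∫⁻ x : V → I, ∑ F ∈ E.powerset, (∏ e ∈ F, pairVal hs e x) *
            ENNReal.ofReal (r * p) ^ (E.card - F.card) := lintegral_mono hpt
      _ = ∑ F ∈ E.powerset, (∫⁻ x : V → I, ∏ e ∈ F, pairVal hs e x) *
            ENNReal.ofReal (r * p) ^ (E.card - F.card) := by
          rw [lintegral_finsetSum _ fun F _ =>
            (Finset.measurable_prod _ fun e _ => hmp e).mul_const _]
          refine Finset.sum_congr rfl fun F _ => ?_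
          rw [lintegral_mul_const _ (Finset.measurable_prod _ fun e _ => hmp e)]
      _ ≤ ∑ F ∈ E.powerset, ((if F = ∅ then ENNReal.ofReal (r ^ K.numEdges * p ^ K.numEdges) else 0)
            + ENNReal.ofReal (r ^ K.numEdges * ε * p ^ K.numEdges)) := by
          refine Finset.sum_le_sum fun F hF => ?_
          rcases eq_or_ne F ∅ with rfl | hne
          · rw [if_pos rfl, Finset.card_empty, Nat.sub_zero, hcardE,
              ← ENNReal.ofReal_pow (mul_pos hr0 hp0).le, mul_pow]
            simp
          · rw [if_neg hne, zero_add]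
            exact hterm F hF hne
      _ = _ := by
          rw [Finset.sum_add_distrib, Finset.sum_ite_eq' , if_pos (Finset.empty_mem_powerset E),
            Finset.sum_const, Finset.card_powerset, hcardE, nsmul_eq_mul]
          rw [show (((2 ^ K.numEdges : ℕ) : ℕ) : ℝ≥0∞) = ENNReal.ofReal (2 ^ K.numEdges) by
            rw [ENNReal.ofReal_pow (by norm_num)]; norm_num]
          rw [← ENNReal.ofReal_mul (by positivity), ← ENNReal.ofReal_add (by positivity)
            (by positivity)]
          congr 1
          ring
  exact (ENNReal.ofReal_le_ofReal_iff (by positivity)).1 hmain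

/-- The entropy of a `p`-regular graphon with too many copies of `K` is at least of order
`p ^ (2 + γ)`. -/
theorem Graphon.exists_mul_rpow_le_entropy (K : SimpleGraph V) (hγ : 0 < K.gammaInv) {δ : ℝ}
    (hδ : 0 < δ) : ∃ c > 0, ∀ p : ℝ, 0 < p → p < 1 → ∀ W : Graphon, W.IsRegular p →
      (1 + δ) * p ^ K.numEdges ≤ W.toSymmKernel.hom K →
      c * p ^ (2 + K.gammaInv) ≤ W.entropy p := by
  obtain ⟨r, hr1, hr⟩ : ∃ r : ℝ, 1 < r ∧ r ^ K.numEdges < 1 + δ / 2 := by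
    have h : Tendsto (fun r : ℝ => r ^ K.numEdges) (𝓝[>] 1) (𝓝 1) := by
      have : Tendsto (fun r : ℝ => r ^ K.numEdges) (𝓝 1) (𝓝 (1 ^ K.numEdges)) :=
        (continuous_pow _).tendsto 1
      rw [one_pow] at this
      exact this.mono_left nhdsWithin_le_nhds
    obtain ⟨r, hr, hr'⟩ := ((h.eventually_lt_const (show (1 : ℝ) < 1 + δ / 2 by linarith)).and
      self_mem_nhdsWithin).exists
    exact ⟨r, hr', hr⟩
  have hr0 : 0 < r := zero_lt_one.trans hr1
  set h := Real.log r - 1 + r⁻¹ with hh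
  have hh0 : 0 < h := log_sub_one_add_inv_pos hr1
  set M : ℝ := 2 ^ K.numEdges * r ^ K.numEdges with hM
  have hM0 : 0 < M := by positivity
  set ε := min 1 (δ / (2 * M)) with hε
  have hε0 : 0 < ε := lt_min one_pos (by positivity)
  -- `h` is the constant of `mul_le_relEntropy`, and `ε` makes the error at most `δ / 2`
  refine ⟨ε * h, mul_pos hε0 hh0, fun p hp0 hp1 W hW hhom => ?_⟩
  by_contra! hlt
  have hmass : ∫⁻ a, ∫⁻ b, ENNReal.ofReal (if r * p ≤ W.toFun a b then W.toFun a b else 0) ≤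
      ENNReal.ofReal (ε * p ^ (2 + K.gammaInv)) := by
    have h1 : ∀ a b, ENNReal.ofReal (if r * p ≤ W.toFun a b then W.toFun a b else 0) ≤
        ENNReal.ofReal h⁻¹ * ENNReal.ofReal (relEntropy p (W.toFun a b)) := by
      intro a b
      rw [← ENNReal.ofReal_mul (inv_pos.2 hh0).le]
      refine ENNReal.ofReal_le_ofReal ?_
      split_ifs with hab
      · rw [le_inv_mul_iff₀ hh0]
        exact mul_le_relEntropy hp0 hp1 (W.mem_Icc a b).2 hr1.le hab
      · exact mul_nonneg (inv_pos.2 hh0).le (relEntropy_nonneg hp0 hp1 (W.mem_Icc a b))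
    have hm := (W.measurable_relEntropy_uncurry p).ennreal_ofReal
    calc _ ≤ ∫⁻ a, ∫⁻ b, ENNReal.ofReal h⁻¹ * ENNReal.ofReal (relEntropy p (W.toFun a b)) :=
          lintegral_mono fun a => lintegral_mono fun b => h1 a b
      _ = ENNReal.ofReal h⁻¹ * ENNReal.ofReal (W.entropy p) := by
          rw [← lintegral_relEntropy hp0 hp1 W, ← lintegral_const_mul _ hm.lintegral_prod_right']
          exact lintegral_congr fun a => lintegral_const_mul _ (hm.comp measurable_prodMk_left)
      _ ≤ _ := by
          rw [← ENNReal.ofReal_mul (inv_pos.2 hh0).le]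
          refine ENNReal.ofReal_le_ofReal ?_
          rw [inv_mul_le_iff₀ hh0]
          linarith
  have hle := hhom.trans
    (hom_le_of_lintegral_le K hγ hp0 hp1 hr1.le hε0 (min_le_left _ _) hW hmass)
  have h2 := le_of_mul_le_mul_right hle (by positivity)
  have h3 : M * ε ≤ δ / 2 := by
    calc M * ε ≤ M * (δ / (2 * M)) := by gcongr; exact min_le_right _ _
      _ = δ / 2 := by field_simp
  have h4 : 2 ^ K.numEdges * (r ^ K.numEdges * ε) = M * ε := by rw [hM]; ring
  linarith

end LowerBound

/-! ### Block graphons and regular completions -/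

section BlockFormulas

variable {m : ℕ} {part : I → Fin (m + 1)}

theorem integral_comp_part (hpart : Measurable part) (g : Fin (m + 1) → ℝ) :
    ∫ x, g (part x) = ∑ i, volume.real (part ⁻¹' {i}) * g i := by
  have h : ∀ x, g (part x) = ∑ i, (part ⁻¹' {i}).indicator (fun _ => g i) x := fun x => by
    rw [Finset.sum_eq_single (part x)]
    · simp
    · intro i _ hi
      exact Set.indicator_of_notMem (fun h => hi (by simpa using h.symm)) _
    · simp
  simp_rw [h]
  have hm : ∀ i, MeasurableSet (part ⁻¹' {i}) := fun i => hpart (measurableSet_singleton i)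
  rw [integral_finsetSum _ fun i _ => (integrable_const _).indicator (hm i)]
  simp [integral_indicator_const _ (hm _)]

variable {V : Type*}

/-- The value of a symmetric matrix on the blocks containing the two ends of a pair of vertices. -/
def blockVal {val : Fin (m + 1) → Fin (m + 1) → ℝ} (hs : ∀ i j, val i j = val j i)
    (B : V → Fin (m + 1)) : Sym2 V → ℝ :=
  Sym2.lift ⟨fun u v => val (B u) (B v), fun _ _ => hs _ _⟩

variable [Fintype V]

theorem volume_real_setOf_part_eq (part : I → Fin (m + 1)) (B : V → Fin (m + 1)) :
    volume.real {x : V → I | ∀ v, part (x v) = B v} = ∏ v, volume.real (part ⁻¹' {B v}) := by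
  have : {x : V → I | ∀ v, part (x v) = B v} = Set.pi Set.univ fun v => part ⁻¹' {B v} := by
    ext x
    simp
  rw [this, Measure.real, volume_pi_pi, ENNReal.toReal_prod]
  rfl

theorem measurableSet_setOf_part_eq (hpart : Measurable part) (B : V → Fin (m + 1)) :
    MeasurableSet {x : V → I | ∀ v, part (x v) = B v} := by
  have : {x : V → I | ∀ v, part (x v) = B v} = Set.pi Set.univ fun v => part ⁻¹' {B v} := by
    ext x
    simp
  rw [this]
  exact MeasurableSet.univ_pi fun v => hpart (measurableSet_singleton _)

open Classical in
/-- `Hom(K, U)` for a kernel `U` that is constant on blocks, as a sum over the assignments of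
blocks to the vertices of `K`. -/
theorem SymmKernel.hom_eq_sum (K : SimpleGraph V) (hpart : Measurable part) (U : SymmKernel)
    {val : Fin (m + 1) → Fin (m + 1) → ℝ} (hs : ∀ i j, val i j = val j i)
    (hU : ∀ x y, U.toFun x y = val (part x) (part y)) :
    U.hom K = ∑ B : V → Fin (m + 1), (∏ v, volume.real (part ⁻¹' {B v})) *
      ∏ e ∈ K.edgeFinset, blockVal hs B e := by
  have h : ∀ x : V → I, SymmKernel.edgeProd K U x = ∑ B : V → Fin (m + 1),
      {x : V → I | ∀ v, part (x v) = B v}.indicator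
        (fun _ => ∏ e ∈ K.edgeFinset, blockVal hs B e) x := fun x => by
    rw [Finset.sum_eq_single fun v => part (x v)]
    · rw [Set.indicator_of_mem (by simp)]
      refine Finset.prod_congr rfl fun e _ => ?_
      induction e with | _ u v
      exact hU _ _
    · intro B _ hB
      exact Set.indicator_of_notMem (fun h => hB (funext fun v => (h v).symm)) _
    · simp
  simp_rw [SymmKernel.hom, h]
  rw [integral_finsetSum _ fun B _ =>
    (integrable_const _).indicator (measurableSet_setOf_part_eq hpart B)]
  simp [integral_indicator_const _ (measurableSet_setOf_part_eq hpart _),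
    volume_real_setOf_part_eq]

namespace BlockGraphon

open Classical in
theorem homBlock_eq (K : SimpleGraph V) (W : BlockGraphon m) (B : V → Fin (m + 1)) :
    W.homBlock K B = (∏ v, W.len (B v)) * ∏ e ∈ K.edgeFinset, blockVal W.val_symm B e := by
  have h : ∀ x ∈ {x : V → I | ∀ v, W.part (x v) = B v},
      SymmKernel.edgeProd K W.toGraphon.toSymmKernel x =
        ∏ e ∈ K.edgeFinset, blockVal W.val_symm B e := by
    intro x hx
    refine Finset.prod_congr rfl fun e _ => ?_
    induction e with | _ u v
    change W.val (W.part (x u)) (W.part (x v)) = W.val (B u) (B v)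
    rw [hx u, hx v]
  rw [homBlock, setIntegral_congr_fun (measurableSet_setOf_part_eq W.measurable_part B) h,
    setIntegral_const, volume_real_setOf_part_eq]
  rfl

open Classical in
theorem hom_eq_sum_homBlock (K : SimpleGraph V) (W : BlockGraphon m) :
    W.hom K = ∑ B : V → Fin (m + 1), W.homBlock K B := by
  rw [hom, SymmKernel.hom_eq_sum K W.measurable_part _ W.val_symm fun _ _ => rfl]
  exact Finset.sum_congr rfl fun B _ => by rw [homBlock_eq]; rfl

theorem entropy_eq_sum (W : BlockGraphon m) (p : ℝ) :
    W.entropy p = ∑ i, ∑ j, W.len i * W.len j * relEntropy p (W.val i j) := by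
  have h : ∀ x, ∫ y, relEntropy p (W.toGraphon.toFun x y) =
      ∑ j, W.len j * relEntropy p (W.val (W.part x) j) := fun x =>
    integral_comp_part W.measurable_part fun j => relEntropy p (W.val (W.part x) j)
  rw [entropy, Graphon.entropy]
  simp_rw [h]
  rw [integral_comp_part W.measurable_part fun i => ∑ j, W.len j * relEntropy p (W.val i j)]
  refine Finset.sum_congr rfl fun i _ => ?_
  rw [Finset.mul_sum]
  exact Finset.sum_congr rfl fun j _ => by rw [len, ← mul_assoc]; rfl

theorem isRegular_of_sum_eq (W : BlockGraphon m) {p : ℝ}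
    (h : ∀ i, ∑ j, W.len j * W.val i j = p) : W.toGraphon.IsRegular p := fun x =>
  (integral_comp_part W.measurable_part fun j => W.val (W.part x) j).trans (h _)

theorem len_nonneg (W : BlockGraphon m) (i : Fin (m + 1)) : 0 ≤ W.len i := measureReal_nonneg

theorem sum_len (W : BlockGraphon m) : ∑ i, W.len i = 1 := by
  have := integral_comp_part W.measurable_part fun _ => (1 : ℝ)
  simpa [len] using this.symm

theorem homBlock_nonneg (K : SimpleGraph V) (W : BlockGraphon m) (B : V → Fin (m + 1)) :
    0 ≤ W.homBlock K B :=
  integral_nonneg fun x => W.toGraphon.edgeProd_nonneg K x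

end BlockGraphon

end BlockFormulas

section Construction

variable {m : ℕ}

/-- The values of a block graphon away from the last block: `1` on the blocks `(i, j)` with
`κ i + κ j ≥ 1` and `p` on the others. -/
noncomputable def coreVal (κ : Fin (m + 1) → ℝ) (p : ℝ) (i j : Fin (m + 1)) : ℝ :=
  if 1 ≤ κ i + κ j then 1 else p

/-- The value on the block `(i, last)` forced by `p`-regularity of the row of `i`, for blocks of
lengths `ℓ`. -/
noncomputable def rowVal (ℓ : Fin (m + 1) → ℝ) (κ : Fin (m + 1) → ℝ) (p : ℝ) (i : Fin (m + 1)) : ℝ :=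
  (p - ∑ j with j ≠ Fin.last m, ℓ j * coreVal κ p i j) / ℓ (Fin.last m)

/-- The values of a `p`-regular block graphon for blocks of lengths `ℓ`, equal to `coreVal κ p` away
from the last block. -/
noncomputable def regVal (ℓ : Fin (m + 1) → ℝ) (κ : Fin (m + 1) → ℝ) (p : ℝ) (i j : Fin (m + 1)) : ℝ :=
  if i = Fin.last m then
    if j = Fin.last m then
      (p - ∑ j with j ≠ Fin.last m, ℓ j * rowVal ℓ κ p j) / ℓ (Fin.last m)
    else rowVal ℓ κ p j
  else if j = Fin.last m then rowVal ℓ κ p i else coreVal κ p i j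

theorem coreVal_symm (κ : Fin (m + 1) → ℝ) (p : ℝ) (i j : Fin (m + 1)) :
    coreVal κ p i j = coreVal κ p j i := by
  simp [coreVal, add_comm]

theorem regVal_symm (ℓ κ : Fin (m + 1) → ℝ) (p : ℝ) (i j : Fin (m + 1)) :
    regVal ℓ κ p i j = regVal ℓ κ p j i := by
  unfold regVal
  split_ifs <;> first | rfl | exact coreVal_symm _ _ _ _

/-- The block graphon with a given partition and the values `regVal`. They are truncated to
`[0, 1]`, which has no effect in the relevant range of parameters, see `regGraphon_val`. -/
noncomputable def regGraphon (part : I → Fin (m + 1)) (hpart : Monotone part) (κ : Fin (m + 1) → ℝ) (p : ℝ) :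
    BlockGraphon m where
  part := part
  interval i := (Set.ordConnected_singleton (a := i)).preimage_mono hpart
  val i j := max 0 (min 1 (regVal (fun i => volume.real (part ⁻¹' {i})) κ p i j))
  val_symm i j := by rw [regVal_symm]
  val_mem i j := ⟨le_max_left _ _, max_le zero_le_one (min_le_left _ _)⟩

theorem regGraphon_val {part : I → Fin (m + 1)} {hpart : Monotone part} {κ : Fin (m + 1) → ℝ} {p : ℝ}
    (hp0 : 0 < p) (hp2 : p ≤ 1 / 2)
    (hsum : ∑ i with i ≠ Fin.last m, (regGraphon part hpart κ p).len i ≤ p) (i j : Fin (m + 1)) :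
    (regGraphon part hpart κ p).val i j = regVal (regGraphon part hpart κ p).len κ p i j := by
  set W := regGraphon part hpart κ p with hW
  have hlast : 1 / 2 ≤ W.len (Fin.last m) := by
    have h1 := W.sum_len
    rw [← Finset.sum_filter_add_sum_filter_not _ (fun i => i ≠ Fin.last m)] at h1
    simp only [ne_eq, not_not, Finset.sum_filter, Finset.sum_ite_eq', Finset.mem_univ,
      if_true] at h1 hsum
    linarith
  have hlast0 : 0 < W.len (Fin.last m) := by linarith
  have hcore : ∀ i j, coreVal κ p i j ∈ Set.Icc (0 : ℝ) 1 := fun i j => by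
    unfold coreVal
    split_ifs
    · simp
    · exact ⟨hp0.le, by linarith⟩
  have hrow : ∀ i, rowVal W.len κ p i ∈ Set.Icc 0 (2 * p) := fun i => by
    have h1 : ∑ j with j ≠ Fin.last m, W.len j * coreVal κ p i j ≤ p :=
      (Finset.sum_le_sum fun j _ => mul_le_of_le_one_right (W.len_nonneg j) (hcore i j).2).trans hsum
    have h2 : 0 ≤ ∑ j with j ≠ Fin.last m, W.len j * coreVal κ p i j :=
      Finset.sum_nonneg fun j _ => mul_nonneg (W.len_nonneg j) (hcore i j).1
    refine ⟨div_nonneg (by linarith) hlast0.le, ?_⟩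
    rw [rowVal, div_le_iff₀ hlast0]
    nlinarith
  have hll : (p - ∑ j with j ≠ Fin.last m, W.len j * rowVal W.len κ p j) / W.len (Fin.last m) ∈
      Set.Icc 0 (2 * p) := by
    have h1 : ∑ j with j ≠ Fin.last m, W.len j * rowVal W.len κ p j ≤ p :=
      (Finset.sum_le_sum fun j _ => mul_le_of_le_one_right (W.len_nonneg j)
        ((hrow j).2.trans (by linarith))).trans hsum
    have h2 : 0 ≤ ∑ j with j ≠ Fin.last m, W.len j * rowVal W.len κ p j :=
      Finset.sum_nonneg fun j _ => mul_nonneg (W.len_nonneg j) (hrow j).1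
    refine ⟨div_nonneg (by linarith) hlast0.le, ?_⟩
    rw [div_le_iff₀ hlast0]
    nlinarith
  have hmem : regVal W.len κ p i j ∈ Set.Icc (0 : ℝ) 1 := by
    have h2 : Set.Icc 0 (2 * p) ⊆ Set.Icc (0 : ℝ) 1 := Set.Icc_subset_Icc_right (by linarith)
    unfold regVal
    split_ifs
    · exact h2 hll
    · exact h2 (hrow _)
    · exact h2 (hrow _)
    · exact hcore _ _
  have : W.val i j = max 0 (min 1 (regVal W.len κ p i j)) := rfl
  rw [this, min_eq_right hmem.2, max_eq_right hmem.1]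

theorem regVal_sum_eq {ℓ κ : Fin (m + 1) → ℝ} {p : ℝ} (h0 : ℓ (Fin.last m) ≠ 0) (i : Fin (m + 1)) :
    ∑ j, ℓ j * regVal ℓ κ p i j = p := by
  rw [← Finset.sum_filter_add_sum_filter_not _ (fun i => i ≠ Fin.last m)]
  have h1 : ∑ j with ¬ j ≠ Fin.last m, ℓ j * regVal ℓ κ p i j =
      ℓ (Fin.last m) * regVal ℓ κ p i (Fin.last m) := by
    simp [Finset.sum_filter]
  rw [h1]
  by_cases hi : i = Fin.last m
  · subst hi
    have : ∑ j with j ≠ Fin.last m, ℓ j * regVal ℓ κ p (Fin.last m) j =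
        ∑ j with j ≠ Fin.last m, ℓ j * rowVal ℓ κ p j :=
      Finset.sum_congr rfl fun j hj => by simp [regVal, (Finset.mem_filter.1 hj).2]
    rw [this]
    simp only [regVal, if_true]
    rw [mul_div_cancel₀ _ h0]
    ring
  · have : ∑ j with j ≠ Fin.last m, ℓ j * regVal ℓ κ p i j =
        ∑ j with j ≠ Fin.last m, ℓ j * coreVal κ p i j :=
      Finset.sum_congr rfl fun j hj => by simp [regVal, hi, (Finset.mem_filter.1 hj).2]
    rw [this]
    simp only [regVal, hi, if_true, if_false]
    rw [rowVal, mul_div_cancel₀ _ h0]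
    ring

end Construction

/-! ### Asymptotics of graphons with a hub and a clique -/

section PowerAsymptotics

theorem tendsto_rpow_nhdsGT_zero {s : ℝ} (hs : 0 < s) :
    Tendsto (fun p : ℝ => p ^ s) (𝓝[>] 0) (𝓝 0) := by
  have h := (Real.continuousAt_rpow_const 0 s (Or.inr hs.le)).tendsto
  rw [Real.zero_rpow hs.ne'] at h
  exact h.mono_left nhdsWithin_le_nhds

theorem eventually_mem_Ioo {r : ℝ} (hr : 0 < r) : ∀ᶠ p : ℝ in 𝓝[>] 0, 0 < p ∧ p < r :=
  Ioo_mem_nhdsGT hr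

theorem tendsto_log_inv_nhdsGT_zero : Tendsto (fun p : ℝ => Real.log (1 / p)) (𝓝[>] 0) atTop := by
  simp only [one_div, Real.log_inv]
  exact tendsto_neg_atBot_atTop.comp Real.tendsto_log_nhdsGT_zero

theorem tendsto_rpow_mul_log_inv {s : ℝ} (hs : 0 < s) :
    Tendsto (fun p : ℝ => p ^ s * Real.log (1 / p)) (𝓝[>] 0) (𝓝 0) := by
  have := (tendsto_log_mul_rpow_nhdsGT_zero hs).neg
  simp only [neg_zero] at this
  refine this.congr fun p => ?_
  rw [one_div, Real.log_inv]
  ring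

theorem rpow_isLittleO_rpow {s t : ℝ} (hst : s < t) :
    (fun p : ℝ => p ^ t) =o[𝓝[>] 0] fun p => p ^ s := by
  refine (isLittleO_iff_tendsto' ?_).2 ?_
  · filter_upwards [eventually_mem_Ioo one_pos] with p hp h
    exact absurd h (Real.rpow_pos_of_pos hp.1 _).ne'
  · refine (tendsto_rpow_nhdsGT_zero (sub_pos.2 hst)).congr' ?_
    filter_upwards [eventually_mem_Ioo one_pos] with p hp
    rw [Real.rpow_sub hp.1]

theorem rpow_mul_log_inv_isLittleO_rpow {s t : ℝ} (hst : s < t) :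
    (fun p : ℝ => p ^ t * Real.log (1 / p)) =o[𝓝[>] 0] fun p => p ^ s := by
  refine (isLittleO_iff_tendsto' ?_).2 ?_
  · filter_upwards [eventually_mem_Ioo one_pos] with p hp h
    exact absurd h (Real.rpow_pos_of_pos hp.1 _).ne'
  · refine (tendsto_rpow_mul_log_inv (sub_pos.2 hst)).congr' ?_
    filter_upwards [eventually_mem_Ioo one_pos] with p hp
    rw [Real.rpow_sub hp.1]
    ring

end PowerAsymptotics

section Profile

variable {m : ℕ}

/-- The exponent of `p` in the length of the `i`-th block: `1 + γ κ i`, except that the last block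
has length of order `1`. -/
noncomputable def blockExp (γ : ℝ) (κ : Fin (m + 1) → ℝ) (i : Fin (m + 1)) : ℝ :=
  if i = Fin.last m then 0 else 1 + γ * κ i

/-- The blocks on which the graphon is `1`. -/
def IsOneBlock (κ : Fin (m + 1) → ℝ) (i j : Fin (m + 1)) : Prop :=
  i ≠ Fin.last m ∧ j ≠ Fin.last m ∧ 1 ≤ κ i + κ j

/-- The common shape of the hub, clique, and hub-plus-clique graphons. Each block `i` other than the
last carries a weight `κ i`, which is `1` for the hub, `1/2` for the clique, and `0` for the rest of
`[0, p]`, and has length asymptotic to `C i * p ^ (1 + γ κ i)`. The value on the block `(i, j)`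
is `1` if `κ i + κ j ≥ 1`, so that an assignment `B` of blocks to vertices maps an edge to a block
with value `1` exactly if the fractional cover `κ ∘ B` covers it. -/
structure HubCliqueProfile (γ : ℝ) (κ C : Fin (m + 1) → ℝ) (W : ℝ → BlockGraphon m) : Prop where
  κ_last : κ (Fin.last m) = 0
  κ_mem : ∀ i, κ i = 0 ∨ κ i = 1 / 2 ∨ κ i = 1
  C_pos : ∀ i, 0 < C i
  len_tendsto : ∀ i, Tendsto (fun p => (W p).len i / p ^ blockExp γ κ i) (𝓝[>] 0) (𝓝 (C i))
  sum_len_le : ∀ᶠ p in 𝓝[>] 0, ∑ i with i ≠ Fin.last m, (W p).len i ≤ p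
  hub_val : ∀ i, i ≠ Fin.last m → κ i = 1 → ∀ᶠ p in 𝓝[>] 0, (W p).val i (Fin.last m) = 0
  row_sum : ∀ᶠ p in 𝓝[>] 0, ∀ i, ∑ j, (W p).len j * (W p).val i j = p
  val_eq : ∀ᶠ p in 𝓝[>] 0, ∀ i j, i ≠ Fin.last m → j ≠ Fin.last m →
    (W p).val i j = coreVal κ p i j

namespace HubCliqueProfile

variable {γ : ℝ} {κ C : Fin (m + 1) → ℝ} {W : ℝ → BlockGraphon m}

theorem κ_nonneg (h : HubCliqueProfile γ κ C W) (i) : 0 ≤ κ i := by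
  rcases h.κ_mem i with h | h | h <;> rw [h] <;> norm_num

theorem κ_le_one (h : HubCliqueProfile γ κ C W) (i) : κ i ≤ 1 := by
  rcases h.κ_mem i with h | h | h <;> rw [h] <;> norm_num

theorem blockExp_last : blockExp γ κ (Fin.last m) = 0 := if_pos rfl

theorem blockExp_of_ne {i : Fin (m + 1)} (hi : i ≠ Fin.last m) :
    blockExp γ κ i = 1 + γ * κ i := if_neg hi

theorem blockExp_le (h : HubCliqueProfile γ κ C W) (hγ : 0 < γ) (i) : blockExp γ κ i ≤ 1 + γ := by
  unfold blockExp
  have := mul_le_of_le_one_right hγ.le (h.κ_le_one i)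
  split_ifs <;> linarith

theorem len_le (h : HubCliqueProfile γ κ C W) : ∃ M, 1 ≤ M ∧ ∀ᶠ p in 𝓝[>] 0, ∀ i,
    (W p).len i ≤ M * p ^ blockExp γ κ i := by
  refine ⟨1 + ∑ i, C i, le_add_of_nonneg_right (Finset.sum_nonneg fun i _ => (h.C_pos i).le), ?_⟩
  refine eventually_all.2 fun i => ?_
  have hC : C i < 1 + ∑ i, C i := by
    have := Finset.single_le_sum (fun i _ => (h.C_pos i).le) (Finset.mem_univ i)
    linarith
  filter_upwards [(h.len_tendsto i).eventually_lt_const hC, eventually_mem_Ioo one_pos] with p hp hp1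
  exact ((div_lt_iff₀ (Real.rpow_pos_of_pos hp1.1 _)).1 hp).le

theorem le_len (h : HubCliqueProfile γ κ C W) (i) : ∀ᶠ p in 𝓝[>] 0,
    C i / 2 * p ^ blockExp γ κ i ≤ (W p).len i := by
  filter_upwards [(h.len_tendsto i).eventually_const_lt (half_lt_self (h.C_pos i)),
    eventually_mem_Ioo one_pos] with p hp hp1
  exact ((lt_div_iff₀ (Real.rpow_pos_of_pos hp1.1 _)).1 hp).le

theorem len_last (W : BlockGraphon m) :
    W.len (Fin.last m) = 1 - ∑ i with i ≠ Fin.last m, W.len i := by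
  have h1 := W.sum_len
  rw [← Finset.sum_filter_add_sum_filter_not _ (fun i => i ≠ Fin.last m)] at h1
  simp only [ne_eq, not_not, Finset.sum_filter, Finset.sum_ite_eq', Finset.mem_univ,
    if_true] at h1 ⊢
  linarith

theorem one_sub_le_len_last (h : HubCliqueProfile γ κ C W) : ∀ᶠ p in 𝓝[>] 0,
    1 - p ≤ (W p).len (Fin.last m) := by
  filter_upwards [h.sum_len_le] with p hp
  have := len_last (W p)
  linarith

theorem val_one (h : HubCliqueProfile γ κ C W) : ∀ᶠ p in 𝓝[>] 0, ∀ i j, IsOneBlock κ i j →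
    (W p).val i j = 1 := by
  filter_upwards [h.val_eq] with p hp i j hij
  rw [hp i j hij.1 hij.2.1, coreVal, if_pos hij.2.2]

theorem val_core (h : HubCliqueProfile γ κ C W) : ∀ᶠ p in 𝓝[>] 0, ∀ i j, i ≠ Fin.last m →
    j ≠ Fin.last m → ¬ IsOneBlock κ i j → (W p).val i j = p := by
  filter_upwards [h.val_eq] with p hp i j hi hj hij
  rw [hp i j hi hj, coreVal, if_neg fun hc => hij ⟨hi, hj, hc⟩]

theorem val_le (h : HubCliqueProfile γ κ C W) : ∀ᶠ p in 𝓝[>] 0, ∀ i j, ¬ IsOneBlock κ i j →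
    (W p).val i j ≤ 2 * p := by
  filter_upwards [h.val_core, h.row_sum, h.one_sub_le_len_last,
    eventually_mem_Ioo (show (0 : ℝ) < 1 / 2 by norm_num)] with p hc hr hl hp i j hij
  have key : ∀ i, (W p).val i (Fin.last m) ≤ 2 * p := fun i => by
    have h1 := Finset.single_le_sum (f := fun j => (W p).len j * (W p).val i j)
      (fun j _ => mul_nonneg ((W p).len_nonneg j) ((W p).val_mem i j).1) (Finset.mem_univ (Fin.last m))
    rw [hr i] at h1
    have h2 := ((W p).val_mem i (Fin.last m)).1
    have h3 : (W p).len (Fin.last m) * (W p).val i (Fin.last m) ≤ p := h1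
    nlinarith
  by_cases hi : i = Fin.last m
  · rw [hi, (W p).val_symm]
    exact key j
  by_cases hj : j = Fin.last m
  · rw [hj]
    exact key i
  rw [hc i j hi hj hij]
  linarith

/-- The deviation from `p` of the values that are forced by regularity. -/
theorem val_last_sub (h : HubCliqueProfile γ κ C W) (hγ : 0 < γ) : ∃ M, 0 < M ∧ ∀ᶠ p in 𝓝[>] 0,
    ∀ i, |(W p).val i (Fin.last m) - p| ≤ M * p ^ (2 + γ - blockExp γ κ i) := by
  obtain ⟨M, hM1, hM⟩ := h.len_le
  have hM0 : 0 < M := zero_lt_one.trans_le hM1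
  set N : ℝ := ((Finset.univ.filter fun j => j ≠ Fin.last m).card : ℝ) with hN
  have hN0 : 0 ≤ N := Nat.cast_nonneg _
  set M₁ : ℝ := 2 * (N * M) with hM₁
  have hM₁0 : 0 ≤ M₁ := by positivity
  refine ⟨M₁ + 2 * (N * (M * M₁)) + 1, by positivity, ?_⟩
  filter_upwards [hM, h.val_core, h.row_sum, h.one_sub_le_len_last,
    eventually_mem_Ioo (show (0 : ℝ) < 1 / 2 by norm_num)] with p hM hc hr hl hp
  have hl' := len_last (W p)
  have hp0 := hp.1
  have hdev : ∀ i, |(W p).val i (Fin.last m) - p| ≤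
      2 * ∑ j with j ≠ Fin.last m, (W p).len j * |(W p).val i j - p| := by
    intro i
    have h1 := hr i
    rw [← Finset.sum_filter_add_sum_filter_not _ (fun j => j ≠ Fin.last m)] at h1
    have h2 : ∑ j with ¬ j ≠ Fin.last m, (W p).len j * (W p).val i j =
        (W p).len (Fin.last m) * (W p).val i (Fin.last m) := by simp [Finset.sum_filter]
    rw [h2] at h1
    have h3 : (W p).len (Fin.last m) * ((W p).val i (Fin.last m) - p) =
        - ∑ j with j ≠ Fin.last m, (W p).len j * ((W p).val i j - p) := by
      simp only [mul_sub, Finset.sum_sub_distrib, ← Finset.sum_mul]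
      rw [hl'] at h1 ⊢
      linarith
    have h4 : (W p).len (Fin.last m) * |(W p).val i (Fin.last m) - p| ≤
        ∑ j with j ≠ Fin.last m, (W p).len j * |(W p).val i j - p| := by
      rw [← abs_of_nonneg ((W p).len_nonneg (Fin.last m)), ← abs_mul, h3, abs_neg]
      refine (Finset.abs_sum_le_sum_abs _ _).trans_eq (Finset.sum_congr rfl fun j _ => ?_)
      rw [abs_mul, abs_of_nonneg ((W p).len_nonneg j)]
    have h5 := abs_nonneg ((W p).val i (Fin.last m) - p)
    nlinarith
  have hcore : ∀ i, i ≠ Fin.last m →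
      |(W p).val i (Fin.last m) - p| ≤ M₁ * p ^ (2 + γ - blockExp γ κ i) := by
    intro i hi
    refine (hdev i).trans ?_
    rw [hM₁, mul_assoc, mul_assoc]
    refine mul_le_mul_of_nonneg_left ?_ (by norm_num)
    rw [hN, ← nsmul_eq_mul]
    refine Finset.sum_le_card_nsmul _ _ _ fun j hj => ?_
    have hj := (Finset.mem_filter.1 hj).2
    by_cases hij : IsOneBlock κ i j
    · have h1 : |(W p).val i j - p| ≤ 1 := by
        have := (W p).val_mem i j
        exact abs_le.2 ⟨by linarith [this.1], by linarith [this.2]⟩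
      refine (mul_le_of_le_one_right ((W p).len_nonneg j) h1).trans ((hM j).trans ?_)
      refine mul_le_mul_of_nonneg_left ?_ hM0.le
      refine Real.rpow_le_rpow_of_exponent_ge hp0 (by linarith) ?_
      rw [blockExp_of_ne hi, blockExp_of_ne hj]
      nlinarith [hij.2.2]
    · rw [hc i j hi hj hij, sub_self, abs_zero, mul_zero]
      positivity
  intro i
  have hpow := Real.rpow_nonneg hp0.le (2 + γ - blockExp γ κ i)
  by_cases hi : i = Fin.last m
  · subst hi
    rw [blockExp_last, sub_zero] at hpow ⊢
    refine (hdev _).trans (le_trans (b := 2 * (N * (M * M₁)) * p ^ (2 + γ)) ?_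
      (mul_le_mul_of_nonneg_right (by linarith) hpow))
    rw [mul_assoc, mul_assoc]
    refine mul_le_mul_of_nonneg_left ?_ (by norm_num)
    rw [hN, ← nsmul_eq_mul]
    refine Finset.sum_le_card_nsmul _ _ _ fun j hj => ?_
    have hj := (Finset.mem_filter.1 hj).2
    have h1 := hcore j hj
    rw [(W p).val_symm] at h1
    refine (mul_le_mul (hM j) h1 (abs_nonneg _) (by positivity)).trans_eq ?_
    rw [Real.rpow_sub hp0]
    field_simp
  · exact (hcore i hi).trans (mul_le_mul_of_nonneg_right (by
      have : 0 ≤ 2 * (N * (M * M₁)) := by positivity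
      linarith) hpow)

open Classical in
/-- The entropy is of order `p ^ (2 + γ) * log (1 / p)`; the main contribution comes from the blocks
`(i, j)` with value `1` and `κ i + κ j = 1`. -/
theorem entropy_tendsto (h : HubCliqueProfile γ κ C W) (hγ : 0 < γ) :
    Tendsto (fun p => (W p).entropy p / (p ^ (2 + γ) * Real.log (1 / p))) (𝓝[>] 0)
      (𝓝 (∑ i, ∑ j, if IsOneBlock κ i j ∧ κ i + κ j = 1 then C i * C j else 0)) := by
  have hsum : ∀ p, (W p).entropy p / (p ^ (2 + γ) * Real.log (1 / p)) = ∑ i, ∑ j,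
      (W p).len i * (W p).len j * relEntropy p ((W p).val i j) /
        (p ^ (2 + γ) * Real.log (1 / p)) := fun p => by
    simp only [BlockGraphon.entropy_eq_sum, Finset.sum_div]
  simp_rw [hsum]
  obtain ⟨M, hM1, hM⟩ := h.len_le
  have hM0 : 0 < M := zero_lt_one.trans_le hM1
  obtain ⟨M', hM'0, hM'⟩ := h.val_last_sub hγ
  have hlog := tendsto_log_inv_nhdsGT_zero.eventually_ge_atTop 1
  -- the blocks in the last row and column are negligible, by the `χ²` bound
  have hlast : ∀ i, Tendsto (fun p => (W p).len i * (W p).len (Fin.last m) *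
      relEntropy p ((W p).val i (Fin.last m)) / (p ^ (2 + γ) * Real.log (1 / p))) (𝓝[>] 0) (𝓝 0) := by
    intro i
    have hlim : Tendsto (fun p : ℝ => M * (2 * M' ^ 2) * (Real.log (1 / p))⁻¹) (𝓝[>] 0) (𝓝 0) := by
      simpa using tendsto_log_inv_nhdsGT_zero.inv_tendsto_atTop.const_mul (M * (2 * M' ^ 2))
    refine tendsto_of_tendsto_of_tendsto_of_le_of_le' tendsto_const_nhds hlim ?_ ?_
    · filter_upwards [hlog, eventually_mem_Ioo one_pos] with p hL hp
      exact div_nonneg (mul_nonneg (mul_nonneg ((W p).len_nonneg _) ((W p).len_nonneg _))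
        (relEntropy_nonneg hp.1 hp.2 ((W p).val_mem _ _)))
        (mul_nonneg (Real.rpow_nonneg hp.1.le _) (by linarith))
    · filter_upwards [hlog, eventually_mem_Ioo (show (0 : ℝ) < 1 / 2 by norm_num), hM, hM']
        with p hL hp hM hM'
      have hp0 := hp.1
      have hlen1 : (W p).len (Fin.last m) ≤ 1 := by
        rw [← (W p).sum_len]
        exact Finset.single_le_sum (fun j _ => (W p).len_nonneg j) (Finset.mem_univ _)
      have hI : relEntropy p ((W p).val i (Fin.last m)) ≤
          2 * M' ^ 2 * p ^ (2 * (2 + γ - blockExp γ κ i) - 1) := by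
        refine (relEntropy_le hp0 (by linarith) ((W p).val_mem _ _)).trans ?_
        have h1 : ((W p).val i (Fin.last m) - p) ^ 2 ≤
            (M' * p ^ (2 + γ - blockExp γ κ i)) ^ 2 := by
          rw [← sq_abs]
          exact pow_le_pow_left₀ (abs_nonneg _) (hM' i) 2
        rw [div_le_iff₀ (mul_pos hp0 (by linarith))]
        refine h1.trans ?_
        have h2 : p ^ (2 * (2 + γ - blockExp γ κ i) - 1) * p = (p ^ (2 + γ - blockExp γ κ i)) ^ 2 := by
          rw [← Real.rpow_add_one hp0.ne', ← Real.rpow_natCast, ← Real.rpow_mul hp0.le]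
          congr 1
          push_cast
          ring
        rw [mul_pow, ← h2]
        have h3 : 0 ≤ M' ^ 2 * (p ^ (2 * (2 + γ - blockExp γ κ i) - 1) * p) := by positivity
        nlinarith
      rw [div_le_iff₀ (mul_pos (Real.rpow_pos_of_pos hp0 _) (by linarith))]
      calc (W p).len i * (W p).len (Fin.last m) * relEntropy p ((W p).val i (Fin.last m))
          ≤ (M * p ^ blockExp γ κ i * 1) * (2 * M' ^ 2 * p ^ (2 * (2 + γ - blockExp γ κ i) - 1)) := by
            refine mul_le_mul (mul_le_mul (hM i) hlen1 ((W p).len_nonneg _) (by positivity)) hI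
              (relEntropy_nonneg hp0 (by linarith) ((W p).val_mem _ _)) (by positivity)
        _ = M * (2 * M' ^ 2) * p ^ (2 * (2 + γ) - blockExp γ κ i - 1) := by
            rw [show 2 * (2 + γ) - blockExp γ κ i - 1 = blockExp γ κ i +
              (2 * (2 + γ - blockExp γ κ i) - 1) by ring, Real.rpow_add hp0]
            ring
        _ ≤ M * (2 * M' ^ 2) * p ^ (2 + γ) := by
            refine mul_le_mul_of_nonneg_left ?_ (by positivity)
            refine Real.rpow_le_rpow_of_exponent_ge hp0 (by linarith) ?_
            have := h.blockExp_le hγ i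
            linarith
        _ = _ := by
            field_simp
  refine tendsto_finsetSum _ fun i _ => tendsto_finsetSum _ fun j _ => ?_
  by_cases hj : j = Fin.last m
  · subst hj
    rw [if_neg fun hc => hc.1.2.1 rfl]
    exact hlast i
  by_cases hi : i = Fin.last m
  · subst hi
    rw [if_neg fun hc => hc.1.1 rfl]
    refine (hlast j).congr fun p => ?_
    rw [(W p).val_symm, mul_comm ((W p).len j)]
  by_cases hij : IsOneBlock κ i j
  · have hlim : Tendsto (fun p : ℝ => p ^ (γ * (κ i + κ j - 1))) (𝓝[>] 0)
        (𝓝 (if κ i + κ j = 1 then 1 else 0)) := by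
      split_ifs with h1
      · simp [h1]
      · exact tendsto_rpow_nhdsGT_zero
          (mul_pos hγ (sub_pos.2 (lt_of_le_of_ne hij.2.2 (Ne.symm h1))))
    have := ((h.len_tendsto i).mul (h.len_tendsto j)).mul hlim
    have hval : C i * C j * (if κ i + κ j = 1 then 1 else 0) =
        if IsOneBlock κ i j ∧ κ i + κ j = 1 then C i * C j else 0 := by
      simp only [hij, true_and]
      split_ifs <;> simp
    rw [hval] at this
    refine this.congr' ?_
    filter_upwards [h.val_one, eventually_mem_Ioo one_pos] with p h1 hp
    have hp0 := hp.1
    have hL : 0 < Real.log (1 / p) := Real.log_pos (by rw [one_div]; exact (one_lt_inv₀ hp0).2 hp.2)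
    rw [h1 i j hij]
    have hI : relEntropy p 1 = Real.log (1 / p) := by simp [relEntropy]
    rw [hI, blockExp_of_ne hi, blockExp_of_ne hj,
      show γ * (κ i + κ j - 1) = (1 + γ * κ i) + (1 + γ * κ j) - (2 + γ) by ring, Real.rpow_sub hp0,
      Real.rpow_add hp0 (1 + γ * κ i)]
    have h2 := Real.rpow_pos_of_pos hp0 (1 + γ * κ i)
    have h3 := Real.rpow_pos_of_pos hp0 (1 + γ * κ j)
    have h4 := Real.rpow_pos_of_pos hp0 (2 + γ)
    generalize p ^ (1 + γ * κ i) = x at *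
    generalize p ^ (1 + γ * κ j) = y at *
    generalize p ^ (2 + γ) = z at *
    field_simp
  · rw [if_neg fun hc => hij hc.1]
    refine tendsto_const_nhds.congr' ?_
    filter_upwards [h.val_core, eventually_mem_Ioo one_pos] with p h1 hp
    have h2 : 1 - p ≠ 0 := (sub_pos.2 hp.2).ne'
    rw [h1 i j hi hj hij]
    simp [relEntropy, div_self hp.1.ne', div_self h2]

end HubCliqueProfile

end Profile

/-! ### The contribution of a single assignment of blocks -/

section ProfileHom

variable {m : ℕ} {V : Type*} [Fintype V]

open Classical in
/-- The edges of `K` that `B` maps to blocks with value `1`. -/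
noncomputable def oneEdges (K : SimpleGraph V) (κ : Fin (m + 1) → ℝ) (B : V → Fin (m + 1)) :
    Finset (Sym2 V) :=
  K.edgeFinset.filter fun e => ∃ u v, e = s(u, v) ∧ IsOneBlock κ (B u) (B v)

theorem IsOneBlock.symm {κ : Fin (m + 1) → ℝ} {i j : Fin (m + 1)} (h : IsOneBlock κ i j) :
    IsOneBlock κ j i := ⟨h.2.1, h.1, by rw [add_comm]; exact h.2.2⟩

theorem mk_mem_oneEdges {K : SimpleGraph V} {κ : Fin (m + 1) → ℝ} {B : V → Fin (m + 1)} {u v : V} :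
    s(u, v) ∈ oneEdges K κ B ↔ K.Adj u v ∧ IsOneBlock κ (B u) (B v) := by
  classical
  simp only [oneEdges, Finset.mem_filter, SimpleGraph.mem_edgeFinset, SimpleGraph.mem_edgeSet]
  refine and_congr_right fun _ => ⟨?_, fun h => ⟨u, v, rfl, h⟩⟩
  rintro ⟨a, b, hab, h⟩
  rcases Sym2.eq_iff.1 hab with ⟨rfl, rfl⟩ | ⟨rfl, rfl⟩
  · exact h
  · exact h.symm

theorem oneEdges_subset (K : SimpleGraph V) (κ : Fin (m + 1) → ℝ) (B : V → Fin (m + 1)) :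
    (oneEdges K κ B : Set (Sym2 V)) ⊆ K.edgeSet := by
  classical
  intro e he
  simpa using (Finset.mem_filter.1 (Finset.mem_coe.1 he)).1

theorem card_oneEdges_le_numEdges (K : SimpleGraph V) (κ : Fin (m + 1) → ℝ)
    (B : V → Fin (m + 1)) : (oneEdges K κ B).card ≤ K.numEdges := by
  classical
  rw [SimpleGraph.numEdges_eq_card]
  exact Finset.card_le_card (Finset.filter_subset _ _)

open Classical in
theorem sum_blockExp {γ : ℝ} {κ : Fin (m + 1) → ℝ} (hκ : κ (Fin.last m) = 0)
    (B : V → Fin (m + 1)) : ∑ v, blockExp γ κ (B v) =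
      (Finset.univ.filter fun v => B v ≠ Fin.last m).card + γ * ∑ v, κ (B v) := by
  have : ∀ v, blockExp γ κ (B v) = (if B v ≠ Fin.last m then (1 : ℝ) else 0) + γ * κ (B v) := by
    intro v
    unfold blockExp
    by_cases hv : B v = Fin.last m
    · simp [hv, hκ]
    · simp [hv]
  simp only [this, Finset.sum_add_distrib, ← Finset.mul_sum, Finset.sum_boole]

open Classical in
theorem prod_ite_mem_oneEdges (K : SimpleGraph V) (κ : Fin (m + 1) → ℝ) (B : V → Fin (m + 1))
    (p : ℝ) : ∏ e ∈ K.edgeFinset, (if e ∈ oneEdges K κ B then 1 else p) =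
      p ^ (K.numEdges - (oneEdges K κ B).card) := by
  rw [Finset.prod_ite, Finset.prod_const_one, one_mul, Finset.prod_const]
  congr 1
  have h3 : K.edgeFinset.filter (fun e => e ∈ oneEdges K κ B) = oneEdges K κ B := by
    ext e
    simp only [Finset.mem_filter, and_iff_right_iff_imp]
    exact fun he => (Finset.mem_filter.1 he).1
  have h4 := Finset.card_filter_add_card_filter_not (s := K.edgeFinset)
    (fun e => e ∈ oneEdges K κ B)
  rw [h3, ← SimpleGraph.numEdges_eq_card] at h4
  omega

open Classical in
theorem prod_blockVal_le (K : SimpleGraph V) {γ p M D : ℝ} {ℓ κ : Fin (m + 1) → ℝ}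
    {val : Fin (m + 1) → Fin (m + 1) → ℝ} (hs : ∀ i j, val i j = val j i) (hp0 : 0 < p)
    (hM : 1 ≤ M) (hℓ0 : ∀ i, 0 ≤ ℓ i) (hℓ : ∀ i, ℓ i ≤ M * p ^ blockExp γ κ i)
    (hv0 : ∀ i j, 0 ≤ val i j) (hv1 : ∀ i j, IsOneBlock κ i j → val i j ≤ D)
    (hv2 : ∀ i j, ¬ IsOneBlock κ i j → val i j ≤ D * p) (B : V → Fin (m + 1)) :
    (∏ v, ℓ (B v)) * ∏ e ∈ K.edgeFinset, blockVal hs B e ≤ M ^ Fintype.card V * D ^ K.numEdges *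
      p ^ (∑ v, blockExp γ κ (B v) + K.numEdges - (oneEdges K κ B).card) := by
  have h1 : ∏ v, ℓ (B v) ≤ M ^ Fintype.card V * p ^ (∑ v, blockExp γ κ (B v)) := by
    refine (Finset.prod_le_prod (fun v _ => hℓ0 _) fun v _ => hℓ (B v)).trans_eq ?_
    rw [Finset.prod_mul_distrib, Finset.prod_const, Finset.card_univ, Real.rpow_sum_of_pos hp0]
  have h2 : ∏ e ∈ K.edgeFinset, blockVal hs B e ≤
      D ^ K.numEdges * p ^ ((K.numEdges : ℝ) - (oneEdges K κ B).card) := by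
    have hle : ∀ e ∈ K.edgeFinset, blockVal hs B e ≤
        D * if e ∈ oneEdges K κ B then 1 else p := by
      intro e he
      induction e with | _ u v
      have huv : K.Adj u v := by simpa using he
      split_ifs with h
      · rw [mul_one]
        exact hv1 _ _ (mk_mem_oneEdges.1 h).2
      · exact hv2 _ _ fun hc => h (mk_mem_oneEdges.2 ⟨huv, hc⟩)
    refine (Finset.prod_le_prod (fun e _ => ?_) hle).trans_eq ?_
    · induction e with | _ u v
      exact hv0 _ _
    · rw [Finset.prod_mul_distrib, Finset.prod_const, ← SimpleGraph.numEdges_eq_card,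
        ← Nat.cast_sub (card_oneEdges_le_numEdges K κ B), Real.rpow_natCast,
        ← prod_ite_mem_oneEdges]
  have hnn : 0 ≤ ∏ e ∈ K.edgeFinset, blockVal hs B e := Finset.prod_nonneg fun e _ => by
    induction e with | _ u v
    exact hv0 _ _
  refine (mul_le_mul h1 h2 hnn (by positivity)).trans_eq ?_
  rw [add_sub_assoc, Real.rpow_add hp0]
  ring

namespace HubCliqueProfile

variable {K : SimpleGraph V} {κ C : Fin (m + 1) → ℝ} {W : ℝ → BlockGraphon m}

theorem card_oneEdges_le (h : HubCliqueProfile K.gammaInv κ C W) (hγ : 0 < K.gammaInv)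
    (B : V → Fin (m + 1)) :
    ((oneEdges K κ B).card : ℝ) ≤ ∑ v, blockExp K.gammaInv κ (B v) := by
  classical
  rw [sum_blockExp h.κ_last]
  refine SimpleGraph.card_le_of_cover hγ.le (oneEdges_subset K κ B) (fun u v huv => ?_)
    (fun v => h.κ_nonneg _) fun u v huv => (mk_mem_oneEdges.1 huv).2.2.2
  simpa using (mk_mem_oneEdges.1 huv).2.1

theorem homBlock_isBigO (h : HubCliqueProfile K.gammaInv κ C W) (B : V → Fin (m + 1)) :
    (fun p => (W p).homBlock K B) =O[𝓝[>] 0] fun p =>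
      p ^ (∑ v, blockExp K.gammaInv κ (B v) + K.numEdges - (oneEdges K κ B).card) := by
  classical
  obtain ⟨M, hM1, hM⟩ := h.len_le
  refine IsBigO.of_bound (M ^ Fintype.card V * 2 ^ K.numEdges) ?_
  filter_upwards [hM, h.val_one, h.val_le, eventually_mem_Ioo one_pos] with p hM h1 h2 hp
  rw [Real.norm_of_nonneg ((W p).homBlock_nonneg K B),
    Real.norm_of_nonneg (Real.rpow_nonneg hp.1.le _), BlockGraphon.homBlock_eq]
  exact prod_blockVal_le K _ hp.1 hM1 (W p).len_nonneg hM
    (fun i j => ((W p).val_mem i j).1) (fun i j hij => by rw [h1 i j hij]; norm_num) h2 B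

/-- Assignments with too few edges on blocks of value `1` are negligible. -/
theorem homBlock_isLittleO (h : HubCliqueProfile K.gammaInv κ C W) {B : V → Fin (m + 1)}
    (hlt : ((oneEdges K κ B).card : ℝ) < ∑ v, blockExp K.gammaInv κ (B v)) :
    (fun p => (W p).homBlock K B) =o[𝓝[>] 0] fun p => p ^ K.numEdges := by
  refine (h.homBlock_isBigO B).trans_isLittleO ?_
  simp only [← Real.rpow_natCast]
  exact rpow_isLittleO_rpow (by linarith)

theorem hom_addConst_isBigO (h : HubCliqueProfile K.gammaInv κ C W) (hγ : 0 < K.gammaInv) :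
    (fun p => ((W p).toGraphon.toSymmKernel.addConst p).hom K) =O[𝓝[>] 0]
      fun p => p ^ K.numEdges := by
  classical
  obtain ⟨M, hM1, hM⟩ := h.len_le
  refine IsBigO.of_bound (Fintype.card (V → Fin (m + 1)) • (M ^ Fintype.card V * 3 ^ K.numEdges)) ?_
  filter_upwards [hM, h.val_one, h.val_le, eventually_mem_Ioo one_pos] with p hM h1 h2 hp
  have hs : ∀ i j, (W p).val i j + p = (W p).val j i + p := fun i j => by rw [(W p).val_symm]
  have hv0 : ∀ i j, 0 ≤ (W p).val i j + p := fun i j => add_nonneg ((W p).val_mem i j).1 hp.1.le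
  rw [Real.norm_of_nonneg (pow_nonneg hp.1.le _), SymmKernel.hom_eq_sum K (W p).measurable_part
    ((W p).toGraphon.toSymmKernel.addConst p) (val := fun i j => (W p).val i j + p) hs
    fun _ _ => rfl, smul_mul_assoc, ← Finset.card_univ]
  rw [Real.norm_of_nonneg]
  · refine Finset.sum_le_card_nsmul _ _ _ fun B _ => ?_
    have hB := prod_blockVal_le K (D := 3) hs hp.1 hM1 (W p).len_nonneg hM
      hv0 (fun i j hij => by rw [h1 i j hij]; linarith [hp.2])
      (fun i j hij => by linarith [h2 i j hij]) B
    refine hB.trans (mul_le_mul_of_nonneg_left ?_ (by positivity))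
    rw [← Real.rpow_natCast]
    refine Real.rpow_le_rpow_of_exponent_ge hp.1 hp.2.le ?_
    linarith [h.card_oneEdges_le hγ B]
  · refine Finset.sum_nonneg fun B _ => mul_nonneg (Finset.prod_nonneg fun v _ => measureReal_nonneg)
      (Finset.prod_nonneg fun e _ => ?_)
    induction e with | _ u v
    exact hv0 _ _

/-- An assignment that maps an edge of `K` to the block of the hub and the last block does not
contribute, since the graphon vanishes there. -/
theorem homBlock_eq_zero (h : HubCliqueProfile K.gammaInv κ C W) {B : V → Fin (m + 1)} {u v : V}
    (huv : K.Adj u v) (hu : B u ≠ Fin.last m) (hκ : κ (B u) = 1) (hv : B v = Fin.last m) :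
    ∀ᶠ p in 𝓝[>] 0, (W p).homBlock K B = 0 := by
  classical
  filter_upwards [h.hub_val _ hu hκ] with p hp
  rw [BlockGraphon.homBlock_eq, Finset.prod_eq_zero (i := s(u, v)), mul_zero]
  · simpa using huv
  · change (W p).val (B u) (B v) = 0
    rw [hv, hp]

/-- The values other than `1` are asymptotic to `p`, unless they are `0`. -/
theorem val_div_tendsto (h : HubCliqueProfile K.gammaInv κ C W) (hγ : 0 < K.gammaInv)
    {i j : Fin (m + 1)} (hij : ¬ IsOneBlock κ i j)
    (hi : ¬ (i ≠ Fin.last m ∧ κ i = 1 ∧ j = Fin.last m))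
    (hj : ¬ (j ≠ Fin.last m ∧ κ j = 1 ∧ i = Fin.last m)) :
    Tendsto (fun p => (W p).val i j / p) (𝓝[>] 0) (𝓝 1) := by
  obtain ⟨M, hM0, hM⟩ := h.val_last_sub hγ
  have key : ∀ i, ¬ (i ≠ Fin.last m ∧ κ i = 1) →
      Tendsto (fun p => (W p).val i (Fin.last m) / p) (𝓝[>] 0) (𝓝 1) := by
    intro i hi
    have hexp : 0 < 1 + K.gammaInv - blockExp K.gammaInv κ i := by
      by_cases hl : i = Fin.last m
      · rw [hl, blockExp_last]
        linarith
      · have h1 : κ i < 1 := lt_of_le_of_ne (h.κ_le_one i) fun hc => hi ⟨hl, hc⟩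
        rw [blockExp_of_ne hl]
        nlinarith
    rw [tendsto_iff_norm_sub_tendsto_zero]
    have hlim := (tendsto_rpow_nhdsGT_zero hexp).const_mul M
    rw [mul_zero] at hlim
    refine squeeze_zero' (Eventually.of_forall fun p => norm_nonneg _) ?_ hlim
    filter_upwards [hM, eventually_mem_Ioo one_pos] with p hM hp
    have hp0 := hp.1
    have : (W p).val i (Fin.last m) / p - 1 = ((W p).val i (Fin.last m) - p) / p := by
      rw [sub_div, div_self hp0.ne']
    rw [this, Real.norm_eq_abs, abs_div, abs_of_pos hp0, div_le_iff₀ hp0, mul_assoc,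
      ← Real.rpow_add_one hp0.ne']
    refine (hM i).trans_eq ?_
    congr 2
    ring
  by_cases hjl : j = Fin.last m
  · subst hjl
    exact key i fun hc => hi ⟨hc.1, hc.2, rfl⟩
  by_cases hil : i = Fin.last m
  · subst hil
    simp only [(W _).val_symm (Fin.last m)]
    exact key j fun hc => hj ⟨hc.1, hc.2, rfl⟩
  · refine tendsto_const_nhds.congr' ?_
    filter_upwards [h.val_core, eventually_mem_Ioo one_pos] with p hc hp
    rw [hc i j hil hjl hij, div_self hp.1.ne']

/-- The limit of the contribution of an assignment `B`, relative to `p ^ e(K)`, if `B` maps as many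
edges as possible to blocks of value `1`. -/
theorem homBlock_div_tendsto (h : HubCliqueProfile K.gammaInv κ C W) (hγ : 0 < K.gammaInv)
    {B : V → Fin (m + 1)}
    (heq : ((oneEdges K κ B).card : ℝ) = ∑ v, blockExp K.gammaInv κ (B v))
    (hhub : ∀ u v, K.Adj u v → B u ≠ Fin.last m → κ (B u) = 1 → B v ≠ Fin.last m) :
    Tendsto (fun p => (W p).homBlock K B / p ^ K.numEdges) (𝓝[>] 0) (𝓝 (∏ v, C (B v))) := by
  classical
  have h1 : Tendsto (fun p => ∏ v, ((W p).len (B v) / p ^ blockExp K.gammaInv κ (B v))) (𝓝[>] 0)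
      (𝓝 (∏ v, C (B v))) := tendsto_finsetProd _ fun v _ => h.len_tendsto _
  have h2 : Tendsto (fun p => ∏ e ∈ K.edgeFinset, (blockVal (W p).val_symm B e /
      if e ∈ oneEdges K κ B then 1 else p)) (𝓝[>] 0) (𝓝 (∏ _e ∈ K.edgeFinset, 1)) := by
    refine tendsto_finsetProd _ fun e he => ?_
    induction e with | _ u v
    have huv : K.Adj u v := by simpa using he
    by_cases hone : s(u, v) ∈ oneEdges K κ B
    · refine tendsto_const_nhds.congr' ?_
      filter_upwards [h.val_one] with p hp
      have : blockVal (W p).val_symm B s(u, v) = 1 := hp _ _ (mk_mem_oneEdges.1 hone).2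
      rw [this, if_pos hone, div_one]
    · simp only [hone, if_false]
      exact h.val_div_tendsto hγ (fun hc => hone (mk_mem_oneEdges.2 ⟨huv, hc⟩))
        (fun hc => hhub u v huv hc.1 hc.2.1 hc.2.2)
        (fun hc => hhub v u huv.symm hc.1 hc.2.1 hc.2.2)
  have h3 := h1.mul h2
  rw [Finset.prod_const_one, mul_one] at h3
  refine h3.congr' ?_
  filter_upwards [eventually_mem_Ioo one_pos] with p hp
  have hp0 := hp.1
  rw [Finset.prod_div_distrib, Finset.prod_div_distrib, prod_ite_mem_oneEdges, ← Real.rpow_sum_of_pos hp0, ← heq,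
    Real.rpow_natCast, div_mul_div_comm, ← pow_add,
    Nat.add_sub_cancel' (card_oneEdges_le_numEdges K κ B), BlockGraphon.homBlock_eq]

end HubCliqueProfile

end ProfileHom

/-! ### The conditions for the lower bound on the upper tail -/

section ProfileConditions

theorem log_log_isLittleO_id : (fun x : ℝ => Real.log (Real.log x)) =o[atTop] fun x => x :=
  (Real.isLittleO_log_id_atTop.comp_tendsto Real.tendsto_log_atTop).trans
    Real.isLittleO_log_id_atTop

theorem isLittleO_inv_log_log_log_mul {g : ℝ → ℝ} :
    g =o[𝓝[>] 0] fun p => (Real.log (Real.log (Real.log (1 / p))))⁻¹ * (g p * Real.log (1 / p)) := by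
  have hL := tendsto_log_inv_nhdsGT_zero
  have hLLL := Real.tendsto_log_atTop.comp (Real.tendsto_log_atTop.comp hL)
  have h1 := log_log_isLittleO_id.comp_tendsto hL
  have h2 := ((isBigO_refl (fun p : ℝ => (Real.log (Real.log (Real.log (1 / p))))⁻¹ * g p)
    (𝓝[>] 0)).mul_isLittleO h1)
  refine h2.congr' ?_ (Eventually.of_forall fun p => ?_)
  · filter_upwards [hLLL.eventually_gt_atTop 0] with p hp
    have hp' : Real.log (Real.log (Real.log (1 / p))) ≠ 0 := hp.ne'
    simp only [Function.comp_apply]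
    field_simp
  · simp only [Function.comp_apply]
    ring

theorem SimpleGraph.gammaInv_le {V : Type*} [Fintype V] {K : SimpleGraph V} (hK : K ≠ ⊥)
    (hγ : 0 < K.gammaInv) : K.gammaInv ≤ K.numEdges - 2 := by
  classical
  obtain ⟨H, hHK, hne, heq⟩ := SimpleGraph.exists_eq_gammaInv hK
  have h1 := le_mul_of_one_le_right hγ.le (SimpleGraph.one_le_fracCoverNum hne)
  have h2 : H.numEdges ≤ K.numEdges :=
    Set.ncard_le_ncard (SimpleGraph.edgeSet_subset_edgeSet.2 hHK) (Set.toFinite _)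
  have h3 : 2 ≤ H.numVerts := by
    obtain ⟨a, b, hab⟩ := SimpleGraph.ne_bot_iff_exists_adj.1 hne
    have := Set.ncard_le_ncard (s := {a, b}) (t := H.support)
      (by rintro x (rfl | rfl); exacts [⟨_, hab⟩, ⟨_, hab.symm⟩]) (Set.toFinite _)
    rwa [Set.ncard_pair hab.ne] at this
  have h2' : (H.numEdges : ℝ) ≤ K.numEdges := by exact_mod_cast h2
  have h3' : (2 : ℝ) ≤ H.numVerts := by exact_mod_cast h3
  linarith

variable {m : ℕ} {V : Type*} [Fintype V]

namespace HubCliqueProfile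

variable {K : SimpleGraph V} {κ C : Fin (m + 1) → ℝ} {W : ℝ → BlockGraphon m} {γ Q : ℝ}

theorem isBigO_len (h : HubCliqueProfile γ κ C W) (i) :
    (fun p => p ^ blockExp γ κ i) =O[𝓝[>] 0] fun p => (W p).len i := by
  refine IsBigO.of_bound (C i / 2)⁻¹ ?_
  filter_upwards [h.le_len i, eventually_mem_Ioo one_pos] with p hM hp
  rw [Real.norm_of_nonneg ((W p).len_nonneg i), Real.norm_of_nonneg (Real.rpow_nonneg hp.1.le _)]
  rwa [le_inv_mul_iff₀ (half_pos (h.C_pos i))]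

/-- A block away from the last row and column is important if its value is `1` or
`γ (1 - κ i - κ j) ≤ 1`. -/
theorem val_isLittleO (h : HubCliqueProfile γ κ C W) (hγ : 0 < γ)
    (hE : (fun p => p ^ (2 + γ) * Real.log (1 / p)) =O[𝓝[>] 0] fun p => (W p).entropy p)
    {i j : Fin (m + 1)} (hi : i ≠ Fin.last m) (hj : j ≠ Fin.last m)
    (hij : 1 ≤ κ i + κ j ∨ γ * (1 - κ i - κ j) ≤ 1) :
    (fun p => (W p).len i * (W p).len j * (W p).val i j) =o[𝓝[>] 0]
      fun p => (Real.log (Real.log (Real.log (1 / p))))⁻¹ * (W p).entropy p := by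
  have h1 : (fun p => (W p).len i * (W p).len j * (W p).val i j) =O[𝓝[>] 0]
      fun p => p ^ (2 + γ) := by
    obtain ⟨M, hM1, hM⟩ := h.len_le
    have hM0 : 0 < M := zero_lt_one.trans_le hM1
    refine IsBigO.of_bound (M * M) ?_
    filter_upwards [hM, h.val_core, eventually_mem_Ioo one_pos] with p hM hc hp
    have hp0 := hp.1
    rw [Real.norm_of_nonneg (Real.rpow_nonneg hp0.le _), Real.norm_of_nonneg
      (mul_nonneg (mul_nonneg ((W p).len_nonneg i) ((W p).len_nonneg j)) ((W p).val_mem i j).1)]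
    have h2 : (W p).len i * (W p).len j ≤ M * M * p ^ ((1 + γ * κ i) + (1 + γ * κ j)) := by
      refine (mul_le_mul (hM i) (hM j) ((W p).len_nonneg j) (by positivity)).trans_eq ?_
      rw [Real.rpow_add hp0, blockExp_of_ne hi, blockExp_of_ne hj]
      ring
    by_cases hone : 1 ≤ κ i + κ j
    · refine (mul_le_of_le_one_right (mul_nonneg ((W p).len_nonneg i) ((W p).len_nonneg j))
        ((W p).val_mem i j).2).trans (h2.trans (mul_le_mul_of_nonneg_left ?_ (by positivity)))
      exact Real.rpow_le_rpow_of_exponent_ge hp0 hp.2.le (by nlinarith)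
    · rw [hc i j hi hj fun hc => hone hc.2.2]
      refine (mul_le_mul_of_nonneg_right h2 hp0.le).trans ?_
      rw [mul_assoc _ _ p, ← Real.rpow_add_one hp0.ne']
      refine mul_le_mul_of_nonneg_left ?_ (by positivity)
      refine Real.rpow_le_rpow_of_exponent_ge hp0 hp.2.le ?_
      linarith [hij.resolve_left hone]
  refine h1.trans_isLittleO (isLittleO_inv_log_log_log_mul.trans_isBigO ?_)
  exact (isBigO_refl _ _).mul hE

/-- The converse of `val_isLittleO`. -/
theorem of_isImportantBlock (h : HubCliqueProfile γ κ C W)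
    (hE : (fun p => (W p).entropy p) =O[𝓝[>] 0] fun p => p ^ (2 + γ) * Real.log (1 / p))
    {p : ℕ → ℝ} (hp : Tendsto p atTop (𝓝[>] 0)) {i j : Fin (m + 1)}
    (himp : IsImportantBlock p (fun t => W (p t)) i j) :
    1 ≤ κ i + κ j ∨ γ * (1 - κ i - κ j) ≤ 1 := by
  obtain ⟨hi, hj, himp⟩ := himp
  by_contra! hij
  have h1 : (fun p => p ^ (3 + γ * (κ i + κ j))) =O[𝓝[>] 0]
      fun p => (W p).len i * (W p).len j * (W p).val i j := by
    refine (((h.isBigO_len i).mul (h.isBigO_len j)).mul (isBigO_refl (fun p : ℝ => p) _)).congr' ?_ ?_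
    · filter_upwards [eventually_mem_Ioo one_pos] with p hp
      rw [blockExp_of_ne hi, blockExp_of_ne hj, ← Real.rpow_add hp.1, ← Real.rpow_add_one hp.1.ne']
      congr 1
      ring
    · filter_upwards [h.val_core] with p hc
      rw [hc i j hi hj fun hc => hij.1.not_ge hc.2.2]
  have h2 : (fun p => (Real.log (Real.log (Real.log (1 / p))))⁻¹ * (W p).entropy p) =O[𝓝[>] 0]
      fun p => p ^ (2 + γ) * Real.log (1 / p) := by
    refine IsBigO.trans ?_ hE
    have hLLL := Real.tendsto_log_atTop.comp (Real.tendsto_log_atTop.comp tendsto_log_inv_nhdsGT_zero)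
    refine IsBigO.of_bound 1 ?_
    filter_upwards [hLLL.eventually_ge_atTop 1] with p hp
    rw [norm_mul, norm_inv]
    refine mul_le_mul_of_nonneg_right (inv_le_one_of_one_le₀ ?_) (norm_nonneg _)
    exact le_trans hp (le_abs_self _)
  have h3 : (fun p => p ^ (2 + γ) * Real.log (1 / p)) =o[𝓝[>] 0]
      fun p => p ^ (3 + γ * (κ i + κ j)) :=
    rpow_mul_log_inv_isLittleO_rpow (by linarith)
  have h4 := ((h1.comp_tendsto hp).trans_isLittleO himp).trans
    ((h2.trans_isLittleO h3).comp_tendsto hp)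
  refine isLittleO_irrefl (Eventually.frequently ?_) h4
  filter_upwards [hp.eventually (eventually_mem_Ioo one_pos)] with t ht
  exact (Real.rpow_pos_of_pos ht.1 _).ne'

/-- If `B` is not negligible, then the cover `κ ∘ B` is tight for the edges on blocks of value
`1`; two more edges at a vertex could be covered by raising its weight by at most `1 / γ`, so they
cannot both be on somewhat important blocks. -/
theorem eq_of_not_isNegligible (h : HubCliqueProfile K.gammaInv κ C W) (hγ : 0 < K.gammaInv)
    {B : V → Fin (m + 1)} (hB : ∑ v, blockExp K.gammaInv κ (B v) ≤ (oneEdges K κ B).card)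
    {u v v' : V} (huv : K.Adj u v) (huv' : K.Adj u v')
    (hu : B u ≠ Fin.last m) (hv : B v ≠ Fin.last m) (hv' : B v' ≠ Fin.last m)
    (hs : κ (B u) + κ (B v) < 1) (hs' : κ (B u) + κ (B v') < 1)
    (hγs : K.gammaInv * (1 - κ (B u) - κ (B v)) ≤ 1)
    (hγs' : K.gammaInv * (1 - κ (B u) - κ (B v')) ≤ 1) : v = v' := by
  classical
  by_contra hne
  set r := max (1 - κ (B u) - κ (B v)) (1 - κ (B u) - κ (B v')) with hr
  have hr0 : 0 ≤ r := le_max_of_le_left (by linarith)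
  have hγr : K.gammaInv * r ≤ 1 := by
    rcases max_choice (1 - κ (B u) - κ (B v)) (1 - κ (B u) - κ (B v')) with hc | hc <;>
      rw [hr, hc] <;> assumption
  have hnot : ∀ w, κ (B u) + κ (B w) < 1 → s(u, w) ∉ oneEdges K κ B := fun w hw hc =>
    hw.not_ge (mk_mem_oneEdges.1 hc).2.2.2
  set T := insert s(u, v) (insert s(u, v') (oneEdges K κ B)) with hT
  have hcard : T.card = (oneEdges K κ B).card + 2 := by
    rw [hT, Finset.card_insert_of_notMem, Finset.card_insert_of_notMem (hnot v' hs')]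
    simp only [Finset.mem_insert, not_or]
    refine ⟨fun hc => hne ?_, hnot v hs⟩
    exact Sym2.congr_right.1 hc
  have hadj : ∀ a b, s(a, b) ∈ T → K.Adj a b := by
    intro a b hab
    simp only [hT, Finset.mem_insert] at hab
    rcases hab with hab | hab | hab
    · exact (K.mem_edgeSet (v := a) (w := b)).1 (hab ▸ huv)
    · exact (K.mem_edgeSet (v := a) (w := b)).1 (hab ▸ huv')
    · exact (mk_mem_oneEdges.1 hab).1
  have hlast : ∀ a b, s(a, b) ∈ T → B a ≠ Fin.last m := by
    intro a b hab
    simp only [hT, Finset.mem_insert] at hab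
    rcases hab with hab | hab | hab
    · rcases Sym2.eq_iff.1 hab with ⟨rfl, rfl⟩ | ⟨rfl, rfl⟩ <;> assumption
    · rcases Sym2.eq_iff.1 hab with ⟨rfl, rfl⟩ | ⟨rfl, rfl⟩ <;> assumption
    · exact (mk_mem_oneEdges.1 hab).2.1
  have hcov : ∀ a b, s(a, b) ∈ T → 1 ≤ (κ (B a) + if a = u then r else 0) +
      (κ (B b) + if b = u then r else 0) := by
    have hr1 : 1 - κ (B u) - κ (B v) ≤ r := le_max_left _ _
    have hr2 : 1 - κ (B u) - κ (B v') ≤ r := le_max_right _ _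
    intro a b hab
    have ha : 0 ≤ if a = u then r else 0 := by positivity
    have hb : 0 ≤ if b = u then r else 0 := by positivity
    simp only [hT, Finset.mem_insert] at hab
    rcases hab with hab | hab | hab
    · rcases Sym2.eq_iff.1 hab with ⟨rfl, rfl⟩ | ⟨rfl, rfl⟩
      · rw [if_pos rfl]; linarith
      · rw [if_pos (rfl : b = b)]; linarith
    · rcases Sym2.eq_iff.1 hab with ⟨rfl, rfl⟩ | ⟨rfl, rfl⟩
      · rw [if_pos rfl]; linarith
      · rw [if_pos (rfl : b = b)]; linarith
    · linarith [(mk_mem_oneEdges.1 hab).2.2.2]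
  have hle := SimpleGraph.card_le_of_cover (K := K) hγ.le (T := T)
    (N := Finset.univ.filter fun v => B v ≠ Fin.last m)
    (c := fun a => κ (B a) + if a = u then r else 0)
    (fun e he => by
      induction e with | _ a b
      exact hadj a b he)
    (fun a b hab => by simpa using hlast a b hab)
    (fun a => add_nonneg (h.κ_nonneg _) (by positivity)) hcov
  rw [hcard, Finset.sum_add_distrib, Finset.sum_ite_eq' Finset.univ] at hle
  rw [sum_blockExp h.κ_last] at hB
  simp only [Finset.mem_univ, if_true] at hle
  push_cast at hle
  linarith

/-- Every family of block graphons with this shape satisfies the conditions for the lower bound on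
the upper tail probability. -/
theorem upperTailLowerBoundConditions (h : HubCliqueProfile K.gammaInv κ C W)
    (hγ : 0 < K.gammaInv) (hK : K ≠ ⊥) (hQ : 0 < Q)
    (hE : Tendsto (fun p => (W p).entropy p / (p ^ (2 + K.gammaInv) * Real.log (1 / p))) (𝓝[>] 0)
      (𝓝 Q))
    (hhom : ∃ η : ℝ, 0 < η ∧ ∀ᶠ p in 𝓝[>] 0, (1 + η) * p ^ K.numEdges ≤ (W p).hom K)
    {n : ℕ → ℕ} {p : ℕ → ℝ} (hn : Tendsto n atTop atTop) (hp : Tendsto p atTop (𝓝[>] 0))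
    (hnp : (fun t => ((n t : ℝ)⁻¹ * Real.log (n t)) ^
      (1 / (2 * (K.numEdges : ℝ) - 2 - K.gammaInv))) =o[atTop] p) :
    UpperTailLowerBoundConditions K n p (fun t => W (p t)) := by
  classical
  set γ := K.gammaInv with hγdef
  have hγe : γ ≤ K.numEdges - 2 := SimpleGraph.gammaInv_le hK hγ
  set α := 2 * (K.numEdges : ℝ) - 2 - γ with hα
  have hα0 : 0 < α := by linarith
  have hpos : ∀ᶠ t in atTop, 0 < p t ∧ p t < 1 := hp.eventually (eventually_mem_Ioo one_pos)
  have hnR : Tendsto (fun t => (n t : ℝ)) atTop atTop := tendsto_natCast_atTop_atTop.comp hn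
  have hlogn : Tendsto (fun t => Real.log (n t)) atTop atTop := Real.tendsto_log_atTop.comp hnR
  have hloglogn : Tendsto (fun t => Real.log (Real.log (n t))) atTop atTop :=
    Real.tendsto_log_atTop.comp hlogn
  -- the assumption on `n` and `p`, in the form `log n / n ≪ p ^ α` with `α ≥ 2 + γ`
  have hα' : (fun t => (n t : ℝ)⁻¹ * Real.log (n t)) =o[atTop] fun t => p t ^ α := by
    have h1 := hnp.rpow hα0 (by filter_upwards [hpos] with t ht using ht.1.le)
    refine h1.congr' ?_ EventuallyEq.rfl
    filter_upwards [hlogn.eventually_ge_atTop 0] with t ht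
    rw [← Real.rpow_mul (by positivity), one_div_mul_cancel hα0.ne', Real.rpow_one]
  have hpow : ∀ s, s ≤ α → (fun t => (n t : ℝ)⁻¹ * Real.log (n t)) =o[atTop] fun t => p t ^ s := by
    intro s hs
    refine hα'.trans_isBigO (IsBigO.of_bound 1 ?_)
    filter_upwards [hpos] with t ht
    rw [one_mul, Real.norm_of_nonneg (Real.rpow_nonneg ht.1.le _),
      Real.norm_of_nonneg (Real.rpow_nonneg ht.1.le _)]
    exact Real.rpow_le_rpow_of_exponent_ge ht.1 ht.2.le hs
  have hlower : (fun t => (n t : ℝ)⁻¹ * Real.log (Real.log (n t))) =o[atTop] p := by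
    have h1 := hpow 1 (by linarith)
    simp only [Real.rpow_one] at h1
    refine IsBigO.trans_isLittleO (IsBigO.of_bound 1 ?_) h1
    filter_upwards [hloglogn.eventually_ge_atTop 0, hlogn.eventually_ge_atTop 0] with t h2 h3
    rw [one_mul, Real.norm_of_nonneg (by positivity), Real.norm_of_nonneg (by positivity)]
    refine mul_le_mul_of_nonneg_left ?_ (by positivity)
    linarith [Real.log_le_self h3]
  have hEq : (fun p => (W p).entropy p) ~[𝓝[>] 0]
      fun p => Q * (p ^ (2 + γ) * Real.log (1 / p)) := by
    refine isEquivalent_of_tendsto_one ?_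
    have := hE.div_const Q
    rw [div_self hQ.ne'] at this
    refine this.congr fun p => ?_
    simp only [Pi.div_apply]
    rw [div_div, mul_comm Q]
  have hEO : (fun p => (W p).entropy p) =O[𝓝[>] 0] fun p => p ^ (2 + γ) * Real.log (1 / p) :=
    hEq.isBigO.trans (isBigO_const_mul_self _ _ _)
  have hEΩ : (fun p => p ^ (2 + γ) * Real.log (1 / p)) =O[𝓝[>] 0] fun p => (W p).entropy p :=
    (isBigO_self_const_mul hQ.ne' _ _).trans hEq.isBigO_symm
  have hlenγ : ∀ i, (fun p : ℝ => p ^ (1 + γ)) =O[𝓝[>] 0] fun p => (W p).len i := by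
    intro i
    refine IsBigO.trans (IsBigO.of_bound 1 ?_) (h.isBigO_len i)
    filter_upwards [eventually_mem_Ioo one_pos] with p hp
    rw [one_mul, Real.norm_of_nonneg (Real.rpow_nonneg hp.1.le _),
      Real.norm_of_nonneg (Real.rpow_nonneg hp.1.le _)]
    exact Real.rpow_le_rpow_of_exponent_ge hp.1 hp.2.le (h.blockExp_le hγ i)
  have hval_ge : ∀ i j, i ≠ Fin.last m → j ≠ Fin.last m → ∀ᶠ p in 𝓝[>] 0, p ≤ (W p).val i j := by
    intro i j hi hj
    filter_upwards [h.val_core, h.val_one, eventually_mem_Ioo one_pos] with p h1 h2 hp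
    by_cases hij : IsOneBlock κ i j
    · rw [h2 i j hij]; exact hp.2.le
    · rw [h1 i j hi hj hij]
  have hneg : ∀ B : V → Fin (m + 1), ¬ IsNegligible K p (fun t => W (p t)) B →
      ∑ v, blockExp γ κ (B v) ≤ (oneEdges K κ B).card := by
    intro B hB
    by_contra! hlt
    exact hB ((h.homBlock_isLittleO hlt).comp_tendsto hp)
  have himp : ∀ i j, i ≠ Fin.last m → j ≠ Fin.last m → (1 ≤ κ i + κ j ∨ γ * (1 - κ i - κ j) ≤ 1) →
      IsImportantBlock p (fun t => W (p t)) i j := fun i j hi hj hij =>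
    ⟨hi, hj, (h.val_isLittleO hγ hEΩ hi hj hij).comp_tendsto hp⟩
  refine
    { range_lower := hlower
      range_upper := hp
      regular := ?_
      one_block_dominates := hp.eventually h.one_sub_le_len_last
      many_copies := ?_
      entropy_lower := ?_
      entropy_upper := ?_
      not_too_small := ?_
      dichotomy := ?_
      somewhat_important := ?_
      unimportant := ?_
      high_degrees := ?_
      not_too_many_copies := (h.hom_addConst_isBigO hγ).comp_tendsto hp }
  · filter_upwards [hp.eventually h.row_sum] with t ht
    exact (W (p t)).isRegular_of_sum_eq ht
  · obtain ⟨η, hη, hη'⟩ := hhom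
    exact ⟨η, hη, hp.eventually hη'⟩
  · refine (hpow (2 + γ) (by linarith)).trans_isBigO (IsBigO.trans ?_ (hEΩ.comp_tendsto hp))
    refine IsBigO.of_bound 1 ?_
    filter_upwards [hp.eventually (tendsto_log_inv_nhdsGT_zero.eventually_ge_atTop 1)] with t ht
    simp only [Function.comp_apply, one_mul, norm_mul]
    refine le_mul_of_one_le_right (norm_nonneg _) (ht.trans (le_abs_self _))
  · refine (hEO.comp_tendsto hp).trans_isLittleO ?_
    have h1 : (fun t => p t ^ (2 + γ) * n t * ((n t : ℝ)⁻¹ * Real.log (n t))) =o[atTop]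
        fun t => p t ^ (2 + γ) * n t * p t ^ α := (isBigO_refl _ _).mul_isLittleO hα'
    refine IsBigO.trans_isLittleO (IsBigO.of_bound 1 ?_) (h1.congr' EventuallyEq.rfl ?_)
    · -- `1 / n ≤ p`, whence `log (1 / p) ≤ log n`
      filter_upwards [hpos, hnR.eventually_gt_atTop 0, hloglogn.eventually_ge_atTop 1,
        hlower.bound one_pos] with t h0 hn0 hll hb
      have h2 : (n t : ℝ)⁻¹ ≤ p t := by
        rw [one_mul, Real.norm_of_nonneg (by positivity), Real.norm_of_nonneg h0.1.le] at hb
        exact (le_mul_of_one_le_right (by positivity) hll).trans hb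
      have h3 : Real.log (1 / p t) ≤ Real.log (n t) := by
        refine Real.log_le_log (one_div_pos.2 h0.1) ?_
        rw [one_div]
        exact inv_le_of_inv_le₀ hn0 h2
      have h4 : 0 ≤ Real.log (1 / p t) :=
        Real.log_nonneg (by rw [one_div]; exact (one_le_inv₀ h0.1).2 h0.2.le)
      have h5 : p t ^ (2 + γ) * n t * ((n t : ℝ)⁻¹ * Real.log (n t)) =
          p t ^ (2 + γ) * Real.log (n t) := by field_simp
      have h6 := Real.rpow_nonneg h0.1.le (2 + γ)
      simp only [Function.comp_apply]
      rw [h5, one_mul, Real.norm_of_nonneg (mul_nonneg h6 h4),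
        Real.norm_of_nonneg (mul_nonneg h6 (h4.trans h3))]
      exact mul_le_mul_of_nonneg_left h3 h6
    · filter_upwards [hpos] with t h0
      rw [mul_right_comm, ← Real.rpow_add h0.1, ← Real.rpow_natCast]
      congr 2
      rw [hα]
      push_cast
      ring
  · intro i
    refine IsBigO.trans_isLittleO (IsBigO.of_bound 1 ?_)
      ((hpow (1 + γ) (by linarith)).trans_isBigO ((hlenγ i).comp_tendsto hp))
    filter_upwards [hlogn.eventually_ge_atTop 1] with t ht
    rw [one_mul, norm_mul]
    exact le_mul_of_one_le_right (norm_nonneg _) (ht.trans (le_abs_self _))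
  · intro i j hi hj
    refine ⟨hp.eventually (hval_ge i j hi hj), ?_⟩
    by_cases hij : IsOneBlock κ i j
    · exact Or.inr (himp i j hi hj (Or.inl hij.2.2))
    · left
      filter_upwards [hp.eventually h.val_core] with t ht
      exact ht i j hi hj hij
  · intro B hB u v v' huv huv' hs hs'
    have key : ∀ i j, IsSomewhatImportantBlock p (fun t => W (p t)) i j →
        i ≠ Fin.last m ∧ j ≠ Fin.last m ∧ κ i + κ j < 1 ∧ γ * (1 - κ i - κ j) ≤ 1 := by
      intro i j hij
      have hlt : κ i + κ j < 1 := by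
        by_contra! hge
        exact hij.2 ((hp.eventually h.val_one).mono fun t ht => ht i j ⟨hij.1.1, hij.1.2.1, hge⟩)
      exact ⟨hij.1.1, hij.1.2.1, hlt, (h.of_isImportantBlock hEO hp hij.1).resolve_left hlt.not_ge⟩
    obtain ⟨hu, hv, h1, h2⟩ := key _ _ hs
    obtain ⟨-, hv', h1', h2'⟩ := key _ _ hs'
    exact h.eq_of_not_isNegligible hγ (hneg B hB) huv huv' hu hv hv' h1 h1' h2 h2'
  · intro B hB u v huv hnimp
    have hhub : ∀ a b, K.Adj a b → ¬ (B a ≠ Fin.last m ∧ κ (B a) = 1 ∧ B b = Fin.last m) := by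
      rintro a b hab ⟨h1, h2, h3⟩
      refine hB ?_
      have h4 : (fun t => (W (p t)).homBlock K B) =ᶠ[atTop] fun _ => 0 :=
        hp.eventually (h.homBlock_eq_zero hab h1 h2 h3)
      exact h4.trans_isLittleO (isLittleO_zero _ _)
    have hone : ¬ IsOneBlock κ (B u) (B v) := fun hc => hnimp (himp _ _ hc.1 hc.2.1 (Or.inl hc.2.2))
    have hexp : blockExp γ κ (B u) + blockExp γ κ (B v) < 1 + γ := by
      by_cases hu : B u = Fin.last m
      · by_cases hv : B v = Fin.last m
        · rw [hu, hv, blockExp_last]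
          linarith
        · have h1 : κ (B v) < 1 :=
            lt_of_le_of_ne (h.κ_le_one _) fun hc => hhub v u huv.symm ⟨hv, hc, hu⟩
          rw [hu, blockExp_last, blockExp_of_ne hv]
          nlinarith
      · by_cases hv : B v = Fin.last m
        · have h1 : κ (B u) < 1 := lt_of_le_of_ne (h.κ_le_one _) fun hc => hhub u v huv ⟨hu, hc, hv⟩
          rw [hv, blockExp_last, blockExp_of_ne hu]
          nlinarith
        · rw [blockExp_of_ne hu, blockExp_of_ne hv]
          have h1 : ¬ γ * (1 - κ (B u) - κ (B v)) ≤ 1 := fun hc => hnimp (himp _ _ hu hv (Or.inr hc))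
          linarith [not_le.1 h1]
    refine ⟨⟨fun _ => 0, tendsto_const_nhds, ?_⟩, ?_⟩
    · have h1 : (fun p => p⁻¹ * (W p).entropy p) =o[𝓝[>] 0]
          fun p => (W p).len (B u) * (W p).len (B v) := by
        refine (((isBigO_refl (fun p : ℝ => p⁻¹) _).mul hEO).trans_isLittleO ?_).trans_isBigO
          ((h.isBigO_len (B u)).mul (h.isBigO_len (B v)))
        refine (rpow_mul_log_inv_isLittleO_rpow hexp).congr' ?_ ?_
        · filter_upwards [eventually_mem_Ioo one_pos] with p hp
          rw [show 2 + γ = 1 + (1 + γ) by ring, Real.rpow_add hp.1 1 (1 + γ), Real.rpow_one]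
          have := hp.1.ne'
          field_simp
        · filter_upwards [eventually_mem_Ioo one_pos] with p hp
          rw [Real.rpow_add hp.1]
      filter_upwards [(h1.comp_tendsto hp).bound one_pos] with t ht
      simp only [Function.comp_apply, one_mul] at ht
      rw [Real.norm_of_nonneg (mul_nonneg ((W (p t)).len_nonneg _) ((W (p t)).len_nonneg _))] at ht
      rw [add_zero, one_mul]
      exact (le_abs_self _).trans ht
    · have h1 := h.val_div_tendsto hγ hone (hhub u v huv)
        (fun hc => hhub v u huv.symm hc)
      have h2 : (fun p => (W p).val (B u) (B v)) ~[𝓝[>] 0] fun p => p :=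
        isEquivalent_of_tendsto_one h1
      exact h2.isLittleO.comp_tendsto hp
  · intro i j hij
    have h1 : (fun p : ℝ => p * p ^ (1 + γ)) =O[𝓝[>] 0] fun p => (W p).val i j * (W p).len i := by
      refine IsBigO.mul (IsBigO.of_bound 1 ?_) (hlenγ i)
      filter_upwards [hval_ge i j hij.1 hij.2.1, eventually_mem_Ioo one_pos] with p h1 h2
      rw [one_mul, Real.norm_of_nonneg h2.1.le, Real.norm_of_nonneg (h2.1.le.trans h1)]
      exact h1
    refine ((hpow (2 + γ) (by linarith)).congr' EventuallyEq.rfl ?_).trans_isBigO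
      (h1.comp_tendsto hp)
    filter_upwards [hpos] with t ht
    simp only [Function.comp_apply]
    rw [show 2 + γ = 1 + (1 + γ) by ring, Real.rpow_add ht.1 1 (1 + γ), Real.rpow_one]

end HubCliqueProfile

end ProfileConditions

/-! ### Contributing subgraphs and the number of copies of `K` -/

section Contributing

variable {V : Type*} [Fintype V]

namespace SimpleGraph

variable {K H : SimpleGraph V}

open Classical in
/-- Let `H` be contributing with minimum fractional cover `c`. The edges of `K` covered by `c` are
those of `H` and, for each vertex outside `H` with a neighbour of weight `1`, exactly one more edge.
Indeed, one more such edge would contradict the maximality in the definition of `γ`. Hence their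
number is as large as possible, and `H` can be recovered from `c` as the largest subgraph
of minimum degree at least `2` that is covered by `c`. -/
theorem IsContributing.card_covered (hγ : 0 ≤ K.gammaInv) (hH : K.IsContributing H) {c : V → ℝ}
    (hc : H.IsFracVertexCover c) (hmin : ∑ v, c v = H.fracCoverNum)
    (hhalf : ∀ v, c v = 0 ∨ c v = 1 / 2 ∨ c v = 1) :
    ((K.edgeFinset.filter fun e => ∀ u v, e = s(u, v) → 1 ≤ c u + c v).card : ℝ) =
      (Finset.univ.filter fun v => v ∈ H.support ∨ ∃ a, c a = 1 ∧ K.Adj v a).card +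
        K.gammaInv * ∑ v, c v ∧
    ∀ H' ≤ K, H'.MinDegTwo → H'.IsFracVertexCover c → H' ≤ H := by
  set T := K.edgeFinset.filter fun e => ∀ u v, e = s(u, v) → 1 ≤ c u + c v with hT
  set N := Finset.univ.filter fun v => v ∈ H.support ∨ ∃ a, c a = 1 ∧ K.Adj v a with hN
  have memT : ∀ u v, s(u, v) ∈ T ↔ K.Adj u v ∧ 1 ≤ c u + c v := by
    intro u v
    simp only [hT, Finset.mem_filter, mem_edgeFinset, mem_edgeSet]
    refine and_congr_right fun _ => ⟨fun h => h u v rfl, fun h a b hab => ?_⟩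
    rcases Sym2.eq_iff.1 hab with ⟨rfl, rfl⟩ | ⟨rfl, rfl⟩ <;> linarith
  have hsupp : ∀ v, v ∉ H.support → c v = 0 := fun v hv => hc.eq_zero_of_notMem_support hmin hv
  -- the outer vertices with a neighbour of weight `1`, such as `t v`
  set U := Finset.univ.filter fun v => v ∉ H.support ∧ ∃ a, c a = 1 ∧ K.Adj v a with hU
  have hex : ∀ v, ∃ a, v ∈ U → c a = 1 ∧ K.Adj v a := by
    intro v
    by_cases hv : v ∈ U
    · obtain ⟨a, ha⟩ := (Finset.mem_filter.1 hv).2.2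
      exact ⟨a, fun _ => ha⟩
    · exact ⟨v, fun h => absurd h hv⟩
  choose t ht using hex
  have hUs : ∀ v ∈ U, v ∉ H.support := fun v hv => (Finset.mem_filter.1 hv).2.1
  have htU : ∀ v ∈ U, ∀ v' ∈ U, v ≠ t v' := by
    rintro v hv v' hv' rfl
    have := (ht v' hv').1
    rw [hsupp _ (hUs _ hv)] at this
    norm_num at this
  set T' := H.edgeFinset ∪ U.image fun v => s(v, t v) with hT'
  have hsub : T' ⊆ T := by
    intro e he
    rcases Finset.mem_union.1 he with he | he
    · induction e with | _ u v
      have huv : H.Adj u v := by simpa using he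
      exact (memT u v).2 ⟨hH.1 huv, hc.2 u v huv⟩
    · obtain ⟨v, hv, rfl⟩ := Finset.mem_image.1 he
      refine (memT _ _).2 ⟨(ht v hv).2, ?_⟩
      rw [(ht v hv).1]
      linarith [hc.1 v]
  have hcardT' : T'.card = H.numEdges + U.card := by
    rw [hT', Finset.card_union_of_disjoint, numEdges_eq_card, Finset.card_image_of_injOn]
    · intro v hv v' hv' heq
      rcases Sym2.eq_iff.1 heq with h | h
      · exact h.1
      · exact absurd h.1 (htU v hv v' hv')
    · rw [Finset.disjoint_left]
      rintro e he he'
      obtain ⟨v, hv, rfl⟩ := Finset.mem_image.1 he'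
      exact hUs v hv ⟨t v, by simpa using he⟩
  have hcardN : N.card = H.numVerts + U.card := by
    have h1 : N = Finset.univ.filter (fun v => v ∈ H.support) ∪ U := by
      ext v
      simp only [hN, hU, Finset.mem_filter, Finset.mem_univ, true_and, Finset.mem_union]
      tauto
    rw [h1, Finset.card_union_of_disjoint, numVerts, Set.ncard_eq_toFinset_card']
    · congr 2
      ext; simp
    · rw [Finset.disjoint_left]
      intro v hv hvU
      exact hUs v hvU (by simpa using hv)
  have hub : (T.card : ℝ) ≤ N.card + K.gammaInv * ∑ v, c v := by
    refine card_le_of_cover hγ (fun e he => ?_) (fun u v huv => ?_) hc.1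
      fun u v huv => ((memT u v).1 huv).2
    · simpa using (Finset.mem_filter.1 (Finset.mem_coe.1 he)).1
    · obtain ⟨huv, h1⟩ := (memT u v).1 huv
      simp only [hN, Finset.mem_filter, Finset.mem_univ, true_and]
      by_cases hu : u ∈ H.support
      · exact Or.inl hu
      · right
        refine ⟨v, ?_, huv⟩
        rw [hsupp u hu] at h1
        rcases hhalf v with h | h | h
        · linarith
        · linarith
        · exact h
  have hlb : (N.card : ℝ) + K.gammaInv * ∑ v, c v = T'.card := by
    have := hH.2.2
    rw [hcardN, hcardT', hmin]
    push_cast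
    linarith
  have hTT' : T' = T := by
    refine Finset.eq_of_subset_of_card_le hsub ?_
    rw [hlb] at hub
    exact_mod_cast hub
  refine ⟨by rw [hlb, hTT'], fun H' hH'K hH' hcov a b hab => ?_⟩
  have hT'2 : ∀ u v, H'.Adj u v → s(u, v) ∈ T' := fun u v huv => by
    rw [hTT']
    exact (memT u v).2 ⟨hH'K huv, hcov.2 u v huv⟩
  -- a vertex of `U` has only one covered edge, so it is not a vertex of `H'`
  have hnU : ∀ v ∈ U, v ∉ H'.support := by
    intro v hv hvs
    have hnb : H'.neighborSet v ⊆ {t v} := by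
      intro w hw
      rcases Finset.mem_union.1 (hT'2 v w hw) with h | h
      · exact absurd ⟨w, by simpa using h⟩ (hUs v hv)
      · obtain ⟨v', hv', heq⟩ := Finset.mem_image.1 h
        rcases Sym2.eq_iff.1 heq with ⟨rfl, rfl⟩ | ⟨-, h2⟩
        · rfl
        · exact absurd h2.symm (htU v hv v' hv')
    have := hH' v hvs
    have h2 := Set.ncard_le_ncard hnb (Set.toFinite _)
    rw [Set.ncard_singleton] at h2
    omega
  rcases Finset.mem_union.1 (hT'2 a b hab) with h | h
  · simpa using h
  · obtain ⟨v, hv, heq⟩ := Finset.mem_image.1 h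
    rcases Sym2.eq_iff.1 heq with ⟨rfl, -⟩ | ⟨rfl, -⟩
    · exact absurd ⟨b, hab⟩ (hnU _ hv)
    · exact absurd ⟨a, hab.symm⟩ (hnU _ hv)

open Classical in
theorem sum_eq_card_add_card {A : Finset V} {c : V → ℝ} (h1 : ∀ v ∈ A, c v = 1)
    (h2 : ∀ v ∉ A, c v = 0 ∨ c v = 1 / 2) :
    ∑ v, c v = A.card + (Finset.univ.filter fun v => c v = 1 / 2).card / 2 := by
  have : ∀ v, c v = (if v ∈ A then 1 else 0) + (if c v = 1 / 2 then (1 : ℝ) else 0) / 2 := by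
    intro v
    by_cases hv : v ∈ A
    · rw [if_pos hv, h1 v hv]
      norm_num
    · rw [if_neg hv]
      rcases h2 v hv with h | h <;> rw [h] <;> norm_num
  rw [Finset.sum_congr rfl fun v _ => this v, Finset.sum_add_distrib, ← Finset.sum_div,
    Finset.sum_boole, Finset.sum_boole]
  simp

theorem IsValidSet.card_le {A : Finset V} (hA : H.IsValidSet A) : (A.card : ℝ) ≤ H.fracCoverNum := by
  obtain ⟨-, c, -, hmin, h1, h2⟩ := hA
  rw [← hmin, sum_eq_card_add_card h1 h2]
  exact le_add_of_nonneg_right (by positivity)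

end SimpleGraph

end Contributing

section HomLowerBound

variable {V : Type*} [Fintype V] {m : ℕ}

open Classical in
/-- The assignment of blocks to vertices that corresponds to a contributing `H` and a valid `A`, with
cover `c`: the hub `ih` for the vertices in `A`, the clique `iq` for those of weight `1/2`, the rest `id`
of `[0, p]` for the other vertices of `H` and for those outside `H` with a neighbour in `A`,
and the last block otherwise. -/
noncomputable def coverAssignment (K H : SimpleGraph V) (A : Finset V) (c : V → ℝ)
    (ih iq id : Fin (m + 1)) (v : V) : Fin (m + 1) :=
  if v ∈ A then ih else if c v = 1 / 2 then iq else
    if v ∈ H.support ∨ ∃ a, c a = 1 ∧ K.Adj v a then id else Fin.last m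

/-- `Hom(K, W) / p ^ e(K)` is asymptotically at least `P_K(z, w)`. The blocks `ih`, `iq` and `id` are
the hub, the clique and the rest of `[0, p]`; they need to exist only if `z > 0` or `w > 0`, as the
terms of `P_K(z, w)` that would use them vanish otherwise. -/
theorem HubCliqueProfile.eventually_le_hom {K : SimpleGraph V} {κ C : Fin (m + 1) → ℝ}
    {W : ℝ → BlockGraphon m} (h : HubCliqueProfile K.gammaInv κ C W) (hγ : 0 < K.gammaInv)
    {z w : ℝ} (hz0 : 0 ≤ z) (hw0 : 0 ≤ w) (hC : C (Fin.last m) = 1) {ih iq id : Fin (m + 1)}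
    (hz : 0 < z → (ih ≠ Fin.last m ∧ κ ih = 1 ∧ C ih = z) ∧ id ≠ Fin.last m ∧ κ id = 0 ∧ C id = 1)
    (hw : 0 < w → iq ≠ Fin.last m ∧ κ iq = 1 / 2 ∧ C iq = √w)
    {x : ℝ} (hx : x < K.upperTailPoly z w) :
    ∀ᶠ p in 𝓝[>] 0, x * p ^ K.numEdges ≤ (W p).hom K := by
  classical
  set S : Finset ((_ : SimpleGraph V) × Finset V) :=
    (Finset.univ.filter K.IsContributing).sigma fun H => Finset.univ.filter H.IsValidSet with hS
  let term : ((_ : SimpleGraph V) × Finset V) → ℝ := fun x =>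
    z ^ x.2.card * w ^ (x.1.fracCoverNum - (x.2.card : ℝ))
  have hP : K.upperTailPoly z w = ∑ x ∈ S with term x ≠ 0, term x := by
    rw [Finset.sum_filter_ne_zero, hS, Finset.sum_sigma]
    unfold SimpleGraph.upperTailPoly
    congr!
  have hcov : ∀ x : ((_ : SimpleGraph V) × Finset V), ∃ c : V → ℝ, x ∈ S →
      x.1.IsFracVertexCover c ∧ ∑ v, c v = x.1.fracCoverNum ∧
      (∀ v ∈ x.2, c v = 1) ∧ ∀ v ∉ x.2, c v = 0 ∨ c v = 1 / 2 := by
    intro x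
    by_cases hxS : x ∈ S
    · have h1 : x.1.IsValidSet x.2 := by
        have := (Finset.mem_sigma.1 hxS).2
        simpa using this
      obtain ⟨-, c, hc⟩ := h1
      exact ⟨c, fun _ => hc⟩
    · exact ⟨fun _ => 0, fun h => absurd h hxS⟩
  choose c hc using hcov
  let B : ((_ : SimpleGraph V) × Finset V) → V → Fin (m + 1) := fun x =>
    coverAssignment K x.1 x.2 (c x) ih iq id
  have hcontr : ∀ x ∈ S, K.IsContributing x.1 := fun x hx => by
    have := (Finset.mem_sigma.1 hx).1
    simpa using this
  have hzpos : ∀ x, term x ≠ 0 → x.2.Nonempty → 0 < z := by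
    intro x hx hne
    refine hz0.lt_of_ne fun h0 => hx ?_
    simp only [term, ← h0, zero_pow (Finset.card_pos.2 hne).ne', zero_mul]
  have hwpos : ∀ x ∈ S, term x ≠ 0 → ∀ v, c x v = 1 / 2 → 0 < w := by
    intro x hxS hx v hv
    refine hw0.lt_of_ne fun h0 => hx ?_
    obtain ⟨-, hmin, h1, h2⟩ := hc x hxS
    have hpos : 0 < (Finset.univ.filter fun v => c x v = 1 / 2).card :=
      Finset.card_pos.2 ⟨v, by simpa using hv⟩
    have hsum := SimpleGraph.sum_eq_card_add_card h1 h2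
    have hne : x.1.fracCoverNum - (x.2.card : ℝ) ≠ 0 := by
      rw [← hmin, hsum]
      have : (0 : ℝ) < (Finset.univ.filter fun v => c x v = 1 / 2).card := by exact_mod_cast hpos
      linarith
    simp only [term, ← h0, Real.zero_rpow hne, mul_zero]
  -- the vertices assigned to `id` force `A` to be nonempty
  have hmid : ∀ x ∈ S, ∀ v, v ∉ x.2 → c x v ≠ 1 / 2 →
      (v ∈ x.1.support ∨ ∃ a, c x a = 1 ∧ K.Adj v a) → x.2.Nonempty := by
    intro x hxS v hvA hv hv'
    obtain ⟨hcv, -, h1, h2⟩ := hc x hxS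
    have hA : ∀ a, 1 ≤ c x a → a ∈ x.2 := fun a ha => by
      by_contra haA
      rcases h2 a haA with h | h <;> rw [h] at ha <;> norm_num at ha
    rcases hv' with ⟨u, huv⟩ | ⟨a, ha, -⟩
    · have h3 := hcv.2 v u huv
      have h4 : c x v = 0 := (h2 v hvA).resolve_right hv
      exact ⟨u, hA u (by linarith)⟩
    · exact ⟨a, hA a ha.ge⟩
  -- the assignment `B x` recovers the cover
  have hκ : ∀ x ∈ S, term x ≠ 0 → ∀ v, κ (B x v) = c x v := by
    intro x hxS hx v
    obtain ⟨hcv, hmin, h1, h2⟩ := hc x hxS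
    simp only [B, coverAssignment]
    split_ifs with hA hq hd
    · rw [(hz (hzpos x hx ⟨v, hA⟩)).1.2.1, h1 v hA]
    · rw [(hw (hwpos x hxS hx v hq)).2.1, hq]
    · rw [(hz (hzpos x hx (hmid x hxS v hA hq hd))).2.2.1, (h2 v hA).resolve_right hq]
    · rw [h.κ_last, (h2 v hA).resolve_right hq]
  have hlast : ∀ x ∈ S, term x ≠ 0 → ∀ v,
      B x v ≠ Fin.last m ↔ v ∈ x.1.support ∨ ∃ a, c x a = 1 ∧ K.Adj v a := by
    intro x hxS hx v
    obtain ⟨hcv, hmin, h1, h2⟩ := hc x hxS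
    have hsupp : c x v ≠ 0 → v ∈ x.1.support := fun hv => by
      by_contra hs
      exact hv (hcv.eq_zero_of_notMem_support hmin hs)
    simp only [B, coverAssignment]
    split_ifs with hA hq hd
    · refine iff_of_true (hz (hzpos x hx ⟨v, hA⟩)).1.1 (Or.inl (hsupp ?_))
      rw [h1 v hA]
      exact one_ne_zero
    · refine iff_of_true (hw (hwpos x hxS hx v hq)).1 (Or.inl (hsupp ?_))
      rw [hq]
      norm_num
    · exact iff_of_true (hz (hzpos x hx (hmid x hxS v hA hq hd))).2.1 hd
    · exact iff_of_false (fun hne => hne rfl) hd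
  have hhalf : ∀ x ∈ S, ∀ v, c x v = 0 ∨ c x v = 1 / 2 ∨ c x v = 1 := fun x hxS v => by
    by_cases hv : v ∈ x.2
    · exact Or.inr (Or.inr ((hc x hxS).2.2.1 v hv))
    · exact ((hc x hxS).2.2.2 v hv).imp_right Or.inl
  have hone : ∀ x ∈ S, term x ≠ 0 → oneEdges K κ (B x) =
      K.edgeFinset.filter fun e => ∀ u v, e = s(u, v) → 1 ≤ c x u + c x v := by
    intro x hxS hx
    obtain ⟨hcv, hmin, h1, h2⟩ := hc x hxS
    have key : ∀ u v, K.Adj u v → 1 ≤ c x u + c x v → B x u ≠ Fin.last m := by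
      intro u v huv huv1
      rw [hlast x hxS hx]
      by_cases hu : u ∈ x.1.support
      · exact Or.inl hu
      · right
        refine ⟨v, ?_, huv⟩
        rw [hcv.eq_zero_of_notMem_support hmin hu] at huv1
        rcases hhalf x hxS v with h | h | h
        · linarith
        · linarith
        · exact h
    ext e
    induction e with | _ u v
    rw [mk_mem_oneEdges, Finset.mem_filter, SimpleGraph.mem_edgeFinset, SimpleGraph.mem_edgeSet,
      IsOneBlock, hκ x hxS hx, hκ x hxS hx]
    refine and_congr_right fun huv => ⟨fun h a b hab => ?_, fun h => ?_⟩
    · rcases Sym2.eq_iff.1 hab with ⟨rfl, rfl⟩ | ⟨rfl, rfl⟩ <;> linarith [h.2.2]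
    · have h1 := h u v rfl
      exact ⟨key u v huv h1, key v u huv.symm (by linarith), h1⟩
  have hinj : Set.InjOn B (S.filter fun x => term x ≠ 0 : Finset _) := by
    rintro x hx y hy hxy
    obtain ⟨hxS, hx0⟩ := Finset.mem_filter.1 hx
    obtain ⟨hyS, hy0⟩ := Finset.mem_filter.1 hy
    have hcc : c x = c y := by
      ext v
      rw [← hκ x hxS hx0, ← hκ y hyS hy0, hxy]
    have hle : ∀ x ∈ S, ∀ y ∈ S, c x = c y → x.1 ≤ y.1 := by
      intro x hxS y hyS hxy
      obtain ⟨hcy, hminy, -, -⟩ := hc y hyS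
      refine ((hcontr y hyS).card_covered hγ.le hcy hminy (hhalf y hyS)).2 x.1 (hcontr x hxS).1
        (hcontr x hxS).2.1 ?_
      rw [← hxy]
      exact (hc x hxS).1
    have hA : ∀ x ∈ S, x.2 = Finset.univ.filter fun v => c x v = 1 := by
      intro x hxS
      obtain ⟨-, -, h1, h2⟩ := hc x hxS
      ext v
      simp only [Finset.mem_filter, Finset.mem_univ, true_and]
      refine ⟨h1 v, fun hv => ?_⟩
      by_contra hvA
      rcases h2 v hvA with h | h <;> rw [h] at hv <;> norm_num at hv
    have h1 : x.1 = y.1 := le_antisymm (hle x hxS y hyS hcc) (hle y hyS x hxS hcc.symm)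
    have h2 : x.2 = y.2 := by rw [hA x hxS, hA y hyS, hcc]
    exact Sigma.ext h1 (heq_of_eq h2)
  have hlim : ∀ x ∈ S.filter fun x => term x ≠ 0,
      Tendsto (fun p => (W p).homBlock K (B x) / p ^ K.numEdges) (𝓝[>] 0) (𝓝 (term x)) := by
    intro x hx
    obtain ⟨hxS, hx0⟩ := Finset.mem_filter.1 hx
    obtain ⟨hcv, hmin, h1, h2⟩ := hc x hxS
    have hprod : ∏ v, C (B x v) = term x := by
      have h3 : ∀ v, C (B x v) = (if v ∈ x.2 then z else 1) * if c x v = 1 / 2 then √w else 1 := by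
        intro v
        simp only [B, coverAssignment]
        split_ifs with hA hq hq hd
        · rw [h1 v hA] at hq
          norm_num at hq
        · rw [(hz (hzpos x hx0 ⟨v, hA⟩)).1.2.2, mul_one]
        · rw [(hw (hwpos x hxS hx0 v hq)).2.2, one_mul]
        · rw [(hz (hzpos x hx0 (hmid x hxS v hA hq hd))).2.2.2, one_mul]
        · rw [hC, one_mul]
      have h4 : x.1.fracCoverNum - (x.2.card : ℝ) =
          1 / 2 * ((Finset.univ.filter fun v => c x v = 1 / 2).card : ℝ) := by
        rw [← hmin, SimpleGraph.sum_eq_card_add_card h1 h2]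
        ring
      simp only [term, h3, Finset.prod_mul_distrib, Finset.prod_ite, Finset.prod_const_one, mul_one,
        Finset.prod_const]
      rw [h4, Real.rpow_mul hw0, Real.rpow_natCast, ← Real.sqrt_eq_rpow]
      simp
    rw [← hprod]
    refine h.homBlock_div_tendsto hγ ?_ fun u v huv hu hu1 => ?_
    · rw [hone x hxS hx0, ((hcontr x hxS).card_covered hγ.le hcv hmin (hhalf x hxS)).1,
        sum_blockExp h.κ_last]
      simp only [hκ x hxS hx0, hlast x hxS hx0]
    · rw [hlast x hxS hx0]
      rw [hκ x hxS hx0] at hu1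
      exact Or.inr ⟨u, hu1, huv.symm⟩
  have hsum := tendsto_finsetSum _ hlim
  rw [← hP] at hsum
  filter_upwards [hsum.eventually_const_lt hx, eventually_mem_Ioo one_pos] with p hp hp1
  rw [← Finset.sum_div, lt_div_iff₀ (pow_pos hp1.1 _)] at hp
  refine hp.le.trans ?_
  rw [BlockGraphon.hom_eq_sum_homBlock, ← Finset.sum_image (f := fun B => (W p).homBlock K B) hinj]
  exact Finset.sum_le_sum_of_subset_of_nonneg (Finset.subset_univ _)
    fun B _ _ => (W p).homBlock_nonneg K B

end HomLowerBound

/-! ### The polynomial `P_K` and the minimizer -/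

section Minimizer

variable {V : Type*} [Fintype V]

namespace SimpleGraph

variable {K : SimpleGraph V}

theorem isValidSet_bot_iff {A : Finset V} : (⊥ : SimpleGraph V).IsValidSet A ↔ A = ∅ := by
  refine ⟨fun h => ?_, ?_⟩
  · have := h.1
    rw [support_bot, Set.subset_empty_iff] at this
    exact_mod_cast this
  · rintro rfl
    exact ⟨by simp, fun _ => 0, ⟨fun _ => le_rfl, by simp⟩, by simp [fracCoverNum_bot], by simp,
      by simp⟩

open Classical in
/-- The empty subgraph contributes `1` to `P_K`. -/
theorem upperTailPoly_eq_one_add (z w : ℝ) : K.upperTailPoly z w =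
    1 + ∑ H ∈ (Finset.univ.filter K.IsContributing).erase ⊥, ∑ A : Finset V with H.IsValidSet A,
      z ^ A.card * w ^ (H.fracCoverNum - (A.card : ℝ)) := by
  have h1 := Finset.add_sum_erase (Finset.univ.filter K.IsContributing)
    (fun H : SimpleGraph V => ∑ A : Finset V with H.IsValidSet A,
      z ^ A.card * w ^ (H.fracCoverNum - (A.card : ℝ)))
    (a := ⊥) (by simpa using isContributing_bot)
  have h2 : (∑ A : Finset V with (⊥ : SimpleGraph V).IsValidSet A,
      z ^ A.card * w ^ ((⊥ : SimpleGraph V).fracCoverNum - (A.card : ℝ))) = 1 := by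
    simp only [isValidSet_bot_iff]
    simp [Finset.filter_eq', fracCoverNum_bot]
  simp only [h2] at h1
  rw [h1]
  unfold upperTailPoly
  congr!

theorem continuous_upperTailPoly : Continuous fun x : ℝ × ℝ => K.upperTailPoly x.1 x.2 := by
  classical
  unfold upperTailPoly
  refine continuous_finsetSum _ fun H _ => continuous_finsetSum _ fun A hA => ?_
  have hA : H.IsValidSet A := by simpa using hA
  refine (continuous_fst.pow _).mul ?_
  exact (Real.continuous_rpow_const (sub_nonneg.2 hA.card_le)).comp continuous_snd

theorem upperTailPoly_zero : K.upperTailPoly 0 0 = 1 := by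
  classical
  rw [upperTailPoly_eq_one_add, add_eq_left]
  refine Finset.sum_eq_zero fun H hH => Finset.sum_eq_zero fun A hA => ?_
  have hH : H ≠ ⊥ := (Finset.mem_erase.1 hH).1
  rcases A.eq_empty_or_nonempty with rfl | hne
  · have := one_le_fracCoverNum hH
    rw [Real.zero_rpow (by simp; linarith), mul_zero]
  · rw [zero_pow (Finset.card_pos.2 hne).ne', zero_mul]

/-- All terms of `P_K` but the constant `1` are homogeneous of degree at least `1`. -/
theorem le_upperTailPoly_mul {z w s : ℝ} (hz : 0 ≤ z) (hw : 0 ≤ w) (hs : 1 ≤ s) :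
    1 + s * (K.upperTailPoly z w - 1) ≤ K.upperTailPoly (s * z) (s * w) := by
  classical
  have hs0 : 0 < s := zero_lt_one.trans_le hs
  rw [upperTailPoly_eq_one_add z w, upperTailPoly_eq_one_add (s * z), add_sub_cancel_left,
    Finset.mul_sum]
  refine add_le_add_right (Finset.sum_le_sum fun H hH => ?_) _
  rw [Finset.mul_sum]
  refine Finset.sum_le_sum fun A hA => ?_
  have hH : H ≠ ⊥ := (Finset.mem_erase.1 hH).1
  have h1 : (s * z) ^ A.card * (s * w) ^ (H.fracCoverNum - (A.card : ℝ)) =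
      s ^ H.fracCoverNum * (z ^ A.card * w ^ (H.fracCoverNum - (A.card : ℝ))) := by
    rw [mul_pow, Real.mul_rpow hs0.le hw, ← Real.rpow_natCast s, mul_mul_mul_comm,
      ← Real.rpow_add hs0, add_sub_cancel]
  rw [h1]
  refine mul_le_mul_of_nonneg_right ?_ (by positivity)
  simpa using Real.rpow_le_rpow_of_exponent_le hs (one_le_fracCoverNum hH)

theorem le_upperTailPoly_self (hK : K ≠ ⊥) (hγ : 0 < K.gammaInv) {t : ℝ} (ht : 1 ≤ t) :
    t ≤ K.upperTailPoly t t := by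
  classical
  have ht0 : 0 < t := zero_lt_one.trans_le ht
  obtain ⟨H, hH, hne⟩ := exists_isContributing_ne_bot hK hγ
  obtain ⟨A, hA⟩ := H.exists_isValidSet
  have hnn : ∀ (H : SimpleGraph V) (A : Finset V),
      0 ≤ t ^ A.card * t ^ (H.fracCoverNum - (A.card : ℝ)) := fun H A => by positivity
  calc t = t ^ (1 : ℝ) := (Real.rpow_one t).symm
    _ ≤ t ^ H.fracCoverNum := Real.rpow_le_rpow_of_exponent_le ht (one_le_fracCoverNum hne)
    _ = t ^ A.card * t ^ (H.fracCoverNum - (A.card : ℝ)) := by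
        rw [← Real.rpow_natCast, ← Real.rpow_add ht0, add_sub_cancel]
    _ ≤ ∑ A : Finset V with H.IsValidSet A, t ^ A.card * t ^ (H.fracCoverNum - (A.card : ℝ)) :=
        Finset.single_le_sum (f := fun A : Finset V =>
          t ^ A.card * t ^ (H.fracCoverNum - (A.card : ℝ))) (fun A _ => hnn H A) (by simpa using hA)
    _ ≤ K.upperTailPoly t t := by
        unfold upperTailPoly
        convert Finset.single_le_sum (s := Finset.univ.filter K.IsContributing)
          (f := fun H : SimpleGraph V => ∑ A : Finset V with H.IsValidSet A,
            t ^ A.card * t ^ (H.fracCoverNum - (A.card : ℝ)))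
          (fun H _ => Finset.sum_nonneg fun A _ => hnn H A) (a := H) (by simpa using hH)

/-- The minimum in the definition of `ρ(K, δ)` is attained. -/
theorem exists_eq_rho (hK : K ≠ ⊥) (hγ : 0 < K.gammaInv) {δ : ℝ} (hδ : 0 < δ) :
    ∃ z w : ℝ, 0 ≤ z ∧ 0 ≤ w ∧ 1 + δ ≤ K.upperTailPoly z w ∧ z + w / 2 = K.rho δ := by
  set S := {x : ℝ × ℝ | 0 ≤ x.1 ∧ 0 ≤ x.2 ∧ 1 + δ ≤ K.upperTailPoly x.1 x.2} with hS
  have hcl : IsClosed S :=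
    (isClosed_le continuous_const continuous_fst).inter
      ((isClosed_le continuous_const continuous_snd).inter
        (isClosed_le continuous_const continuous_upperTailPoly))
  set t := 1 + δ with ht
  have hmem : (t, t) ∈ S := ⟨by linarith, by linarith, le_upperTailPoly_self hK hγ (by linarith)⟩
  have hcpt : IsCompact (S ∩ Set.Icc 0 (t + t / 2) ×ˢ Set.Icc 0 (2 * (t + t / 2))) :=
    (isCompact_Icc.prod isCompact_Icc).inter_left hcl
  have hne : (S ∩ Set.Icc 0 (t + t / 2) ×ˢ Set.Icc 0 (2 * (t + t / 2))).Nonempty :=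
    ⟨(t, t), hmem, ⟨by linarith, by linarith⟩, ⟨by linarith, by linarith⟩⟩
  have hcont : Continuous fun x : ℝ × ℝ => x.1 + x.2 / 2 := by fun_prop
  obtain ⟨x, ⟨hxS, -⟩, hx⟩ := hcpt.exists_isMinOn hne hcont.continuousOn
  have hmin : ∀ y ∈ S, x.1 + x.2 / 2 ≤ y.1 + y.2 / 2 := by
    intro y hy
    by_cases hle : y.1 + y.2 / 2 ≤ t + t / 2
    · refine isMinOn_iff.1 hx y ⟨hy, ⟨hy.1, ?_⟩, ⟨hy.2.1, ?_⟩⟩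
      · linarith [hy.2.1]
      · linarith [hy.1]
    · refine le_trans (isMinOn_iff.1 hx (t, t) ⟨hmem, ⟨?_, ?_⟩, ⟨?_, ?_⟩⟩) (not_le.1 hle).le <;> simp <;>
        linarith
  refine ⟨x.1, x.2, hxS.1, hxS.2.1, hxS.2.2, ?_⟩
  symm
  rw [rho]
  refine IsLeast.csInf_eq ⟨⟨x.1, x.2, hxS.1, hxS.2.1, hxS.2.2, rfl⟩, ?_⟩
  rintro _ ⟨z, w, hz, hw, hP, rfl⟩
  exact hmin (z, w) ⟨hz, hw, hP⟩

end SimpleGraph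

end Minimizer

/-- If for every `s > 0` a property holds for all sufficiently small `p > 0`, then it holds for all
small `p` with some `s = s(p) > 0` that tends to `0`. -/
theorem exists_tendsto_zero_of_forall_eventually {Q : ℝ → ℝ → Prop}
    (hQ : ∀ s > 0, ∀ᶠ p in 𝓝[>] (0 : ℝ), Q s p) :
    ∃ s : ℝ → ℝ, (∀ p, 0 < s p) ∧ Tendsto s (𝓝[>] 0) (𝓝 0) ∧ ∀ᶠ p in 𝓝[>] (0 : ℝ), Q (s p) p := by
  classical
  have hpos : ∀ n : ℕ, (0 : ℝ) < 1 / (n + 1) := fun n => Nat.one_div_pos_of_nat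
  have hr : ∀ n : ℕ, ∃ r > 0, ∀ p : ℝ, 0 < p → p < r → Q (1 / (n + 1)) p := fun n => by
    obtain ⟨r, hr0, hr⟩ := mem_nhdsGT_iff_exists_Ioo_subset.1 (hQ _ (hpos n))
    exact ⟨r, hr0, fun p h1 h2 => hr ⟨h1, h2⟩⟩
  choose r hr0 hr using hr
  let N : ℝ → ℕ := fun p => Nat.findGreatest (fun n => p < r n) ⌊1 / p⌋₊
  refine ⟨fun p => 1 / (N p + 1), fun p => hpos _, ?_, ?_⟩
  · have hN : Tendsto N (𝓝[>] 0) atTop := by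
      refine tendsto_atTop.2 fun n => ?_
      filter_upwards [eventually_mem_Ioo (hr0 n), eventually_mem_Ioo (hpos n)] with p h1 h2
      refine Nat.le_findGreatest (Nat.le_floor ?_) h1.2
      rw [le_div_iff₀ h2.1]
      have := (lt_div_iff₀ (by positivity)).1 h2.2
      nlinarith [h2.1]
    exact tendsto_one_div_add_atTop_nhds_zero_nat.comp hN
  · filter_upwards [eventually_mem_Ioo (hr0 0)] with p hp
    refine hr _ p hp.1 ?_
    exact Nat.findGreatest_spec (P := fun n => p < r n) (Nat.zero_le _) hp.2

/-! ### The explicit graphons -/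

section Lengths

theorem volume_real_eq_of_mem_iff_le {s : Set I} {b : ℝ} (hb0 : 0 ≤ b) (hb1 : b ≤ 1)
    (h : ∀ x : I, x ∈ s ↔ (x : ℝ) ≤ b) : volume.real s = b := by
  have : s = Set.Iic (⟨b, hb0, hb1⟩ : I) := Set.ext h
  rw [this, Measure.real, unitInterval.volume_Iic, ENNReal.toReal_ofReal hb0]

theorem volume_real_eq_of_mem_iff_lt_le {s : Set I} {a b : ℝ} (ha0 : 0 ≤ a) (hab : a ≤ b)
    (hb1 : b ≤ 1) (h : ∀ x : I, x ∈ s ↔ a < (x : ℝ) ∧ (x : ℝ) ≤ b) : volume.real s = b - a := by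
  have : s = Set.Ioc (⟨a, ha0, hab.trans hb1⟩ : I) ⟨b, ha0.trans hab, hb1⟩ := Set.ext h
  rw [this, Measure.real, unitInterval.volume_Ioc]
  simp [ENNReal.toReal_ofReal (sub_nonneg.2 hab)]

end Lengths

section Graphons

variable {m : ℕ}

/-- The lengths of the blocks determine whether a family of graphons `regGraphon` has hub and clique
shape. If there is a hub, the other blocks have to fill `[0, p]` exactly for the hub to have degree
`p` there and the value `0` on the last block. -/
theorem HubCliqueProfile.of_regGraphon {γ : ℝ} {κ C : Fin (m + 1) → ℝ}
    {part : ℝ → I → Fin (m + 1)} (hpart : ∀ p, Monotone (part p))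
    (κ_last : κ (Fin.last m) = 0) (κ_mem : ∀ i, κ i = 0 ∨ κ i = 1 / 2 ∨ κ i = 1)
    (C_pos : ∀ i, 0 < C i) (C_last : C (Fin.last m) = 1)
    (len_tendsto : ∀ i, i ≠ Fin.last m → Tendsto (fun p =>
      (regGraphon (part p) (hpart p) κ p).len i / p ^ (1 + γ * κ i)) (𝓝[>] 0) (𝓝 (C i)))
    (sum_len_le : ∀ᶠ p in 𝓝[>] 0,
      ∑ i with i ≠ Fin.last m, (regGraphon (part p) (hpart p) κ p).len i ≤ p)
    (sum_len_eq : ∀ i, i ≠ Fin.last m → κ i = 1 → ∀ᶠ p in 𝓝[>] 0,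
      ∑ i with i ≠ Fin.last m, (regGraphon (part p) (hpart p) κ p).len i = p) :
    HubCliqueProfile γ κ C fun p => regGraphon (part p) (hpart p) κ p := by
  have hp2 := eventually_mem_Ioo (show (0 : ℝ) < 1 / 2 by norm_num)
  have hval : ∀ᶠ p in 𝓝[>] 0, ∀ i j, (regGraphon (part p) (hpart p) κ p).val i j =
      regVal (regGraphon (part p) (hpart p) κ p).len κ p i j := by
    filter_upwards [hp2, sum_len_le] with p hp hs
    exact regGraphon_val hp.1 hp.2.le hs
  refine ⟨κ_last, κ_mem, C_pos, fun i => ?_, sum_len_le, fun i hi hκ => ?_, ?_, ?_⟩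
  · by_cases hi : i = Fin.last m
    · subst hi
      simp only [HubCliqueProfile.blockExp_last, Real.rpow_zero, div_one, C_last,
        HubCliqueProfile.len_last]
      have h0 : Tendsto (fun p => ∑ i with i ≠ Fin.last m,
          (regGraphon (part p) (hpart p) κ p).len i) (𝓝[>] 0) (𝓝 0) := by
        refine squeeze_zero' (.of_forall fun p => Finset.sum_nonneg fun i _ =>
          BlockGraphon.len_nonneg _ _) sum_len_le ?_
        exact tendsto_id.mono_left nhdsWithin_le_nhds
      simpa using h0.const_sub 1
    · simpa only [HubCliqueProfile.blockExp_of_ne hi] using len_tendsto i hi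
  · filter_upwards [hval, sum_len_eq i hi hκ] with p hv hs
    have hc : ∀ j, coreVal κ p i j = 1 := fun j => by
      have : 0 ≤ κ j := by rcases κ_mem j with h | h | h <;> rw [h] <;> norm_num
      exact if_pos (by linarith)
    rw [hv, regVal, if_neg hi, if_pos rfl, rowVal]
    simp only [hc, mul_one]
    rw [hs, sub_self, zero_div]
  · filter_upwards [hval, sum_len_le, hp2] with p hv hs hp i
    simp only [hv]
    refine regVal_sum_eq ?_ i
    have := HubCliqueProfile.len_last (regGraphon (part p) (hpart p) κ p)
    linarith
  · filter_upwards [hval] with p hv i j hi hj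
    rw [hv, regVal, if_neg hi, if_neg hj]

/-- The intervals with endpoints `0, a, 1`. -/
noncomputable def cutPart₁ (a : ℝ) (x : I) : Fin 2 := if (x : ℝ) ≤ a then 0 else 1

/-- The intervals with endpoints `0, a, b, 1`. -/
noncomputable def cutPart₂ (a b : ℝ) (x : I) : Fin 3 :=
  if (x : ℝ) ≤ a then 0 else if (x : ℝ) ≤ b then 1 else 2

/-- The intervals with endpoints `0, a, b, c, 1`. -/
noncomputable def cutPart₃ (a b c : ℝ) (x : I) : Fin 4 :=
  if (x : ℝ) ≤ a then 0 else if (x : ℝ) ≤ b then 1 else if (x : ℝ) ≤ c then 2 else 3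

theorem monotone_cutPart₁ (a : ℝ) : Monotone (cutPart₁ a) := by
  intro x y hxy
  have hxy : (x : ℝ) ≤ y := hxy
  unfold cutPart₁
  split_ifs <;> first | decide | (exfalso; linarith)

theorem monotone_cutPart₂ (a b : ℝ) : Monotone (cutPart₂ a b) := by
  intro x y hxy
  have hxy : (x : ℝ) ≤ y := hxy
  unfold cutPart₂
  split_ifs <;> first | decide | (exfalso; linarith)

theorem monotone_cutPart₃ (a b c : ℝ) : Monotone (cutPart₃ a b c) := by
  intro x y hxy
  have hxy : (x : ℝ) ≤ y := hxy
  unfold cutPart₃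
  split_ifs <;> first | decide | (exfalso; linarith)

theorem volume_real_cutPart₁_zero {a : ℝ} (h0 : 0 ≤ a) (h1 : a ≤ 1) :
    volume.real (cutPart₁ a ⁻¹' {0}) = a := by
  refine volume_real_eq_of_mem_iff_le h0 h1 fun x => ?_
  simp only [cutPart₁, Set.mem_preimage, Set.mem_singleton_iff]
  split_ifs <;> simp_all

theorem volume_real_cutPart₂_zero {a b : ℝ} (h0 : 0 ≤ a) (h1 : a ≤ 1) :
    volume.real (cutPart₂ a b ⁻¹' {0}) = a := by
  refine volume_real_eq_of_mem_iff_le h0 h1 fun x => ?_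
  simp only [cutPart₂, Set.mem_preimage, Set.mem_singleton_iff]
  split_ifs <;> simp_all

theorem volume_real_cutPart₂_one {a b : ℝ} (h0 : 0 ≤ a) (hab : a ≤ b) (h1 : b ≤ 1) :
    volume.real (cutPart₂ a b ⁻¹' {1}) = b - a := by
  refine volume_real_eq_of_mem_iff_lt_le h0 hab h1 fun x => ?_
  simp only [cutPart₂, Set.mem_preimage, Set.mem_singleton_iff]
  split_ifs with h h' <;> simp [not_lt.2, not_le.1, *]

theorem volume_real_cutPart₃_zero {a b c : ℝ} (h0 : 0 ≤ a) (h1 : a ≤ 1) :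
    volume.real (cutPart₃ a b c ⁻¹' {0}) = a := by
  refine volume_real_eq_of_mem_iff_le h0 h1 fun x => ?_
  simp only [cutPart₃, Set.mem_preimage, Set.mem_singleton_iff]
  split_ifs <;> simp_all

theorem volume_real_cutPart₃_one {a b c : ℝ} (h0 : 0 ≤ a) (hab : a ≤ b) (h1 : b ≤ 1) :
    volume.real (cutPart₃ a b c ⁻¹' {1}) = b - a := by
  refine volume_real_eq_of_mem_iff_lt_le h0 hab h1 fun x => ?_
  simp only [cutPart₃, Set.mem_preimage, Set.mem_singleton_iff]
  split_ifs with h h' <;> simp [not_lt.2, not_le.1, *]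

theorem volume_real_cutPart₃_two {a b c : ℝ} (h0 : 0 ≤ a) (hab : a ≤ b) (hbc : b ≤ c) (h1 : c ≤ 1) :
    volume.real (cutPart₃ a b c ⁻¹' {2}) = c - b := by
  refine volume_real_eq_of_mem_iff_lt_le (h0.trans hab) hbc h1 fun x => ?_
  simp only [cutPart₃, Set.mem_preimage, Set.mem_singleton_iff]
  split_ifs with h h' h''
  · simp [h.trans hab]
  all_goals simp [not_lt.2, not_le.1, *]


variable {γ : ℝ}

/-- The graphon with only a hub, of length `z p ^ (1 + γ)`. -/
noncomputable def hubGraphon (γ z p : ℝ) : BlockGraphon 2 :=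
  regGraphon (cutPart₂ (z * p ^ (1 + γ)) p) (monotone_cutPart₂ _ _) ![1, 0, 0] p

/-- The graphon with only a clique, on an interval of length `√w p ^ (1 + γ / 2)`. -/
noncomputable def cliqueGraphon (γ w p : ℝ) : BlockGraphon 1 :=
  regGraphon (cutPart₁ (√w * p ^ (1 + γ / 2))) (monotone_cutPart₁ _) ![1 / 2, 0] p

/-- The graphon with a hub, of length `z p ^ (1 + γ)`, and a clique, on an interval of length
`√w p ^ (1 + γ / 2)` that contains the hub. -/
noncomputable def hubCliqueGraphon (γ z w p : ℝ) : BlockGraphon 3 :=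
  regGraphon (cutPart₃ (z * p ^ (1 + γ)) (√w * p ^ (1 + γ / 2)) p) (monotone_cutPart₃ _ _ _)
    ![1, 1 / 2, 0, 0] p

theorem eventually_mul_rpow_add_le {r r' : ℝ → ℝ} {r₀ r₀' s t : ℝ} (ht : 0 < t)
    (hr : Tendsto r (𝓝[>] 0) (𝓝 r₀)) (hr' : Tendsto r' (𝓝[>] 0) (𝓝 r₀')) (h0 : 0 < r₀') :
    ∀ᶠ p in 𝓝[>] (0 : ℝ), r p * p ^ (s + t) ≤ r' p * p ^ s := by
  have h1 : Tendsto (fun p => r p * p ^ t) (𝓝[>] 0) (𝓝 0) := by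
    simpa using hr.mul (tendsto_rpow_nhdsGT_zero ht)
  filter_upwards [h1.eventually_lt hr' h0, eventually_mem_Ioo one_pos] with p h hp
  rw [add_comm, Real.rpow_add hp.1, ← mul_assoc]
  exact mul_le_mul_of_nonneg_right h.le (Real.rpow_nonneg hp.1.le _)

theorem tendsto_sub_mul_rpow_add_div {r r' : ℝ → ℝ} {r₀ r₀' s t : ℝ} (ht : 0 < t)
    (hr : Tendsto r (𝓝[>] 0) (𝓝 r₀)) (hr' : Tendsto r' (𝓝[>] 0) (𝓝 r₀')) :
    Tendsto (fun p : ℝ => (r' p * p ^ s - r p * p ^ (s + t)) / p ^ s) (𝓝[>] 0) (𝓝 r₀') := by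
  have h1 : Tendsto (fun p => r' p - r p * p ^ t) (𝓝[>] 0) (𝓝 r₀') := by
    simpa using hr'.sub (hr.mul (tendsto_rpow_nhdsGT_zero ht))
  refine h1.congr' ?_
  filter_upwards [eventually_mem_Ioo one_pos] with p hp
  have := (Real.rpow_pos_of_pos hp.1 s).ne'
  rw [Real.rpow_add hp.1]
  field_simp

theorem tendsto_mul_rpow_div {r : ℝ → ℝ} {r₀ s : ℝ} (hr : Tendsto r (𝓝[>] 0) (𝓝 r₀)) :
    Tendsto (fun p : ℝ => r p * p ^ s / p ^ s) (𝓝[>] 0) (𝓝 r₀) := by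
  refine hr.congr' ?_
  filter_upwards [eventually_mem_Ioo one_pos] with p hp
  rw [mul_div_cancel_right₀ _ (Real.rpow_pos_of_pos hp.1 s).ne']

section Hub

variable {z : ℝ → ℝ} {z₀ : ℝ}

theorem eventually_hubGraphon_len (hγ : 0 < γ) (hz : Tendsto z (𝓝[>] 0) (𝓝 z₀)) (hz0 : 0 < z₀) :
    ∀ᶠ p in 𝓝[>] 0, (hubGraphon γ (z p) p).len 0 = z p * p ^ (1 + γ) ∧
      (hubGraphon γ (z p) p).len 1 = p - z p * p ^ (1 + γ) := by
  filter_upwards [eventually_mul_rpow_add_le (s := 1) hγ hz tendsto_const_nhds one_pos,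
    hz.eventually_const_lt hz0, eventually_mem_Ioo one_pos] with p h hzp hp
  rw [Real.rpow_one, one_mul] at h
  have h0 : 0 ≤ z p * p ^ (1 + γ) := mul_nonneg hzp.le (Real.rpow_nonneg hp.1.le _)
  exact ⟨volume_real_cutPart₂_zero h0 (h.trans hp.2.le), volume_real_cutPart₂_one h0 h hp.2.le⟩

theorem eventually_hubGraphon_sum_len (hγ : 0 < γ) (hz : Tendsto z (𝓝[>] 0) (𝓝 z₀))
    (hz0 : 0 < z₀) :
    ∀ᶠ p in 𝓝[>] 0, ∑ i with i ≠ Fin.last 2, (hubGraphon γ (z p) p).len i = p := by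
  filter_upwards [eventually_hubGraphon_len hγ hz hz0] with p h
  rw [Finset.sum_filter, Fin.sum_univ_three, h.1, h.2]
  simp [Fin.ext_iff]

theorem hubCliqueProfile_hubGraphon (hγ : 0 < γ) (hz : Tendsto z (𝓝[>] 0) (𝓝 z₀))
    (hz0 : 0 < z₀) :
    HubCliqueProfile γ ![1, 0, 0] ![z₀, 1, 1] fun p => hubGraphon γ (z p) p := by
  have hlen := eventually_hubGraphon_len hγ hz hz0
  have hsum := eventually_hubGraphon_sum_len hγ hz hz0
  refine HubCliqueProfile.of_regGraphon (fun _ => monotone_cutPart₂ _ _) rfl ?_ ?_ rfl ?_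
    (hsum.mono fun p hp => hp.le) fun _ _ _ => hsum
  · intro i; fin_cases i <;> simp
  · intro i; fin_cases i <;> simp [hz0]
  · intro i hi
    fin_cases i
    · simp only [Fin.zero_eta, Matrix.cons_val_zero, mul_one]
      exact (tendsto_mul_rpow_div hz).congr' (hlen.mono fun p hp => by rw [← hp.1]; rfl)
    · have := tendsto_sub_mul_rpow_add_div (s := 1) hγ hz (tendsto_const_nhds (x := (1 : ℝ)))
      simp only [Fin.mk_one, Matrix.cons_val_one, Matrix.cons_val_zero, mul_zero, add_zero, one_mul,
        Real.rpow_one] at this ⊢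
      exact this.congr' (hlen.mono fun p hp => by rw [← hp.2]; rfl)
    · exact absurd rfl hi

theorem isHubCliqueGraphon_hubGraphon (hγ : 0 < γ) (hz : Tendsto z (𝓝[>] 0) (𝓝 z₀))
    (hz0 : 0 < z₀) :
    ∀ᶠ p in 𝓝[>] 0, IsHubCliqueGraphon γ p (z p) 0 2 (hubGraphon γ (z p) p) := by
  have h := hubCliqueProfile_hubGraphon hγ hz hz0
  filter_upwards [hz.eventually_const_lt hz0, h.val_eq, h.hub_val 0 (by decide) rfl]
    with p hzp hv hh
  refine .hub _ hzp rfl (fun _ => rfl) ?_ ?_ hh ?_ <;>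
  · rw [hv _ _ (by decide) (by decide)]
    simp [coreVal]

end Hub

section Clique

variable {w : ℝ → ℝ} {w₀ : ℝ}

theorem eventually_cliqueGraphon_len (hγ : 0 < γ) (hw : Tendsto w (𝓝[>] 0) (𝓝 w₀)) :
    ∀ᶠ p in 𝓝[>] 0, (cliqueGraphon γ (w p) p).len 0 = √(w p) * p ^ (1 + γ / 2) ∧
      √(w p) * p ^ (1 + γ / 2) ≤ p := by
  filter_upwards [eventually_mul_rpow_add_le (s := 1) (half_pos hγ) hw.sqrt tendsto_const_nhds
    one_pos, eventually_mem_Ioo one_pos] with p h hp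
  rw [Real.rpow_one, one_mul] at h
  have h0 : 0 ≤ √(w p) * p ^ (1 + γ / 2) :=
    mul_nonneg (Real.sqrt_nonneg _) (Real.rpow_nonneg hp.1.le _)
  exact ⟨volume_real_cutPart₁_zero h0 (h.trans hp.2.le), h⟩

theorem hubCliqueProfile_cliqueGraphon (hγ : 0 < γ) (hw : Tendsto w (𝓝[>] 0) (𝓝 w₀))
    (hw0 : 0 < w₀) :
    HubCliqueProfile γ ![1 / 2, 0] ![√w₀, 1] fun p => cliqueGraphon γ (w p) p := by
  have hlen := eventually_cliqueGraphon_len hγ hw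
  refine HubCliqueProfile.of_regGraphon (fun _ => monotone_cutPart₁ _) rfl ?_ ?_ rfl ?_ ?_ ?_
  · intro i; fin_cases i <;> simp
  · intro i; fin_cases i <;> simp [hw0]
  · intro i hi
    fin_cases i
    · simp only [Fin.zero_eta, Matrix.cons_val_zero, mul_one_div]
      exact (tendsto_mul_rpow_div hw.sqrt).congr' (hlen.mono fun p hp => by rw [← hp.1]; rfl)
    · exact absurd rfl hi
  · filter_upwards [hlen] with p hp
    rw [← hp.1] at hp
    change ∑ i with i ≠ Fin.last 1, (cliqueGraphon γ (w p) p).len i ≤ p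
    rw [Finset.sum_filter, Fin.sum_univ_two]
    simpa [Fin.ext_iff] using hp.2
  · intro i hi
    fin_cases i
    · norm_num
    · exact absurd rfl hi

theorem isHubCliqueGraphon_cliqueGraphon (hγ : 0 < γ) (hw : Tendsto w (𝓝[>] 0) (𝓝 w₀))
    (hw0 : 0 < w₀) :
    ∀ᶠ p in 𝓝[>] 0, IsHubCliqueGraphon γ p 0 (w p) 1 (cliqueGraphon γ (w p) p) := by
  have h := hubCliqueProfile_cliqueGraphon hγ hw hw0
  filter_upwards [hw.eventually_const_lt hw0, h.val_eq] with p hwp hv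
  refine .clique _ rfl hwp (fun _ => rfl) ?_
  rw [hv _ _ (by decide) (by decide)]
  simp only [coreVal, Matrix.cons_val_zero]
  norm_num

end Clique

section HubClique

variable {z w : ℝ → ℝ} {z₀ w₀ : ℝ}

theorem eventually_hubCliqueGraphon_len (hγ : 0 < γ) (hz : Tendsto z (𝓝[>] 0) (𝓝 z₀))
    (hw : Tendsto w (𝓝[>] 0) (𝓝 w₀)) (hz0 : 0 < z₀) (hw0 : 0 < w₀) :
    ∀ᶠ p in 𝓝[>] 0, (hubCliqueGraphon γ (z p) (w p) p).len 0 = z p * p ^ (1 + γ) ∧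
      (hubCliqueGraphon γ (z p) (w p) p).len 1 = √(w p) * p ^ (1 + γ / 2) - z p * p ^ (1 + γ) ∧
      (hubCliqueGraphon γ (z p) (w p) p).len 2 = p - √(w p) * p ^ (1 + γ / 2) := by
  filter_upwards [eventually_mul_rpow_add_le (s := 1 + γ / 2) (half_pos hγ) hz hw.sqrt
    (Real.sqrt_pos.2 hw0), eventually_mul_rpow_add_le (s := 1) (half_pos hγ) hw.sqrt
    tendsto_const_nhds one_pos, hz.eventually_const_lt hz0, eventually_mem_Ioo one_pos]
    with p h h' hzp hp
  rw [Real.rpow_one, one_mul] at h'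
  rw [add_assoc, add_halves] at h
  have h0 : 0 ≤ z p * p ^ (1 + γ) := mul_nonneg hzp.le (Real.rpow_nonneg hp.1.le _)
  exact ⟨volume_real_cutPart₃_zero h0 (h.trans (h'.trans hp.2.le)),
    volume_real_cutPart₃_one h0 h (h'.trans hp.2.le), volume_real_cutPart₃_two h0 h h' hp.2.le⟩

theorem eventually_hubCliqueGraphon_sum_len (hγ : 0 < γ) (hz : Tendsto z (𝓝[>] 0) (𝓝 z₀))
    (hw : Tendsto w (𝓝[>] 0) (𝓝 w₀)) (hz0 : 0 < z₀) (hw0 : 0 < w₀) :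
    ∀ᶠ p in 𝓝[>] 0, ∑ i with i ≠ Fin.last 3, (hubCliqueGraphon γ (z p) (w p) p).len i = p := by
  filter_upwards [eventually_hubCliqueGraphon_len hγ hz hw hz0 hw0] with p h
  rw [Finset.sum_filter, Fin.sum_univ_four, h.1, h.2.1, h.2.2]
  simp [Fin.ext_iff]

theorem hubCliqueProfile_hubCliqueGraphon (hγ : 0 < γ) (hz : Tendsto z (𝓝[>] 0) (𝓝 z₀))
    (hw : Tendsto w (𝓝[>] 0) (𝓝 w₀)) (hz0 : 0 < z₀) (hw0 : 0 < w₀) :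
    HubCliqueProfile γ ![1, 1 / 2, 0, 0] ![z₀, √w₀, 1, 1]
      fun p => hubCliqueGraphon γ (z p) (w p) p := by
  have hlen := eventually_hubCliqueGraphon_len hγ hz hw hz0 hw0
  have hsum := eventually_hubCliqueGraphon_sum_len hγ hz hw hz0 hw0
  refine HubCliqueProfile.of_regGraphon (fun _ => monotone_cutPart₃ _ _ _) rfl ?_ ?_ rfl ?_
    (hsum.mono fun p hp => hp.le) fun _ _ _ => hsum
  · intro i; fin_cases i <;> simp
  · intro i; fin_cases i <;> simp [hz0, hw0]
  · intro i hi
    fin_cases i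
    · simp only [Fin.zero_eta, Matrix.cons_val_zero, mul_one]
      exact (tendsto_mul_rpow_div hz).congr' (hlen.mono fun p hp => by rw [← hp.1]; rfl)
    · have := tendsto_sub_mul_rpow_add_div (s := 1 + γ / 2) (half_pos hγ) hz hw.sqrt
      rw [add_assoc, add_halves] at this
      simp only [Fin.mk_one, Matrix.cons_val_one, Matrix.cons_val_zero, mul_one_div]
      exact this.congr' (hlen.mono fun p hp => by rw [← hp.2.1]; rfl)
    · have := tendsto_sub_mul_rpow_add_div (s := 1) (half_pos hγ) hw.sqrt
        (tendsto_const_nhds (x := (1 : ℝ)))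
      simp only [Fin.reduceFinMk, Matrix.cons_val, mul_zero, add_zero, one_mul, Real.rpow_one] at this ⊢
      exact this.congr' (hlen.mono fun p hp => by rw [← hp.2.2]; rfl)
    · exact absurd rfl hi

theorem isHubCliqueGraphon_hubCliqueGraphon (hγ : 0 < γ) (hz : Tendsto z (𝓝[>] 0) (𝓝 z₀))
    (hw : Tendsto w (𝓝[>] 0) (𝓝 w₀)) (hz0 : 0 < z₀) (hw0 : 0 < w₀) :
    ∀ᶠ p in 𝓝[>] 0,
      IsHubCliqueGraphon γ p (z p) (w p) 3 (hubCliqueGraphon γ (z p) (w p) p) := by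
  have h := hubCliqueProfile_hubCliqueGraphon hγ hz hw hz0 hw0
  filter_upwards [hz.eventually_const_lt hz0, hw.eventually_const_lt hw0, h.val_eq,
    h.hub_val 0 (by decide) rfl] with p hzp hwp hv hh
  refine .hubClique _ hzp hwp (fun _ => rfl) ?_ ?_ ?_ hh ?_ ?_ ?_ <;>
  · rw [hv _ _ (by decide) (by decide)]
    simp only [coreVal, Matrix.cons_val]
    norm_num

end HubClique

end Graphons

/-! ### The upper bound and its attainment -/

section Attained

variable {V : Type*} [Fintype V] {K : SimpleGraph V} {δ z₀ w₀ : ℝ}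

/-- Let `G s p` be block graphons of hub and clique shape with parameters `(1 + s) z₀` and
`(1 + s) w₀`, where `P_K(z₀, w₀) ≥ 1 + δ`. Then some choice of `s = s(p) → 0` makes `Hom` large
enough. -/
theorem exists_tendsto_zero_of_profile (hγ : 0 < K.gammaInv) (hδ : 0 < δ) (hz0 : 0 ≤ z₀)
    (hw0 : 0 ≤ w₀) (hP : 1 + δ ≤ K.upperTailPoly z₀ w₀) {m : ℕ} {κ : Fin (m + 1) → ℝ}
    {C : ℝ → Fin (m + 1) → ℝ} {G : ℝ → ℝ → BlockGraphon m}
    (hG : ∀ s > 0, HubCliqueProfile K.gammaInv κ (C s) (G s))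
    (hC : ∀ s, C s (Fin.last m) = 1) {ih iq id : Fin (m + 1)}
    (hz : 0 < z₀ → ∀ s, (ih ≠ Fin.last m ∧ κ ih = 1 ∧ C s ih = (1 + s) * z₀) ∧
      id ≠ Fin.last m ∧ κ id = 0 ∧ C s id = 1)
    (hw : 0 < w₀ → ∀ s, iq ≠ Fin.last m ∧ κ iq = 1 / 2 ∧ C s iq = √((1 + s) * w₀)) :
    ∃ s : ℝ → ℝ, Tendsto s (𝓝[>] 0) (𝓝 0) ∧
      ∀ᶠ p in 𝓝[>] (0 : ℝ), (1 + δ) * p ^ K.numEdges ≤ (G (s p) p).hom K := by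
  have hQ : ∀ s > 0, ∀ᶠ p in 𝓝[>] (0 : ℝ), (1 + δ) * p ^ K.numEdges ≤ (G s p).hom K := by
    intro s hs
    have hs1 : 0 < 1 + s := by linarith
    refine (hG s hs).eventually_le_hom hγ (mul_nonneg hs1.le hz0) (mul_nonneg hs1.le hw0) (hC s)
      (fun h => hz (pos_of_mul_pos_right h hs1.le) s) (fun h => hw (pos_of_mul_pos_right h hs1.le) s)
      (lt_of_lt_of_le ?_ (SimpleGraph.le_upperTailPoly_mul hz0 hw0 (by linarith)))
    nlinarith
  obtain ⟨s, -, hs, h⟩ := exists_tendsto_zero_of_forall_eventually hQ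
  exact ⟨s, hs, h⟩

/-- The choice of the shape depends on which of `z₀` and `w₀` are positive; they are not both `0`, as
`P_K(0, 0) = 1`. -/
theorem exists_hubCliqueProfile (hγ : 0 < K.gammaInv) (hδ : 0 < δ) (hz0 : 0 ≤ z₀) (hw0 : 0 ≤ w₀)
    (hP : 1 + δ ≤ K.upperTailPoly z₀ w₀) :
    ∃ z w : ℝ → ℝ, Tendsto z (𝓝[>] 0) (𝓝 z₀) ∧ Tendsto w (𝓝[>] 0) (𝓝 w₀) ∧
      ∃ (m : ℕ) (W : ℝ → BlockGraphon m) (κ C : Fin (m + 1) → ℝ),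
        HubCliqueProfile K.gammaInv κ C W ∧
        (∀ᶠ p in 𝓝[>] (0 : ℝ), IsHubCliqueGraphon K.gammaInv p (z p) (w p) m (W p)) ∧
        (∀ᶠ p in 𝓝[>] (0 : ℝ), (1 + δ) * p ^ K.numEdges ≤ (W p).hom K) ∧
        Tendsto (fun p => (W p).entropy p / (p ^ (2 + K.gammaInv) * Real.log (1 / p))) (𝓝[>] 0)
          (𝓝 (2 * (z₀ + w₀ / 2))) := by
  have hlim : ∀ (a : ℝ) {s : ℝ → ℝ}, Tendsto s (𝓝[>] 0) (𝓝 0) →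
      Tendsto (fun p => (1 + s p) * a) (𝓝[>] 0) (𝓝 a) := fun a s hs => by
    simpa using (hs.const_add 1).mul_const a
  rcases hz0.eq_or_lt with rfl | hz0' <;> rcases hw0.eq_or_lt with rfl | hw0'
  · rw [SimpleGraph.upperTailPoly_zero] at hP
    linarith
  · obtain ⟨s, hs, hhom⟩ := exists_tendsto_zero_of_profile (G := fun s p =>
      cliqueGraphon K.gammaInv ((1 + s) * w₀) p) (C := fun s => ![√((1 + s) * w₀), 1])
      (ih := 0) (iq := 0) (id := 0) hγ hδ le_rfl hw0 hP
      (fun s hs => hubCliqueProfile_cliqueGraphon hγ tendsto_const_nhds (by positivity))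
      (fun _ => rfl) (fun h => absurd h (lt_irrefl _)) (fun _ s => ⟨by decide, rfl, rfl⟩)
    have h := hubCliqueProfile_cliqueGraphon hγ (hlim w₀ hs) hw0'
    refine ⟨fun _ => 0, _, tendsto_const_nhds, hlim w₀ hs, 1, _, _, _, h,
      isHubCliqueGraphon_cliqueGraphon hγ (hlim w₀ hs) hw0', hhom, ?_⟩
    convert h.entropy_tendsto hγ using 2
    simp [Fin.sum_univ_two, IsOneBlock, Fin.ext_iff]
    norm_num [hw0]
    ring
  · obtain ⟨s, hs, hhom⟩ := exists_tendsto_zero_of_profile (G := fun s p =>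
      hubGraphon K.gammaInv ((1 + s) * z₀) p) (C := fun s => ![(1 + s) * z₀, 1, 1])
      (ih := 0) (iq := 0) (id := 1) hγ hδ hz0 le_rfl hP
      (fun s hs => hubCliqueProfile_hubGraphon hγ tendsto_const_nhds (by positivity))
      (fun _ => rfl) (fun _ s => ⟨⟨by decide, rfl, rfl⟩, by decide, rfl, rfl⟩)
      (fun h => absurd h (lt_irrefl _))
    have h := hubCliqueProfile_hubGraphon hγ (hlim z₀ hs) hz0'
    refine ⟨_, fun _ => 0, hlim z₀ hs, tendsto_const_nhds, 2, _, _, _, h,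
      isHubCliqueGraphon_hubGraphon hγ (hlim z₀ hs) hz0', hhom, ?_⟩
    convert h.entropy_tendsto hγ using 2
    simp [Fin.sum_univ_three, IsOneBlock, Fin.ext_iff]
    ring
  · obtain ⟨s, hs, hhom⟩ := exists_tendsto_zero_of_profile (G := fun s p =>
      hubCliqueGraphon K.gammaInv ((1 + s) * z₀) ((1 + s) * w₀) p)
      (C := fun s => ![(1 + s) * z₀, √((1 + s) * w₀), 1, 1])
      (ih := 0) (iq := 1) (id := 2) hγ hδ hz0 hw0 hP
      (fun s hs => hubCliqueProfile_hubCliqueGraphon hγ tendsto_const_nhds tendsto_const_nhds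
        (by positivity) (by positivity))
      (fun _ => rfl) (fun _ s => ⟨⟨by decide, rfl, rfl⟩, by decide, rfl, rfl⟩)
      (fun _ s => ⟨by decide, rfl, rfl⟩)
    have h := hubCliqueProfile_hubCliqueGraphon hγ (hlim z₀ hs) (hlim w₀ hs) hz0' hw0'
    refine ⟨_, _, hlim z₀ hs, hlim w₀ hs, 3, _, _, _, h,
      isHubCliqueGraphon_hubCliqueGraphon hγ (hlim z₀ hs) (hlim w₀ hs) hz0' hw0', hhom, ?_⟩
    convert h.entropy_tendsto hγ using 2
    simp [Fin.sum_univ_four, IsOneBlock, Fin.ext_iff]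
    norm_num [hw0]
    ring

end Attained

theorem minEntropy_le {V : Type*} [Fintype V] {K : SimpleGraph V} {δ p : ℝ} (hp0 : 0 < p)
    (hp1 : p < 1) {W : Graphon} (hreg : W.IsRegular p)
    (hhom : (1 + δ) * p ^ K.numEdges ≤ W.toSymmKernel.hom K) :
    minEntropy K δ p ≤ W.entropy p :=
  csInf_le ⟨0, by rintro _ ⟨W, -, -, rfl⟩; exact W.entropy_nonneg hp0 hp1⟩ ⟨W, hreg, hhom, rfl⟩

theorem theorem2p11 {V : Type*} [Fintype V] (K : SimpleGraph V)
    (hK : ∀ v, ∃ u, K.Adj v u) (hforest : ¬ K.IsAcyclic) (hcore : ¬ K.twoCore.IsCycles)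
    (δ : ℝ) (hδ : 0 < δ) :
    ((fun p : ℝ => p ^ (2 + K.gammaInv)) =O[𝓝[>] 0] fun p => minEntropy K δ p) ∧
    (∃ ε : ℝ → ℝ, Tendsto ε (𝓝[>] 0) (𝓝 0) ∧ ∀ᶠ p in 𝓝[>] (0 : ℝ),
      minEntropy K δ p ≤
        (2 + ε p) * K.rho δ * p ^ (2 + K.gammaInv) * Real.log (1 / p)) ∧
    ∃ z₀ w₀ : ℝ, 0 ≤ z₀ ∧ 0 ≤ w₀ ∧ 1 + δ ≤ K.upperTailPoly z₀ w₀ ∧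
      z₀ + w₀ / 2 = K.rho δ ∧
      ∃ z w : ℝ → ℝ, Tendsto z (𝓝[>] 0) (𝓝 z₀) ∧ Tendsto w (𝓝[>] 0) (𝓝 w₀) ∧
        ∃ (m : ℕ) (W : ℝ → BlockGraphon m),
          (∀ᶠ p in 𝓝[>] (0 : ℝ),
            IsHubCliqueGraphon K.gammaInv p (z p) (w p) m (W p) ∧
            (W p).toGraphon.IsRegular p ∧
            (1 + δ) * p ^ K.numEdges ≤ (W p).hom K) ∧
          ((fun p => (W p).entropy p) ~[𝓝[>] 0]
            fun p => 2 * K.rho δ * p ^ (2 + K.gammaInv) * Real.log (1 / p)) ∧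
          ∀ (n : ℕ → ℕ) (p : ℕ → ℝ), Tendsto n atTop atTop → Tendsto p atTop (𝓝[>] 0) →
            ((fun t => ((n t : ℝ)⁻¹ * Real.log (n t)) ^
              (1 / (2 * (K.numEdges : ℝ) - 2 - K.gammaInv))) =o[atTop] p) →
            UpperTailLowerBoundConditions K n p (fun t => W (p t)) := by
  have hbot := SimpleGraph.ne_bot_of_not_isCycles hcore
  have hγ := SimpleGraph.gammaInv_pos hcore
  obtain ⟨z₀, w₀, hz0, hw0, hP, hρ⟩ := SimpleGraph.exists_eq_rho hbot hγ hδ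
  have hρ0 : 0 < K.rho δ := by
    rw [← hρ]
    rcases hz0.eq_or_lt with rfl | hz0'
    · rcases hw0.eq_or_lt with rfl | hw0'
      · rw [SimpleGraph.upperTailPoly_zero] at hP
        linarith
      · linarith
    · linarith
  obtain ⟨z, w, hz, hw, m, W, κ, C, hprof, hshape, hhom, hE⟩ :=
    exists_hubCliqueProfile hγ hδ hz0 hw0 hP
  rw [hρ] at hE
  have hreg : ∀ᶠ p in 𝓝[>] 0, (W p).toGraphon.IsRegular p :=
    hprof.row_sum.mono fun p hp => (W p).isRegular_of_sum_eq hp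
  have hp1 := eventually_mem_Ioo (one_pos (α := ℝ))
  have hpos : ∀ p : ℝ, 0 < p ∧ p < 1 → 0 < p ^ (2 + K.gammaInv) * Real.log (1 / p) :=
    fun p hp => mul_pos (Real.rpow_pos_of_pos hp.1 _)
      (Real.log_pos (by rw [lt_div_iff₀ hp.1]; linarith [hp.2]))
  refine ⟨?_, ?_, z₀, w₀, hz0, hw0, hP, hρ, z, w, hz, hw, m, W, ?_, ?_, ?_⟩
  · obtain ⟨c, hc, hlow⟩ := Graphon.exists_mul_rpow_le_entropy K hγ hδ
    refine IsBigO.of_bound c⁻¹ ?_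
    filter_upwards [hreg, hhom, hp1] with p hr hh hp
    have h : c * p ^ (2 + K.gammaInv) ≤ minEntropy K δ p := by
      refine le_csInf ⟨_, (W p).toGraphon, hr, hh, rfl⟩ ?_
      rintro _ ⟨W', hr', hh', rfl⟩
      exact hlow p hp.1 hp.2 W' hr' hh'
    rw [Real.norm_of_nonneg (Real.rpow_nonneg hp.1.le _), le_inv_mul_iff₀ hc]
    exact h.trans (Real.le_norm_self _)
  · refine ⟨fun p => (W p).entropy p / (p ^ (2 + K.gammaInv) * Real.log (1 / p)) / K.rho δ - 2,
      ?_, ?_⟩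
    · have := (hE.div_const (K.rho δ)).sub_const 2
      rwa [mul_div_cancel_right₀ _ hρ0.ne', sub_self] at this
    · filter_upwards [hreg, hhom, hp1] with p hr hh hp
      refine (minEntropy_le hp.1 hp.2 hr hh).trans_eq ?_
      have := (hpos p hp).ne'
      rw [add_sub_cancel, div_mul_cancel₀ _ hρ0.ne', mul_assoc, div_mul_cancel₀ _ this]
      rfl
  · filter_upwards [hshape, hreg, hhom] with p h1 h2 h3
    exact ⟨h1, h2, h3⟩
  · have hne : ∀ᶠ p in 𝓝[>] 0,
        2 * K.rho δ * p ^ (2 + K.gammaInv) * Real.log (1 / p) ≠ 0 := by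
      filter_upwards [hp1] with p hp
      rw [mul_assoc]
      exact (mul_pos (by linarith) (hpos p hp)).ne'
    refine (isEquivalent_iff_tendsto_one hne).2 ?_
    have := hE.div_const (2 * K.rho δ)
    rw [div_self (by linarith : 2 * K.rho δ ≠ 0)] at this
    refine this.congr fun p => ?_
    simp only [Pi.div_apply]
    rw [div_div, mul_comm _ (2 * K.rho δ), ← mul_assoc]
  · intro n p hn hp hnp
    exact hprof.upperTailLowerBoundConditions hγ hbot (by linarith) hE ⟨δ, hδ, hhom⟩ hn hp hnp
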